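/- **Setting.** An instance of discrete Bamboo Garden Trimming consists of $n\ge 1$ growth rates $h_1\ge h_2\ge\dots\ge h_n>0$; let $H=\sum_i h_i$. Pairs $(p_i,q_i)$, $1\le i\le n$, of a non-negative and a positive integer represent a gap-free cyclic schedule if, when item $i$ is placed at the positions $p_i+kq_i$, $k\ge 0$, each of the positions $0,1,2,\dots$ receives exactly one item. **The Main Algorithm.** 1. Let $\delta=3\sqrt{h_1/H}$ and $f''_i=(1+\delta)H/h_i$. Let $\mathit{min}$ be the largest integer with $2^{\mathit{min}}\le f''_1$, let $\mathit{max}$ be the smallest integer with $2^{\mathit{max}+1}>f''_n$, and let $C=2^{\lfloor \mathit{min}/2\rfloor}$. 2. Let $f_i$ be the largest number $\le f''_i$ of the form $2^k(1+j/C)$ with integers $k\ge \mathit{min}$ and $0\le j\le C-1$. The frequencies equal to $2^k(1+j/C)$ form group $j$ of layer $k$. Start with the multiset of frequencies $f_1,\dots,f_n$. Combining $m$ equal frequencies $v$ means replacing them by one frequency $v/m$; this is recorded in an ordered tree, whose leaves are the items and whose nodes are the combined frequencies. 3. For $k=\mathit{max},\dots,\mathit{min}+1$ and $j=C-1,\dots,1$: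 combine pairs of frequencies in group $j$ of layer $k$ as many times as possible. 4. For $j=C-1,\dots,1$: combine $C+j$ frequencies in group $j$ of layer $\mathit{min}$ as many times as possible. 5. For $k=\mathit{max},\dots,\mathit{min}$ and $j=C-1,\dots,1$: combine the frequencies in group $j$ of layer $k$ as many times as possible, in pairs if $k>\mathit{min}$ and $C+j$ at a time if $k=\mathit{min}$; then reduce every frequency left in this group to $2^k(1+(j-1)/C)$. 6. While there are at least two frequencies, replace two largest ones $a\le b$ by one frequency $a/2$, again recorded by a tree node, with the tree of $a$ as first child and that of $b$ as second. The last frequency receives all positions $0+k\cdot 1$, $k\ge 0$. Expand the trees: if a node with $m$ children is placed at the positions $p+kq$, $k\ge 0$, then its child number $l\in\{0,\dots,m-1\}$ is placed at the positions $(p+lq)+k(mq)$. Output the pairs $(p_i,q_i)$ of the items. Which of several equal frequencies are combined, and in which order, is left open, so an instance may have several possible outputs. **Machine.** A real RAM has registers and arrays that hold real numbers. It runs a fixed finite program (assignment, sequence, conditional, while loop) in which only integer constants occur. Each constant, each register or array access (with a computed index, rounded down), each operation $+,-,\cdot,/,\sqrt{\ },\log,\lfloor\ \rfloor$ on real numbers,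 each comparison, each Boolean connective, and each assignment, branch or loop test costs a bounded number of steps. **Theorem.** There are real-RAM programs $\mathtt{main}$, $\mathtt{setup}$, $\mathtt{next}$ and a constant $c$ such that the following hold. (a) For all $n\ge1$ and $h_1\ge\dots\ge h_n>0$, the program $\mathtt{main}$, started with only $n$ and $h_1,\dots,h_n$ in memory, halts after at most $c\,n\log(n+1)$ steps (that is, in time $O(n\log n)$ for $n\ge 2$). Its memory then holds pairs $(p_i,q_i)$ that are an output of the Main Algorithm for $(h_1,\dots,h_n)$ and that represent a gap-free cyclic schedule. (b) For every $n$ and all pairs $(p_i,q_i)$, $1\le i\le n$, that represent a gap-free cyclic schedule (in particular for those of (a)), the schedule can be generated step by step with a priority queue, as follows. Started with only $n$ and the pairs in memory, $\mathtt{setup}$ halts after at most $c\,n\log(n+1)$ steps and leaves a binary min-heap of the pairs $(i,t_i)$ with key $t_i$, where $t_i=p_i$. After this, $\mathtt{next}$ is run once for each of $T=0,1,2,\dots$, each time on the memory left by the previous run. Each run takes at most $c\log(n+1)$ steps, outputs the item $i$ whose $t_i$ is smallest, replaces $t_i$ by $t_i+q_i$, and leaves a binary min-heap of the updated pairs. The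 item output in run $T$ is the item scheduled at position $T$. -/

import Mathlib

namespace BambooGarden

/-! ### The real random access machine: structured programs with a step count -/

/-- The memory of the machine: scalar registers and one-dimensional arrays, all holding real
numbers. A program mentions only finitely many registers and arrays. -/
structure Mem where
  reg : ℕ → ℝ
  arr : ℕ → ℕ → ℝ

/-- Expressions over the registers and the array cells. Only integers occur as constants. -/
inductive RExpr where
  | const (z : ℤ)
  | reg (r : ℕ)
  | cell (a : ℕ) (index : RExpr)
  | add (x y : RExpr)
  | sub (x y : RExpr)
  | mul (x y : RExpr)
  | divide (x y : RExpr)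
  | sqrt (x : RExpr)
  | log (x : RExpr)
  | floor (x : RExpr)

/-- The value of an expression. An array index is rounded down to a natural number. -/
noncomputable def RExpr.eval (σ : Mem) : RExpr → ℝ
  | const z => (z : ℝ)
  | reg r => σ.reg r
  | cell a e => σ.arr a ⌊e.eval σ⌋₊
  | add x y => x.eval σ + y.eval σ
  | sub x y => x.eval σ - y.eval σ
  | mul x y => x.eval σ * y.eval σ
  | divide x y => x.eval σ / y.eval σ
  | sqrt x => Real.sqrt (x.eval σ)
  | log x => Real.log (x.eval σ)
  | floor x => ((⌊x.eval σ⌋ : ℤ) : ℝ)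

/-- The cost of an expression: one step for each constant, memory access and operation. -/
def RExpr.cost : RExpr → ℕ
  | const _ => 1
  | reg _ => 1
  | cell _ e => e.cost + 1
  | add x y => x.cost + y.cost + 1
  | sub x y => x.cost + y.cost + 1
  | mul x y => x.cost + y.cost + 1
  | divide x y => x.cost + y.cost + 1
  | sqrt x => x.cost + 1
  | log x => x.cost + 1
  | floor x => x.cost + 1

/-- Boolean tests. -/
inductive RTest where
  | le (x y : RExpr)
  | not (b : RTest)
  | and (b c : RTest)

/-- The truth value of a test. -/
def RTest.holds (σ : Mem) : RTest → Prop
  | le x y => x.eval σ ≤ y.eval σ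
  | not b => ¬ b.holds σ
  | and b c => b.holds σ ∧ c.holds σ

/-- The cost of evaluating a test. -/
def RTest.cost : RTest → ℕ
  | le x y => x.cost + y.cost + 1
  | not b => b.cost + 1
  | and b c => b.cost + c.cost + 1

/-- Programs. A program is a finite object that does not depend on the input. -/
inductive Prog where
  | skip
  | setReg (r : ℕ) (e : RExpr)
  | setCell (a : ℕ) (index e : RExpr)
  | seq (P Q : Prog)
  | ite (b : RTest) (P Q : Prog)
  | loop (b : RTest) (P : Prog)

/-- The memory after assigning `x` to register `r`. -/
def Mem.setReg (σ : Mem) (r : ℕ) (x : ℝ) : Mem :=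
  { σ with reg := Function.update σ.reg r x }

/-- The memory after assigning `x` to cell `i` of array `a`. -/
def Mem.setCell (σ : Mem) (a i : ℕ) (x : ℝ) : Mem :=
  { σ with arr := Function.update σ.arr a (Function.update (σ.arr a) i x) }

/-- `Exec P σ σ' τ`: started with memory `σ`, the program `P` halts with memory `σ'` after
exactly `τ` steps. -/
inductive Exec : Prog → Mem → Mem → ℕ → Prop
  | skip (σ : Mem) : Exec Prog.skip σ σ 1
  | setReg (σ : Mem) (r : ℕ) (e : RExpr) :
      Exec (Prog.setReg r e) σ (σ.setReg r (e.eval σ)) (e.cost + 1)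
  | setCell (σ : Mem) (a : ℕ) (i e : RExpr) :
      Exec (Prog.setCell a i e) σ (σ.setCell a ⌊i.eval σ⌋₊ (e.eval σ)) (i.cost + e.cost + 1)
  | seq {P Q : Prog} {σ σ' σ'' : Mem} {τ τ' : ℕ} (hP : Exec P σ σ' τ) (hQ : Exec Q σ' σ'' τ') :
      Exec (Prog.seq P Q) σ σ'' (τ + τ')
  | iteTrue {b : RTest} {P Q : Prog} {σ σ' : Mem} {τ : ℕ} (hb : b.holds σ)
      (hP : Exec P σ σ' τ) : Exec (Prog.ite b P Q) σ σ' (b.cost + 1 + τ)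
  | iteFalse {b : RTest} {P Q : Prog} {σ σ' : Mem} {τ : ℕ} (hb : ¬ b.holds σ)
      (hQ : Exec Q σ σ' τ) : Exec (Prog.ite b P Q) σ σ' (b.cost + 1 + τ)
  | loopDone {b : RTest} {P : Prog} {σ : Mem} (hb : ¬ b.holds σ) :
      Exec (Prog.loop b P) σ σ (b.cost + 1)
  | loopNext {b : RTest} {P : Prog} {σ σ' σ'' : Mem} {τ τ' : ℕ} (hb : b.holds σ)
      (hP : Exec P σ σ' τ) (hL : Exec (Prog.loop b P) σ' σ'' τ') :
      Exec (Prog.loop b P) σ σ'' (b.cost + 1 + τ + τ')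

/-- The memory that holds `n` in register `0`, the vector `h` in array `0`, and `0` elsewhere. -/
noncomputable def inputMem {n : ℕ} (h : Fin n → ℝ) : Mem where
  reg r := if r = 0 then (n : ℝ) else 0
  arr a i := if hi : i < n then (if a = 0 then h ⟨i, hi⟩ else 0) else 0

/-- The memory that holds `n` in register `0`, the vectors `p` and `q` in the arrays `1` and `2`,
and `0` elsewhere. -/
noncomputable def pairsMem {n : ℕ} (p q : Fin n → ℕ) : Mem where
  reg r := if r = 0 then (n : ℝ) else 0
  arr a i := if hi : i < n then
    (if a = 1 then (p ⟨i, hi⟩ : ℝ) else if a = 2 then (q ⟨i, hi⟩ : ℝ) else 0) else 0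

/-- The arrays `1` and `2` of the memory `σ` hold the vectors `p` and `q`. -/
def HoldsPairs {n : ℕ} (σ : Mem) (p q : Fin n → ℕ) : Prop :=
  ∀ i : Fin n, σ.arr 1 i = (p i : ℝ) ∧ σ.arr 2 i = (q i : ℝ)

/-- The arrays `3` and `4` of the memory `σ` hold the pairs `(i, t i)` as a binary heap with
smallest key `t i` at the top: position `j` holds the pair of the item `e j`, and the parent of
a position `j > 0` is the position `(j - 1) / 2`. -/
def HoldsQueue {n : ℕ} (σ : Mem) (t : Fin n → ℕ) : Prop :=
  ∃ e : Equiv.Perm (Fin n),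
    (∀ j : Fin n, σ.arr 3 j = ((e j : ℕ) : ℝ) ∧ σ.arr 4 j = (t (e j) : ℝ)) ∧
    ∀ j : ℕ, 0 < j → j < n → σ.arr 4 ((j - 1) / 2) ≤ σ.arr 4 j

/-! ### Cyclic schedules -/

/-- The pairs `(p i, q i)` represent a cyclic schedule without gaps: when item `i` is placed at the
positions `p i + k * q i`, `k ≥ 0`, every position `0, 1, 2, …` receives exactly one item. -/
def IsCyclicSchedule {n : ℕ} (p q : Fin n → ℕ) : Prop :=
  (∀ i, 0 < q i) ∧ ∀ T : ℕ, ∃! i : Fin n, ∃ k : ℕ, T = p i + k * q i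

/-! ### The Main Algorithm

The algorithm leaves open which of several equal frequencies are combined and in which order, so
it is given as a relation between its input and its possible outputs. -/

/-- Ordered trees that record how frequencies are combined. The leaf `i` is the frequency of
item `i`; a node with `m` children is a frequency that replaces `m` frequencies. -/
inductive FTree (n : ℕ) where
  | leaf (i : Fin n)
  | node (m : ℕ) (child : Fin m → FTree n)

/-- `Places t p q i p' q'`: if the frequency with tree `t` is placed at the positions `p + k * q`,
then expanding the tree places item `i` at the positions `p' + k * q'`. The occurrences of a node
are given to its `m` children in turn. -/
inductive Places {n : ℕ} : FTree n → ℕ → ℕ → Fin n → ℕ → ℕ → Prop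
  | leaf (i : Fin n) (p q : ℕ) : Places (FTree.leaf i) p q i p q
  | node {m : ℕ} {child : Fin m → FTree n} {p q : ℕ} {i : Fin n} {p' q' : ℕ} (l : Fin m)
      (hl : Places (child l) (p + (l : ℕ) * q) (m * q) i p' q') :
      Places (FTree.node m child) p q i p' q'

/-- A current sequence of frequencies, each with its value and its tree; only the
multiset matters. -/
abbrev Freqs (n : ℕ) := Multiset (ℝ × FTree n)

/-- Replace `m` frequencies of the same value `v` by one frequency `v / m`. -/
inductive Combine {n : ℕ} (m : ℕ) (v : ℝ) : Freqs n → Freqs n → Prop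
  | mk (R : Freqs n) (child : Fin m → FTree n) :
      Combine m v (R + Finset.univ.val.map fun l => (v, child l))
        (R + {(v / m, FTree.node m child)})

/-- Combine groups of `m` frequencies of value `v` as many times as possible. -/
def CombineAll {n : ℕ} (m : ℕ) (v : ℝ) (S S' : Freqs n) : Prop :=
  Relation.ReflTransGen (Combine m v) S S' ∧ Multiset.countP (fun x => x.1 = v) S' < m

/-- Change every frequency of value `v` to the value `w`. -/
noncomputable def pushDown {n : ℕ} (v w : ℝ) (S : Freqs n) : Freqs n :=
  S.map fun x => if x.1 = v then (w, x.2) else x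

/-- Perform the steps `R a` one after another, for the entries `a` of a list in this order. -/
def ForEach {α β : Type} (R : α → β → β → Prop) : List α → β → β → Prop
  | [] => Eq
  | a :: l => Relation.Comp (R a) (ForEach R l)

/-- The frequency `2 ^ k * (1 + j / C)`, of group `j` in layer `k`. -/
noncomputable def gridFreq (C k j : ℕ) : ℝ := 2 ^ k * (1 + (j : ℝ) / C)

/-- The list `b, b - 1, …, a`. -/
def downTo (b a : ℕ) : List ℕ := (List.Ico a (b + 1)).reverse

/-- Step 3: for `k = hi, …, lo + 1` and `1 ≤ j ≤ C - 1`, combine pairs of frequencies. -/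
def Step3 {n : ℕ} (lo hi C : ℕ) : Freqs n → Freqs n → Prop :=
  ForEach (fun k => ForEach (fun j => CombineAll 2 (gridFreq C k j)) (downTo (C - 1) 1))
    (downTo hi (lo + 1))

/-- Step 4: in layer `lo`, for `1 ≤ j ≤ C - 1`, combine `C + j` frequencies of group `j`. -/
def Step4 {n : ℕ} (lo C : ℕ) : Freqs n → Freqs n → Prop :=
  ForEach (fun j => CombineAll (C + j) (gridFreq C lo j)) (downTo (C - 1) 1)

/-- Step 5: for `k = hi, …, lo` and `j = C - 1, …, 1`, combine the frequencies of group `j` in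
layer `k`, in pairs if `k > lo` and by `C + j` if `k = lo`, and push the remaining ones down to
group `j - 1`. -/
def Step5 {n : ℕ} (lo hi C : ℕ) : Freqs n → Freqs n → Prop :=
  ForEach (fun k => ForEach (fun j S S' => ∃ S₁,
      CombineAll (if k = lo then C + j else 2) (gridFreq C k j) S S₁ ∧
      S' = pushDown (gridFreq C k j) (gridFreq C k (j - 1)) S₁) (downTo (C - 1) 1))
    (downTo hi lo)

/-- One reduction of the scheduler for powers-of-two frequencies: two largest frequencies `a ≤ b`
are replaced by one frequency `a / 2`, whose occurrences they share alternatingly. -/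
inductive MergeLargest {n : ℕ} : Freqs n → Freqs n → Prop
  | mk (R : Freqs n) (a b : ℝ) (s t : FTree n) (hab : a ≤ b) (hR : ∀ x ∈ R, x.1 ≤ a) :
      MergeLargest (R + {(a, s), (b, t)}) (R + {(a / 2, FTree.node 2 ![s, t])})

/-- Step 6: merge the frequencies into a single one, use that one in every position `0 + k * 1`,
and expand its tree. -/
def Step6 {n : ℕ} (S : Freqs n) (p q : Fin n → ℕ) : Prop :=
  ∃ (v : ℝ) (t : FTree n), Relation.ReflTransGen MergeLargest S {(v, t)} ∧
    ∀ i, Places t 0 1 i (p i) (q i)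

/-- The parameter `δ = 3 √(h₁ / H)`, where `H` is the sum of the growth rates. -/
noncomputable def delta {n : ℕ} (hn : 0 < n) (h : Fin n → ℝ) : ℝ :=
  3 * Real.sqrt (h ⟨0, hn⟩ / ∑ i, h i)

/-- The initial frequencies `(1 + δ) H / h i`. -/
noncomputable def initialFreq {n : ℕ} (hn : 0 < n) (h : Fin n → ℝ) (i : Fin n) : ℝ :=
  (1 + delta hn h) * (∑ j, h j) / h i

/-- `MainAlgorithm hn h p q`: the pairs `(p i, q i)` are a possible output of the Main Algorithm
for the growth rates `h`. -/
def MainAlgorithm {n : ℕ} (hn : 0 < n) (h : Fin n → ℝ) (p q : Fin n → ℕ) : Prop :=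
  ∃ (lo hi C : ℕ) (f : Fin n → ℝ) (S₃ S₄ S₅ : Freqs n),
    IsGreatest {m : ℕ | (2 : ℝ) ^ m ≤ initialFreq hn h ⟨0, hn⟩} lo ∧
    IsLeast {m : ℕ | initialFreq hn h ⟨n - 1, Nat.sub_lt hn one_pos⟩ < (2 : ℝ) ^ (m + 1)} hi ∧
    C = 2 ^ (lo / 2) ∧
    (∀ i, IsGreatest
      {x : ℝ | x ≤ initialFreq hn h i ∧ ∃ k j : ℕ, lo ≤ k ∧ j < C ∧ x = gridFreq C k j} (f i)) ∧
    Step3 lo hi C (Finset.univ.val.map fun i => (f i, FTree.leaf i)) S₃ ∧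
    Step4 lo C S₃ S₄ ∧
    Step5 lo hi C S₄ S₅ ∧
    Step6 S₅ p q

end BambooGarden

/-! Time. Neither the number of layers nor the size of the frequencies is bounded in terms of `n`,
so the machine can neither visit all groups nor compute the powers `2 ^ k` by repeated doubling. A
grid frequency `2 ^ k * (1 + j / C)` is therefore represented by the integer `k * C + j`. This
coding is strictly increasing (`gridVal_strictMono`), halving a frequency subtracts `C` from its key
(`gridVal_sub`), and dividing a frequency of layer `lo` by `C + j` gives exactly a power of two
(`gridVal_div`). The keys of the items come from logarithms and a bisection with about `lo / 2`
rounds. As `2 ^ lo ≤ 4 * n`, this is `O(log n)` per item.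

Steps 3 and 4 together are one pass over the keys in descending order, and Step 5 is a second one;
the passes differ only in whether leftovers are pushed down (`KeyStep`, `Desc`, `forEach_of_desc`).
A combination always produces a smaller key (`combinedKey_lt`), so a priority queue ordered by keys
meets every frequency in time. The pass jumps from event to event: keys without frequencies are
skipped, and pushing a whole group down changes a single register (`Descent.move_empty`,
`Descent.move_push`). The potential `9 * H.card + 6 * T.card`, counted in heap operations, pays for
popping, combining and flushing, whatever the number of layers (`descendAction_spec`). Step 6 pops
the heap twice per merge. Each combination removes at least one root, so there are fewer than `2 *
n` trees; parents have larger names than their children, and one backward sweep expands all trees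
(`expandProg_spec`).

Correctness of the schedule does not depend on the frequencies. Every operation keeps each item as a
leaf of exactly one tree, and a node with `m` children hands its occurrences out by residues modulo
`m`. Hence the final tree puts exactly one item into every position
(`MainAlgorithm.isCyclicSchedule`).

For part (b), the key of item `i` before run `T` is the first position of `i` that is at least `T`.
Exactly one item has key `T`, it is at the top of the heap, and one sift restores the order
(`exists_queue_run`). -/

namespace BambooGarden

/-! ### Reasoning about programs -/

attribute [simp] RExpr.eval RExpr.cost RTest.holds RTest.cost

/-- The test `x < y`. -/
def RTest.lt (x y : RExpr) : RTest := RTest.not (RTest.le y x)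

/-- The test `x = y`. -/
def RTest.eq (x y : RExpr) : RTest := RTest.and (RTest.le x y) (RTest.le y x)

@[simp] theorem RTest.holds_lt (σ : Mem) (x y : RExpr) :
    (RTest.lt x y).holds σ ↔ x.eval σ < y.eval σ := by simp [RTest.lt]

@[simp] theorem RTest.holds_eq (σ : Mem) (x y : RExpr) :
    (RTest.eq x y).holds σ ↔ x.eval σ = y.eval σ := by
  simp [RTest.eq, le_antisymm_iff]

@[simp] theorem RTest.cost_lt (x y : RExpr) :
    (RTest.lt x y).cost = y.cost + x.cost + 2 := by simp [RTest.lt]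

@[simp] theorem RTest.cost_eq (x y : RExpr) :
    (RTest.eq x y).cost = (x.cost + y.cost + 1) + (y.cost + x.cost + 1) + 1 := by simp [RTest.eq]

@[simp] theorem Mem.reg_setReg (σ : Mem) (r : ℕ) (x : ℝ) (r' : ℕ) :
    (σ.setReg r x).reg r' = if r' = r then x else σ.reg r' := by
  simp [Mem.setReg, Function.update_apply]

@[simp] theorem Mem.arr_setReg (σ : Mem) (r : ℕ) (x : ℝ) : (σ.setReg r x).arr = σ.arr := rfl

@[simp] theorem Mem.reg_setCell (σ : Mem) (a i : ℕ) (x : ℝ) : (σ.setCell a i x).reg = σ.reg := rfl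

@[simp] theorem Mem.arr_setCell (σ : Mem) (a i : ℕ) (x : ℝ) (a' i' : ℕ) :
    (σ.setCell a i x).arr a' i' =
      if a' = a then (if i' = i then x else σ.arr a i') else σ.arr a' i' := by
  by_cases h : a' = a
  · subst h; simp [Mem.setCell, Function.update_apply]
  · simp [Mem.setCell, h]

/-- Started with memory `σ`, the program `P` halts, and the final memory and the number of steps
satisfy `Q`. -/
def Runs (P : Prog) (σ : Mem) (Q : Mem → ℕ → Prop) : Prop :=
  ∃ σ' τ, Exec P σ σ' τ ∧ Q σ' τ

namespace Runs

variable {P P' : Prog} {σ : Mem} {Q Q' : Mem → ℕ → Prop} {b : RTest}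

theorem mono (h : Runs P σ Q) (hQ : ∀ σ' τ, Q σ' τ → Q' σ' τ) : Runs P σ Q' := by
  obtain ⟨σ', τ, h, hq⟩ := h
  exact ⟨σ', τ, h, hQ _ _ hq⟩

theorem skip (h : Q σ 1) : Runs Prog.skip σ Q := ⟨_, _, Exec.skip σ, h⟩

theorem setReg {r : ℕ} {e : RExpr} (h : Q (σ.setReg r (e.eval σ)) (e.cost + 1)) :
    Runs (Prog.setReg r e) σ Q := ⟨_, _, Exec.setReg σ r e, h⟩

theorem setCell {a : ℕ} {i e : RExpr}
    (h : Q (σ.setCell a ⌊i.eval σ⌋₊ (e.eval σ)) (i.cost + e.cost + 1)) :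
    Runs (Prog.setCell a i e) σ Q := ⟨_, _, Exec.setCell σ a i e, h⟩

theorem seq (h : Runs P σ fun σ₁ τ₁ => Runs P' σ₁ fun σ₂ τ₂ => Q σ₂ (τ₁ + τ₂)) :
    Runs (Prog.seq P P') σ Q := by
  obtain ⟨σ₁, τ₁, h₁, σ₂, τ₂, h₂, hq⟩ := h
  exact ⟨_, _, Exec.seq h₁ h₂, hq⟩

theorem ite (h₁ : b.holds σ → Runs P σ fun σ' τ => Q σ' (b.cost + 1 + τ))
    (h₂ : ¬ b.holds σ → Runs P' σ fun σ' τ => Q σ' (b.cost + 1 + τ)) :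
    Runs (Prog.ite b P P') σ Q := by
  by_cases hb : b.holds σ
  · obtain ⟨σ', τ, h, hq⟩ := h₁ hb
    exact ⟨_, _, Exec.iteTrue hb h, hq⟩
  · obtain ⟨σ', τ, h, hq⟩ := h₂ hb
    exact ⟨_, _, Exec.iteFalse hb h, hq⟩

/-- A loop runs within a budget that pays for every test and every run of the body. -/
theorem loop (I : Mem → ℕ → Prop) (B : ℕ) (hI : I σ B)
    (hbody : ∀ σ B, I σ B → b.holds σ →
      Runs P σ fun σ' τ => ∃ B', I σ' B' ∧ τ + B' + (b.cost + 1) ≤ B)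
    (hQ : ∀ σ' τ B', I σ' B' → ¬ b.holds σ' → τ + B' ≤ B + (b.cost + 1) → Q σ' τ) :
    Runs (Prog.loop b P) σ Q := by
  suffices H : ∀ B σ, I σ B → ∃ σ' τ B', Exec (Prog.loop b P) σ σ' τ ∧ I σ' B' ∧ ¬ b.holds σ' ∧
      τ + B' ≤ B + (b.cost + 1) by
    obtain ⟨σ', τ, B', h₁, h₂, h₃, h₄⟩ := H B σ hI
    exact ⟨σ', τ, h₁, hQ _ _ _ h₂ h₃ h₄⟩
  intro B
  -- Every pass spends at least the cost of one test, so the budget strictly decreases and serves as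
  -- termination measure as well.
  induction B using Nat.strong_induction_on with
  | _ B ih =>
    intro σ hI
    by_cases hb : b.holds σ
    · obtain ⟨σ₁, τ₁, h₁, B₁, hI₁, hB₁⟩ := hbody σ B hI hb
      obtain ⟨σ₂, τ₂, B₂, h₂, hI₂, hb₂, hB₂⟩ := ih B₁ (by omega) σ₁ hI₁
      exact ⟨σ₂, _, B₂, Exec.loopNext hb h₁ h₂, hI₂, hb₂, by omega⟩
    · exact ⟨σ, _, B, Exec.loopDone hb, hI, hb, by omega⟩

end Runs

/-! ### What a program leaves unchanged -/

/-- Whether a program has an assignment to the register `r`. -/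
def Prog.writesReg (r : ℕ) : Prog → Bool
  | skip => false
  | setReg r' _ => r == r'
  | setCell _ _ _ => false
  | seq P Q => P.writesReg r || Q.writesReg r
  | ite _ P Q => P.writesReg r || Q.writesReg r
  | loop _ P => P.writesReg r

/-- Whether a program has an assignment to the array `a`. -/
def Prog.writesArr (a : ℕ) : Prog → Bool
  | skip => false
  | setReg _ _ => false
  | setCell a' _ _ => a == a'
  | seq P Q => P.writesArr a || Q.writesArr a
  | ite _ P Q => P.writesArr a || Q.writesArr a
  | loop _ P => P.writesArr a

/-- The memories `σ` and `σ'` agree where `P` does not write. -/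
def Frame (P : Prog) (σ σ' : Mem) : Prop :=
  (∀ r, P.writesReg r = false → σ'.reg r = σ.reg r) ∧
    ∀ a, P.writesArr a = false → σ'.arr a = σ.arr a

/-- With this, a specification need only describe what its program changes. For a concrete program
the side conditions of `Frame` evaluate, so `rfl` proves them. -/
theorem Exec.frame {P : Prog} {σ σ' : Mem} {τ : ℕ} (h : Exec P σ σ' τ) : Frame P σ σ' := by
  unfold Frame
  induction h with
  | skip => simp
  | setReg σ r e =>
    refine ⟨fun r' h => ?_, fun a _ => rfl⟩
    have : r' ≠ r := by simpa [Prog.writesReg] using h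
    simp [this]
  | setCell σ a i e =>
    refine ⟨fun r' h => rfl, fun a' h => ?_⟩
    have : a' ≠ a := by simpa [Prog.writesArr] using h
    funext i'
    simp [this]
  | seq _ _ ih₁ ih₂ =>
    refine ⟨fun r h => ?_, fun a h => ?_⟩
    · simp only [Prog.writesReg, Bool.or_eq_false_iff] at h
      rw [ih₂.1 r h.2, ih₁.1 r h.1]
    · simp only [Prog.writesArr, Bool.or_eq_false_iff] at h
      rw [ih₂.2 a h.2, ih₁.2 a h.1]
  | iteTrue _ _ ih =>
    refine ⟨fun r h => ?_, fun a h => ?_⟩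
    · simp only [Prog.writesReg, Bool.or_eq_false_iff] at h
      exact ih.1 r h.1
    · simp only [Prog.writesArr, Bool.or_eq_false_iff] at h
      exact ih.2 a h.1
  | iteFalse _ _ ih =>
    refine ⟨fun r h => ?_, fun a h => ?_⟩
    · simp only [Prog.writesReg, Bool.or_eq_false_iff] at h
      exact ih.1 r h.2
    · simp only [Prog.writesArr, Bool.or_eq_false_iff] at h
      exact ih.2 a h.2
  | loopDone => simp
  | loopNext _ _ _ ih₁ ih₂ =>
    refine ⟨fun r h => ?_, fun a h => ?_⟩
    · rw [ih₂.1 r h, ih₁.1 r h]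
    · rw [ih₂.2 a h, ih₁.2 a h]

theorem Runs.frame {P : Prog} {σ : Mem} {Q : Mem → ℕ → Prop} (h : Runs P σ Q) :
    Runs P σ fun σ' τ => Frame P σ σ' ∧ Q σ' τ := by
  obtain ⟨σ', τ, h, hq⟩ := h
  exact ⟨σ', τ, h, h.frame, hq⟩

/-- Use the specification of the first program of a sequence. -/
theorem Runs.seq_spec {P P' : Prog} {σ : Mem} {Q R : Mem → ℕ → Prop} (h : Runs P σ Q)
    (h' : ∀ σ₁ τ₁, Frame P σ σ₁ → Q σ₁ τ₁ → Runs P' σ₁ fun σ₂ τ₂ => R σ₂ (τ₁ + τ₂)) :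
    Runs (Prog.seq P P') σ R :=
  Runs.seq (h.frame.mono fun _ _ hq => h' _ _ hq.1 hq.2)

/-- The case `j = 0` matters: tests have no short circuit, so sifting up reads a parent cell even at
the root. There the quotient is negative and both sides are `0`. -/
theorem floor_parent (j : ℕ) : ⌊((j : ℝ) - 1) / 2⌋₊ = (j - 1) / 2 := by
  rw [Nat.floor_div_ofNat]
  rcases j with _ | j
  · rw [Nat.floor_of_nonpos (by norm_num)]
  · simp

/-- Positivity is needed here, as the integer floor at `j = 0` is `-1`. -/
theorem floor_parent_int (j : ℕ) (hj : 0 < j) :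
    ((⌊((j : ℝ) - 1) / 2⌋ : ℤ) : ℝ) = (((j - 1) / 2 : ℕ) : ℝ) := by
  rw [← floor_parent, natCast_floor_eq_intCast_floor]
  have : (1 : ℝ) ≤ j := by exact_mod_cast hj
  apply div_nonneg <;> linarith

/-! ### Binary heaps -/

/-- The entries of the arrays `4` and `3` at the positions below `s`. -/
def heapEntries (σ : Mem) (s : ℕ) : Multiset (ℝ × ℝ) :=
  (Multiset.range s).map fun i => (σ.arr 4 i, σ.arr 3 i)

/-- The arrays `4` and `3` hold the entries `M` as a binary heap, and register `2` their number. -/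
def Heap (σ : Mem) (s : ℕ) (M : Multiset (ℝ × ℝ)) : Prop :=
  σ.reg 2 = s ∧ heapEntries σ s = M ∧ ∀ i, 0 < i → i < s → σ.arr 4 ((i - 1) / 2) ≤ σ.arr 4 i

theorem Heap.congr {σ σ' : Mem} {s : ℕ} {M : Multiset (ℝ × ℝ)} (h : Heap σ s M)
    (h2 : σ'.reg 2 = σ.reg 2) (h3 : σ'.arr 3 = σ.arr 3) (h4 : σ'.arr 4 = σ.arr 4) :
    Heap σ' s M := by
  unfold Heap heapEntries at *
  rwa [h2, h3, h4]

/-- Heap order, but the entry at `j` may be too small for its place. -/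
def UpOK (K : ℕ → ℝ) (s j : ℕ) : Prop :=
  (∀ i, 0 < i → i < s → i ≠ j → K ((i - 1) / 2) ≤ K i) ∧
    ∀ i, 0 < i → i < s → (i - 1) / 2 = j → 0 < j → K ((j - 1) / 2) ≤ K i

/-- Heap order, but the entry at `j` may be too large for its place. -/
def DownOK (K : ℕ → ℝ) (s j : ℕ) : Prop :=
  (∀ i, 0 < i → i < s → (i - 1) / 2 ≠ j → K ((i - 1) / 2) ≤ K i) ∧
    ∀ i, 0 < i → i < s → (i - 1) / 2 = j → 0 < j → K ((j - 1) / 2) ≤ K i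

/-- A sibling of `j` stays in order since its new parent is smaller than the old one. The children
of `j` come to hang below the old parent, which is what the second clause of `UpOK` provides for. -/
theorem UpOK.step {K : ℕ → ℝ} {s j : ℕ} (h : UpOK K s j) (hj : 0 < j) (hs : j < s)
    (hK : K j < K ((j - 1) / 2)) :
    UpOK (fun i => K (Equiv.swap j ((j - 1) / 2) i)) s ((j - 1) / 2) := by
  obtain ⟨h₁, h₂⟩ := h
  set p := (j - 1) / 2 with hp
  have hpj : p < j := by omega
  refine ⟨fun i hi his hip => ?_, fun i hi his hip hp0 => ?_⟩ <;> beta_reduce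
  · by_cases hij : i = j
    · subst hij
      simp only [Equiv.swap_apply_left, ← hp, Equiv.swap_apply_right]
      exact hK.le
    · rw [Equiv.swap_apply_of_ne_of_ne hij hip]
      by_cases hc : (i - 1) / 2 = j
      · rw [hc, Equiv.swap_apply_left]
        exact h₂ i hi his hc hj
      · by_cases hc' : (i - 1) / 2 = p
        · rw [hc', Equiv.swap_apply_right]
          exact hK.le.trans (hc' ▸ h₁ i hi his hij)
        · rw [Equiv.swap_apply_of_ne_of_ne hc hc']
          exact h₁ i hi his hij
  · have hg := h₁ p hp0 (by omega) (by omega)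
    rw [Equiv.swap_apply_of_ne_of_ne (a := j) (b := p) (x := (p - 1) / 2) (by omega) (by omega)]
    by_cases hij : i = j
    · subst hij
      rw [Equiv.swap_apply_left]
      exact hg
    · rw [Equiv.swap_apply_of_ne_of_ne hij (by omega)]
      exact hg.trans (hip ▸ h₁ i hi his hij)

/-- The smallest child may stand above its siblings, and by the second clause of `DownOK` it also
respects the parent of `j`. Only the place `c` remains in doubt. -/
theorem DownOK.step {K : ℕ → ℝ} {s j c : ℕ} (h : DownOK K s j) (hc : (c - 1) / 2 = j) (hc0 : 0 < c)
    (hs : c < s) (hK : K c < K j) (hmin : ∀ i, 0 < i → i < s → (i - 1) / 2 = j → K c ≤ K i) :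
    DownOK (fun i => K (Equiv.swap j c i)) s c := by
  obtain ⟨h₁, h₂⟩ := h
  have hpj : j < c := by omega
  refine ⟨fun i hi his hip => ?_, fun i hi his hip hp0 => ?_⟩ <;> beta_reduce
  · by_cases hij : i = j
    · subst hij
      rw [Equiv.swap_apply_left, Equiv.swap_apply_of_ne_of_ne (by omega) hip]
      exact h₂ c hc0 hs hc hi
    · by_cases hic : i = c
      · subst hic
        rw [hc, Equiv.swap_apply_left, Equiv.swap_apply_right]
        exact hK.le
      · rw [Equiv.swap_apply_of_ne_of_ne hij hic]
        by_cases hcj : (i - 1) / 2 = j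
        · rw [hcj, Equiv.swap_apply_left]
          exact hmin i hi his hcj
        · rw [Equiv.swap_apply_of_ne_of_ne hcj hip]
          exact h₁ i hi his hcj
  · rw [hc, Equiv.swap_apply_left, Equiv.swap_apply_of_ne_of_ne (by omega) (by omega)]
    have := h₁ i hi his (by omega)
    rwa [hip] at this

theorem heap_min {K : ℕ → ℝ} {s : ℕ} (h : ∀ i, 0 < i → i < s → K ((i - 1) / 2) ≤ K i) :
    ∀ i, i < s → K 0 ≤ K i := by
  intro i
  induction i using Nat.strong_induction_on with
  | _ i ih =>
    intro hi
    rcases Nat.eq_zero_or_pos i with rfl | h0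
    · exact le_rfl
    · exact (ih _ (by omega) (by omega)).trans (h i h0 hi)

/-- A transposition permutes the positions below `s`; this is why sifting preserves the multiset of
entries. -/
theorem map_range_swap {α : Type*} (f : ℕ → α) {s j c : ℕ} (hj : j < s) (hc : c < s) :
    (Multiset.range s).map (fun i => f (Equiv.swap j c i)) = (Multiset.range s).map f := by
  have : (Multiset.range s).map (Equiv.swap j c) = Multiset.range s := by
    apply Multiset.Nodup.ext _ (Multiset.nodup_range s) |>.2
    · intro a
      simp only [Multiset.mem_map, Multiset.mem_range]
      constructor
      · rintro ⟨b, hb, rfl⟩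
        simp only [Equiv.swap_apply_def]
        split_ifs <;> omega
      · intro ha
        refine ⟨Equiv.swap j c a, ?_, by simp⟩
        simp only [Equiv.swap_apply_def]
        split_ifs <;> omega
    · exact (Multiset.nodup_range s).map (Equiv.injective _)
  conv_rhs => rw [← this, Multiset.map_map]
  rfl

open RExpr RTest

/-! ### Heap programs and their costs -/

/-- Swap the heap entries at the positions in the registers `3` and `4`, and move to the second. -/
def swapMove : Prog :=
  .seq (.setReg 5 (cell 4 (reg 3))) <|
  .seq (.setCell 4 (reg 3) (cell 4 (reg 4))) <|
  .seq (.setCell 4 (reg 4) (reg 5)) <|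
  .seq (.setReg 5 (cell 3 (reg 3))) <|
  .seq (.setCell 3 (reg 3) (cell 3 (reg 4))) <|
  .seq (.setCell 3 (reg 4) (reg 5)) <|
  .setReg 3 (reg 4)

theorem swapMove_spec {σ : Mem} {j c : ℕ} (hj : σ.reg 3 = j) (hc : σ.reg 4 = c) :
    Runs swapMove σ fun σ' τ => τ ≤ 30 ∧ σ'.reg 3 = c ∧ σ'.reg 2 = σ.reg 2 ∧
      (∀ i, σ'.arr 4 i = σ.arr 4 (Equiv.swap j c i)) ∧
      ∀ i, σ'.arr 3 i = σ.arr 3 (Equiv.swap j c i) := by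
  unfold swapMove
  repeat' first | apply Runs.seq | apply Runs.setReg | apply Runs.setCell
  simp [hj, hc, Equiv.swap_apply_def]
  refine ⟨fun i => ?_, fun i => ?_⟩ <;> split_ifs <;> simp_all

/-- Move the heap entry at the position in register `3` up to its place. -/
def siftUp : Prog :=
  .loop (.and (.le (const 1) (reg 3))
      (.lt (cell 4 (reg 3)) (cell 4 (divide (sub (reg 3) (const 1)) (const 2))))) <|
  .seq (.setReg 4 (floor (divide (sub (reg 3) (const 1)) (const 2)))) swapMove

theorem siftUp_spec {σ : Mem} {s j : ℕ} {M : Multiset (ℝ × ℝ)} (h2 : σ.reg 2 = s) (hj : σ.reg 3 = j)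
    (hjs : j < s) (hM : heapEntries σ s = M) (hK : UpOK (σ.arr 4) s j) :
    Runs siftUp σ fun σ' τ => τ ≤ 60 * Nat.log 2 (j + 1) + 20 ∧ Heap σ' s M := by
  refine Runs.loop (fun σ B => ∃ j : ℕ, σ.reg 2 = s ∧ σ.reg 3 = j ∧ j < s ∧
    heapEntries σ s = M ∧ UpOK (σ.arr 4) s j ∧ B = 60 * Nat.log 2 (j + 1)) (60 * Nat.log 2 (j + 1))
    ⟨j, h2, hj, hjs, hM, hK, rfl⟩ ?_ ?_
  · rintro σ B ⟨j, h2, hj, hjs, hM, hK, rfl⟩ hb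
    simp [hj, floor_parent] at hb
    obtain ⟨hb1, hb2⟩ := hb
    apply Runs.seq
    apply Runs.setReg
    simp only [RExpr.eval, hj, Int.cast_one, Int.cast_ofNat, floor_parent_int j hb1]
    refine (swapMove_spec (j := j) (c := (j - 1) / 2) (by simp [hj]) (by simp)).mono ?_
    rintro σ' τ ⟨hτ, h3', h2', hA, hB⟩
    simp only [Mem.arr_setReg] at hA hB
    refine ⟨_, ⟨(j - 1) / 2, by simpa [h2] using h2', h3', by omega, ?_, ?_, rfl⟩, ?_⟩
    · rw [← hM]
      unfold heapEntries
      simp only [hA, hB]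
      exact map_range_swap (fun i => (σ.arr 4 i, σ.arr 3 i)) hjs (by omega)
    · rw [funext hA]
      exact hK.step hb1 hjs hb2
    -- Counted from one, the parent's position is half of the child's, so each swap lowers the
    -- logarithm by one and releases 60 steps.
    · have : Nat.log 2 (j + 1) = Nat.log 2 ((j - 1) / 2 + 1) + 1 := by
        rw [Nat.log_of_one_lt_of_le (by omega) (by omega)]
        congr 2; omega
      simp
      omega
  · rintro σ' τ B' ⟨j, h2, hj, hjs, hM, hK, rfl⟩ hb hτ
    simp [hj, floor_parent] at hb hτ
    refine ⟨by omega, h2, hM, fun i hi his => ?_⟩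
    by_cases hij : i = j
    · subst hij
      exact hb hi
    · exact hK.1 i hi his hij

/-- Move the heap entry at the position in register `3` down to its place. -/
def siftDown : Prog :=
  .loop (.not (.and
      (.not (.and (.lt (add (mul (const 2) (reg 3)) (const 1)) (reg 2))
        (.lt (cell 4 (add (mul (const 2) (reg 3)) (const 1))) (cell 4 (reg 3)))))
      (.not (.and (.lt (add (mul (const 2) (reg 3)) (const 2)) (reg 2))
        (.lt (cell 4 (add (mul (const 2) (reg 3)) (const 2))) (cell 4 (reg 3))))))) <|
  .seq (.setReg 4 (add (mul (const 2) (reg 3)) (const 1))) <|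
  .seq (.ite (.and (.lt (add (mul (const 2) (reg 3)) (const 2)) (reg 2))
      (.le (cell 4 (add (mul (const 2) (reg 3)) (const 2)))
        (cell 4 (add (mul (const 2) (reg 3)) (const 1)))))
    (.setReg 4 (add (mul (const 2) (reg 3)) (const 2))) .skip)
  swapMove

theorem floor_two_mul_add_one (j : ℕ) : ⌊2 * (j : ℝ) + 1⌋₊ = 2 * j + 1 := by
  exact_mod_cast Nat.floor_natCast (R := ℝ) (2 * j + 1)

theorem floor_two_mul_add_two (j : ℕ) : ⌊2 * (j : ℝ) + 2⌋₊ = 2 * j + 2 := by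
  exact_mod_cast Nat.floor_natCast (R := ℝ) (2 * j + 2)

theorem siftDown_spec {σ : Mem} {s j : ℕ} {M : Multiset (ℝ × ℝ)} (h2 : σ.reg 2 = s)
    (hj : σ.reg 3 = j) (hM : heapEntries σ s = M) (hK : DownOK (σ.arr 4) s j) :
    Runs siftDown σ fun σ' τ => τ ≤ 150 * Nat.log 2 s + 50 ∧ Heap σ' s M := by
  refine Runs.loop (fun σ B => ∃ j : ℕ, σ.reg 2 = s ∧ σ.reg 3 = j ∧
    heapEntries σ s = M ∧ DownOK (σ.arr 4) s j ∧ B = 150 * (Nat.log 2 s - Nat.log 2 (j + 1)))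
    (150 * (Nat.log 2 s - Nat.log 2 (j + 1)))
    ⟨j, h2, hj, hM, hK, rfl⟩ ?_ ?_
  · rintro σ B ⟨j, h2, hj, hM, hK, rfl⟩ hb
    have e1 : (2 * (j : ℝ) + 1 < s) ↔ 2 * j + 1 < s := by exact_mod_cast Iff.rfl
    have e2 : (2 * (j : ℝ) + 2 < s) ↔ 2 * j + 2 < s := by exact_mod_cast Iff.rfl
    simp [hj, h2, floor_two_mul_add_one, floor_two_mul_add_two, e1, e2] at hb
    -- The common end of both branches, where `c` is the child that was chosen.
    have key : ∀ σ₁ : Mem, ∀ c : ℕ, σ₁.arr = σ.arr → σ₁.reg 2 = s → σ₁.reg 3 = j → σ₁.reg 4 = c →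
        (c = 2 * j + 1 ∨ c = 2 * j + 2) → c < s → σ.arr 4 c < σ.arr 4 j →
        (∀ i, 0 < i → i < s → (i - 1) / 2 = j → σ.arr 4 c ≤ σ.arr 4 i) →
        Runs swapMove σ₁ fun σ' τ => τ ≤ 30 ∧ ∃ B', (∃ j : ℕ, σ'.reg 2 = s ∧ σ'.reg 3 = j ∧
          heapEntries σ' s = M ∧ DownOK (σ'.arr 4) s j ∧
          B' = 150 * (Nat.log 2 s - Nat.log 2 (j + 1))) ∧
          B' + 150 ≤ 150 * (Nat.log 2 s - Nat.log 2 (j + 1)) := by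
      intro σ₁ c ha h2 h3 h4 hc hcs hlt hmin
      refine (swapMove_spec h3 h4).mono ?_
      rintro σ' τ ⟨hτ, h3', h2', hA, hB⟩
      rw [ha] at hA hB
      refine ⟨hτ, _, ⟨c, by rw [h2', h2], h3', ?_, ?_, rfl⟩, ?_⟩
      · rw [← hM]
        unfold heapEntries
        simp only [hA, hB]
        exact map_range_swap (fun i => (σ.arr 4 i, σ.arr 3 i)) (by omega) (by omega)
      · rw [funext hA]
        exact hK.step (by omega) (by omega) hcs hlt hmin
      · have l1 : Nat.log 2 (c + 1) = Nat.log 2 (j + 1) + 1 := by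
          rw [Nat.log_of_one_lt_of_le (by omega) (by omega)]
          congr 2; omega
        have l2 : Nat.log 2 (c + 1) ≤ Nat.log 2 s := Nat.log_mono_right (by omega)
        omega
    apply Runs.seq
    apply Runs.setReg
    apply Runs.seq
    apply Runs.ite
    · intro hc
      simp [hj, h2, floor_two_mul_add_one, floor_two_mul_add_two, e2] at hc
      apply Runs.setReg
      refine (key _ (2 * j + 2) (by simp) (by simp [h2]) (by simp [hj]) (by simp [hj])
        (by simp) hc.1 ?_ ?_).mono ?_
      · rcases not_and_or.1 (fun h => absurd hb (by push Not; simpa using h)) with h | h <;> grind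
      · intro i h0 hi hij
        have : i = 2 * j + 1 ∨ i = 2 * j + 2 := by omega
        rcases this with rfl | rfl
        · exact hc.2
        · exact le_rfl
      · rintro σ' τ ⟨hτ, B', hB, hB'⟩
        refine ⟨B', hB, ?_⟩
        simp
        omega
    · intro hc
      simp [hj, h2, floor_two_mul_add_one, floor_two_mul_add_two, e2] at hc
      apply Runs.skip
      refine (key _ (2 * j + 1) (by simp) (by simp [h2]) (by simp [hj]) (by simp [hj])
        (by simp) ?_ ?_ ?_).mono ?_
      · by_contra hlt
        grind
      · grind
      · intro i h0 hi hij
        have : i = 2 * j + 1 ∨ i = 2 * j + 2 := by omega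
        rcases this with rfl | rfl
        · exact le_rfl
        · exact (hc hi).le
      · rintro σ' τ ⟨hτ, B', hB, hB'⟩
        refine ⟨B', hB, ?_⟩
        simp
        omega
  · rintro σ' τ B' ⟨j, h2, hj, hM, hK, rfl⟩ hb hτ
    have e1 : (2 * (j : ℝ) + 1 < s) ↔ 2 * j + 1 < s := by exact_mod_cast Iff.rfl
    have e2 : (2 * (j : ℝ) + 2 < s) ↔ 2 * j + 2 < s := by exact_mod_cast Iff.rfl
    simp [hj, h2, floor_two_mul_add_one, floor_two_mul_add_two, e1, e2] at hb hτ
    refine ⟨by omega, h2, hM, fun i hi his => ?_⟩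
    by_cases hij : (i - 1) / 2 = j
    · have : i = 2 * j + 1 ∨ i = 2 * j + 2 := by omega
      rcases this with rfl | rfl
      · rw [hij]; exact hb.1 his
      · rw [hij]; exact hb.2 his
    · exact hK.1 i hi his hij

/-- Insert the entry with the key in register `6` and the name in register `7` into the heap. -/
def heapInsert : Prog :=
  .seq (.setCell 4 (reg 2) (reg 6)) <|
  .seq (.setCell 3 (reg 2) (reg 7)) <|
  .seq (.setReg 3 (reg 2)) <|
  .seq (.setReg 2 (add (reg 2) (const 1))) siftUp

theorem heapInsert_spec {σ : Mem} {s : ℕ} {M : Multiset (ℝ × ℝ)} (h : Heap σ s M) :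
    Runs heapInsert σ fun σ' τ => τ ≤ 60 * Nat.log 2 (s + 1) + 40 ∧
      Heap σ' (s + 1) ((σ.reg 6, σ.reg 7) ::ₘ M) := by
  obtain ⟨h2, hM, hK⟩ := h
  unfold heapInsert
  repeat' first | apply Runs.seq | apply Runs.setReg | apply Runs.setCell
  refine (siftUp_spec (s := s + 1) (j := s) (M := (σ.reg 6, σ.reg 7) ::ₘ M) (by simp [h2])
    (by simp [h2]) (by omega) ?_ ?_).mono ?_
  · rw [← hM]
    simp only [heapEntries, Multiset.range_succ, Multiset.map_cons]
    congr 1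
    · simp [h2]
    · apply Multiset.map_congr rfl
      intro i hi
      have : i ≠ s := by have := Multiset.mem_range.1 hi; omega
      simp [h2, this]
  · refine ⟨fun i h0 hi his => ?_, fun i h0 hi his => ?_⟩
    · have := hK i h0 (by omega)
      have e : (i - 1) / 2 ≠ s := by omega
      simpa [h2, his, e] using this
    · omega
  · rintro σ' τ ⟨hτ, hH⟩
    refine ⟨?_, hH⟩
    simp
    omega

/-- Remove the top entry of the heap; put its key into register `6` and its name into register
`7`. -/
def heapPop : Prog :=
  .seq (.setReg 6 (cell 4 (const 0))) <|
  .seq (.setReg 7 (cell 3 (const 0))) <|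
  .seq (.setReg 2 (sub (reg 2) (const 1))) <|
  .seq (.setCell 4 (const 0) (cell 4 (reg 2))) <|
  .seq (.setCell 3 (const 0) (cell 3 (reg 2))) <|
  .seq (.setReg 3 (const 0)) siftDown

/-- Overwriting the root can only spoil comparisons with the root, and shortening a heap spoils
none. The second clause of `DownOK` is void at the root. -/
theorem downOK_zero {K K' : ℕ → ℝ} {s s' : ℕ} (hs : s' ≤ s)
    (h : ∀ i, 0 < i → i < s → K ((i - 1) / 2) ≤ K i) (hK : ∀ i, 0 < i → i < s → K' i = K i) :
    DownOK K' s' 0 := by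
  refine ⟨fun i h0 hi hi0 => ?_, fun i h0 hi _ h => absurd h (lt_irrefl _)⟩
  rw [hK i h0 (by omega), hK _ (by omega) (by omega)]
  exact h i h0 (by omega)

theorem heapPop_spec {σ : Mem} {s : ℕ} {M : Multiset (ℝ × ℝ)} (h : Heap σ (s + 1) M) :
    Runs heapPop σ fun σ' τ => τ ≤ 150 * Nat.log 2 s + 80 ∧ σ'.reg 6 = σ.arr 4 0 ∧
      ∃ M', M = (σ'.reg 6, σ'.reg 7) ::ₘ M' ∧ Heap σ' s M' := by
  obtain ⟨h2, hM, hK⟩ := h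
  unfold heapPop
  repeat' first | apply Runs.seq | apply Runs.setReg | apply Runs.setCell
  refine ((siftDown_spec (s := s) (j := 0) (M := M - {(σ.arr 4 0, σ.arr 3 0)}) (by simp [h2])
    (by simp) ?_ ?_).frame).mono ?_
  · rw [← hM]
    rw [eq_tsub_iff_add_eq_of_le]
    -- If only one entry is present, the last entry is the top itself. Otherwise the top and the
    -- last entry are split off from the range, and the last one takes position `0`.
    · rcases Nat.eq_zero_or_pos s with rfl | hs
      · simp [heapEntries]
      obtain ⟨t, rfl⟩ : ∃ t, s = t + 1 := ⟨s - 1, by omega⟩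
      have e1 : ∀ f : ℕ → ℝ × ℝ, (Multiset.range (t + 1)).map f =
          f 0 ::ₘ (Multiset.range t).map (fun i => f (i + 1)) := by
        intro f
        change Multiset.map f (Multiset.ofList (List.range (t + 1))) =
          f 0 ::ₘ Multiset.map _ (Multiset.ofList (List.range t))
        rw [List.range_succ_eq_map]
        simp [Function.comp_def]
      have e2 : ∀ f : ℕ → ℝ × ℝ, (Multiset.range (t + 1 + 1)).map f =
          f (t + 1) ::ₘ f 0 ::ₘ (Multiset.range t).map (fun i => f (i + 1)) := by
        intro f
        rw [Multiset.range_succ, Multiset.map_cons, e1]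
      simp only [heapEntries]
      rw [e1, e2, Multiset.cons_add, ← Multiset.singleton_add (a := (σ.arr 4 (t + 1), σ.arr 3 (t + 1))),
        ← Multiset.singleton_add (a := (σ.arr 4 0, σ.arr 3 0))]
      simp [h2]
      have e3 : ⌊(t : ℝ) + 1⌋₊ = t + 1 := by exact_mod_cast Nat.floor_natCast (R := ℝ) (t + 1)
      rw [e3, Multiset.cons_swap, add_comm _ {_}, Multiset.singleton_add]
    · simp only [heapEntries, Multiset.singleton_le]
      exact Multiset.mem_map.2 ⟨0, Multiset.mem_range.2 s.succ_pos, rfl⟩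
  · apply downOK_zero (Nat.le_succ s) hK
    intro i h0 hi
    have : i ≠ 0 := by omega
    simp [this]
  · rintro σ' τ ⟨hfr, hτ, hH⟩
    have e6 : σ'.reg 6 = σ.arr 4 0 := by rw [hfr.1 6 rfl]; simp
    have e7 : σ'.reg 7 = σ.arr 3 0 := by rw [hfr.1 7 rfl]; simp
    refine ⟨?_, e6, _, ?_, hH⟩
    · simp
      omega
    · rw [e6, e7]
      rw [← hM]
      refine (Multiset.cons_erase (a := (σ.arr 4 0, σ.arr 3 0)) ?_).symm.trans ?_
      · exact Multiset.mem_map.2 ⟨0, Multiset.mem_range.2 s.succ_pos, rfl⟩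
      · rw [Multiset.sub_singleton]

theorem Heap.top {σ : Mem} {s : ℕ} {M : Multiset (ℝ × ℝ)} (h : Heap σ s M) (hs : 0 < s) :
    (∃ x ∈ M, x.1 = σ.arr 4 0) ∧ ∀ x ∈ M, σ.arr 4 0 ≤ x.1 := by
  obtain ⟨h2, rfl, hK⟩ := h
  refine ⟨⟨_, Multiset.mem_map.2 ⟨0, by simpa using hs, rfl⟩, rfl⟩, ?_⟩
  intro x hx
  obtain ⟨i, hi, rfl⟩ := Multiset.mem_map.1 hx
  exact heap_min hK i (by simpa using hi)

/-! ### Generating the schedule with a priority queue -/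

theorem map_univ_fin_eq_map_range {α : Type*} (n : ℕ) (f : ℕ → α) :
    ((Finset.univ : Finset (Fin n)).val.map fun i : Fin n => f i) = (Multiset.range n).map f := by
  rw [Fin.univ_val_map]
  change (↑(List.ofFn fun i : Fin n => f i) : Multiset α) = Multiset.map f ↑(List.range n)
  rw [Multiset.map_coe]
  congr 1
  apply List.ext_getElem <;> simp

/-- The heap entries of the pairs `(i, t i)`. -/
def queueEntries {n : ℕ} (t : Fin n → ℕ) : Multiset (ℝ × ℝ) :=
  Finset.univ.val.map fun i => ((t i : ℝ), ((i : ℕ) : ℝ))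

/-- Each item's name occurs among the `n` entries, so the map from positions to items is surjective
on a finite set and hence a permutation. -/
theorem Heap.holdsQueue {n : ℕ} {σ : Mem} {t : Fin n → ℕ} (h : Heap σ n (queueEntries t)) :
    HoldsQueue σ t := by
  obtain ⟨h2, hM, hK⟩ := h
  unfold heapEntries queueEntries at hM
  have h₁ : ∀ j : Fin n, ∃ i : Fin n, σ.arr 4 j = (t i : ℝ) ∧ σ.arr 3 j = ((i : ℕ) : ℝ) := by
    intro j
    have : (σ.arr 4 j, σ.arr 3 j) ∈ (Multiset.range n).map fun i => (σ.arr 4 i, σ.arr 3 i) :=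
      Multiset.mem_map.2 ⟨j, by simp, rfl⟩
    rw [hM] at this
    obtain ⟨i, -, hi⟩ := Multiset.mem_map.1 this
    simp only [Prod.mk.injEq] at hi
    exact ⟨i, hi.1.symm, hi.2.symm⟩
  choose e he using h₁
  have hs : Function.Surjective e := by
    intro i
    have : ((t i : ℝ), ((i : ℕ) : ℝ)) ∈
        (Finset.univ : Finset (Fin n)).val.map fun i => ((t i : ℝ), ((i : ℕ) : ℝ)) :=
      Multiset.mem_map.2 ⟨i, by simp, rfl⟩
    rw [← hM] at this
    obtain ⟨j, hj, hij⟩ := Multiset.mem_map.1 this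
    refine ⟨⟨j, Multiset.mem_range.1 hj⟩, ?_⟩
    have h := (he ⟨j, Multiset.mem_range.1 hj⟩).2
    simp only [Prod.mk.injEq] at hij
    rw [hij.2] at h
    exact Fin.ext (by exact_mod_cast h.symm)
  exact ⟨Equiv.ofBijective e (Finite.injective_iff_bijective.1 (Finite.injective_iff_surjective.2 hs)),
    fun j => ⟨(he j).2, (he j).1⟩, hK⟩

/-- Build the heap of the pairs `(i, p i)`. -/
def setupProg : Prog :=
  .loop (.lt (reg 2) (reg 0)) <|
  .seq (.setReg 6 (cell 1 (reg 2))) <|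
  .seq (.setReg 7 (reg 2)) heapInsert

theorem setupProg_spec {n : ℕ} (p q : Fin n → ℕ) :
    Runs setupProg (pairsMem p q) fun σ' τ => τ ≤ n * (60 * Nat.log 2 n + 60) + 10 ∧
      Heap σ' n (queueEntries p) ∧ σ'.reg 0 = n ∧ ∀ i : Fin n, σ'.arr 2 i = q i := by
  set P : ℕ → ℝ := (pairsMem p q).arr 1 with hP
  have hPi : ∀ i : Fin n, P i = p i := by simp [hP, pairsMem]
  have key : Runs setupProg (pairsMem p q) fun σ' τ => τ ≤ n * (60 * Nat.log 2 n + 60) + 10 ∧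
      Heap σ' n ((Multiset.range n).map fun i => (P i, (i : ℝ))) := by
    refine Runs.loop (fun σ B => ∃ s : ℕ, s ≤ n ∧ σ.reg 0 = n ∧ σ.arr 1 = P ∧
      Heap σ s ((Multiset.range s).map fun i => (P i, (i : ℝ))) ∧
      B = (n - s) * (60 * Nat.log 2 n + 60)) (n * (60 * Nat.log 2 n + 60)) ?_ ?_ ?_
    · exact ⟨0, by omega, by simp [pairsMem], rfl, ⟨by simp [pairsMem], rfl, by omega⟩, rfl⟩
    · rintro σ B ⟨s, hs, h0, h1, hH, rfl⟩ hb
      have hsn : s < n := by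
        simpa [h0, hH.1] using hb
      apply Runs.seq
      apply Runs.setReg
      apply Runs.seq
      apply Runs.setReg
      refine Runs.mono (Runs.frame (heapInsert_spec (s := s)
        (M := (Multiset.range s).map fun i => (P i, (i : ℝ))) (hH.congr (by simp) rfl rfl))) ?_
      rintro σ' τ ⟨hfr, hτ, hH'⟩
      refine ⟨_, ⟨s + 1, hsn, ?_, ?_, ?_, rfl⟩, ?_⟩
      · rw [hfr.1 0 rfl]; simp [h0]
      · rw [hfr.2 1 rfl]; simp [h1]
      · simpa [hH.1, h1] using hH'
      · have h3 : Nat.log 2 (s + 1) ≤ Nat.log 2 n := Nat.log_mono_right hsn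
        have h4 : n - s = n - (s + 1) + 1 := by omega
        rw [h4, add_mul]
        simp
        omega
    · rintro σ' τ B' ⟨s, hs, h0, h1, hH, rfl⟩ hb hτ
      have : s = n := by
        have : n ≤ s := by simpa [h0, hH.1] using hb
        omega
      subst this
      simp at hτ
      exact ⟨by omega, hH⟩
  refine key.frame.mono ?_
  rintro σ' τ ⟨hfr, hτ, hH⟩
  refine ⟨hτ, ?_, ?_, fun i => ?_⟩
  · rw [← map_univ_fin_eq_map_range] at hH
    unfold queueEntries
    simpa only [hPi] using hH
  · rw [hfr.1 0 rfl]; simp [pairsMem]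
  · rw [hfr.2 2 rfl]; simp [pairsMem]

/-- Output the item with the smallest key, and move it to its next position. -/
def nextProg : Prog :=
  .seq (.setReg 1 (cell 3 (const 0))) <|
  .seq (.setCell 4 (const 0) (add (cell 4 (const 0)) (cell 2 (reg 1)))) <|
  .seq (.setReg 3 (const 0)) siftDown

theorem nextProg_spec {n : ℕ} (hn : 0 < n) {σ : Mem} {t q : Fin n → ℕ}
    (hH : Heap σ n (queueEntries t)) (hq : ∀ i : Fin n, σ.arr 2 i = q i) :
    ∃ i : Fin n, (∀ j, t i ≤ t j) ∧ Runs nextProg σ fun σ' τ =>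
      τ ≤ 150 * Nat.log 2 n + 80 ∧
      Heap σ' n (queueEntries (Function.update t i (t i + q i))) ∧
      (∀ i : Fin n, σ'.arr 2 i = q i) ∧ σ'.reg 1 = ((i : ℕ) : ℝ) := by
  obtain ⟨e, he, hK⟩ := hH.holdsQueue
  set o : Fin n := ⟨0, hn⟩ with ho
  have h30 : σ.arr 3 0 = ((e o : ℕ) : ℝ) := (he o).1
  have h40 : σ.arr 4 0 = ((t (e o) : ℕ) : ℝ) := (he o).2
  refine ⟨e o, fun j => ?_, ?_⟩
  · have h1 := heap_min hK (e.symm j : ℕ) (e.symm j).2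
    have h2 := (he (e.symm j)).2
    have h3 : σ.arr 4 0 = (t (e o) : ℝ) := (he o).2
    rw [h2, h3] at h1
    simpa using h1
  · unfold nextProg
    repeat' first | apply Runs.seq | apply Runs.setReg | apply Runs.setCell
    refine ((siftDown_spec (s := n) (j := 0)
      (M := queueEntries (Function.update t (e o) (t (e o) + q (e o)))) (by simpa using hH.1)
      (by simp) ?_ ?_).frame).mono ?_
    · unfold heapEntries queueEntries
      rw [← map_univ_fin_eq_map_range]
      -- Listing the items in heap order makes the two multisets agree position by position; only
      -- position `0` has changed.
      conv_rhs => rw [← Multiset.map_univ_val_equiv e, Multiset.map_map]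
      apply Multiset.map_congr rfl
      intro j _
      by_cases hj : j = o
      · subst hj
        have := hq (e o)
        simp [ho] at this h30 h40 ⊢
        simp [h30, h40, this]
      · have hj0 : (j : ℕ) ≠ 0 := fun h => hj (Fin.ext h)
        have : e j ≠ e o := fun h => hj (e.injective h)
        simp [hj0, this, he j]
    · apply downOK_zero le_rfl hK
      intro i h0 hi
      have : i ≠ 0 := by omega
      simp [this]
    · rintro σ' τ ⟨hfr, hτ, hH'⟩
      refine ⟨?_, hH', fun i => ?_, ?_⟩
      · simp
        omega
      · rw [hfr.2 2 rfl]; simp [hq]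
      · rw [hfr.1 1 rfl]; simp [h30]

/-- The invariant in `X T` is that each key is the least position of its item that is not below `T`.
Bundling it with the memory as a type lets the infinite run be built by choice and recursion on `T`.
-/
theorem exists_queue_run {n : ℕ} (hn : 0 < n) (p q : Fin n → ℕ) (h : IsCyclicSchedule p q) :
    ∃ (σ : ℕ → Mem) (t : ℕ → Fin n → ℕ) (item : ℕ → Fin n) (τ₀ : ℕ) (τ : ℕ → ℕ),
      Exec setupProg (pairsMem p q) (σ 0) τ₀ ∧ τ₀ ≤ n * (60 * Nat.log 2 n + 60) + 10 ∧
      t 0 = p ∧ ∀ T : ℕ, HoldsQueue (σ T) (t T) ∧ (∀ i, t T (item T) ≤ t T i) ∧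
        t (T + 1) = Function.update (t T) (item T) (t T (item T) + q (item T)) ∧
        Exec nextProg (σ T) (σ (T + 1)) (τ T) ∧ τ T ≤ 150 * Nat.log 2 n + 80 ∧
        (σ (T + 1)).reg 1 = ((item T : ℕ) : ℝ) ∧ ∃ k : ℕ, T = p (item T) + k * q (item T) := by
  obtain ⟨σ₀, τ₀, hx, hτ₀, hH₀, -, hq₀⟩ := setupProg_spec p q
  let X : ℕ → Type := fun T => {x : Mem × (Fin n → ℕ) // Heap x.1 n (queueEntries x.2) ∧
    (∀ i : Fin n, x.1.arr 2 i = q i) ∧ (∀ i, T ≤ x.2 i ∧ ∃ k, x.2 i = p i + k * q i) ∧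
    ∀ i k, T ≤ p i + k * q i → x.2 i ≤ p i + k * q i}
  have step : ∀ T (x : X T), ∃ (y : X (T + 1)) (i : Fin n) (τ : ℕ),
      (∀ j, x.1.2 i ≤ x.1.2 j) ∧
      y.1.2 = Function.update x.1.2 i (x.1.2 i + q i) ∧ Exec nextProg x.1.1 y.1.1 τ ∧
      τ ≤ 150 * Nat.log 2 n + 80 ∧ y.1.1.reg 1 = ((i : ℕ) : ℝ) ∧ ∃ k : ℕ, T = p i + k * q i := by
    rintro T ⟨⟨σ, t⟩, hH, hq, ht, hmin⟩
    obtain ⟨i, hi, σ', τ, hx, hτ, hH', hq', hr⟩ := nextProg_spec hn hH hq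
    dsimp only at *
    obtain ⟨i₀, ⟨k₀, hk₀⟩, huniq⟩ := h.2 T
    -- The item scheduled at `T` has key `T`, and no key is smaller. So the top of the heap has key
    -- `T`, and uniqueness of the schedule identifies the item.
    have h1 : t i₀ = T := le_antisymm ((hmin i₀ k₀ hk₀.le).trans hk₀.ge) (ht i₀).1
    have h2 : t i = T := le_antisymm ((hi i₀).trans h1.le) (ht i).1
    obtain ⟨k₁, hk₁⟩ : ∃ k, t i = p i + k * q i := (ht i).2
    have hii : i = i₀ := huniq i ⟨k₁, h2.symm.trans hk₁⟩
    have hqi := h.1 i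
    refine ⟨⟨⟨σ', Function.update t i (t i + q i)⟩, hH', hq', fun j => ?_, fun j k hj => ?_⟩,
      i, τ, hi, rfl, hx, hτ, hr, k₁, h2.symm.trans hk₁⟩
    · by_cases hj : j = i
      · subst hj
        simp only [Function.update_self]
        exact ⟨by omega, k₁ + 1, by rw [hk₁, add_mul]; omega⟩
      · simp only [Function.update_of_ne hj]
        refine ⟨?_, (ht j).2⟩
        have hne : t j ≠ T := by
          intro he
          obtain ⟨k, hk⟩ := (ht j).2
          exact hj ((huniq j ⟨k, he.symm.trans hk⟩).trans hii.symm)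
        have : T ≤ t j := (ht j).1
        omega
    · by_cases hji : j = i
      · subst hji
        simp only [Function.update_self]
        rw [h2] at hk₁ ⊢
        have hlt : k₁ < k := by
          by_contra hle
          have : k * q j ≤ k₁ * q j := Nat.mul_le_mul_right _ (by omega)
          omega
        have : (k₁ + 1) * q j ≤ k * q j := Nat.mul_le_mul_right _ hlt
        rw [add_mul] at this
        omega
      · simp only [Function.update_of_ne hji]
        exact hmin j k (by omega)
  choose y i τ hy using step
  let x₀ : X 0 := ⟨⟨σ₀, p⟩, hH₀, hq₀, fun i => ⟨by omega, 0, by simp⟩, fun i k _ => by simp⟩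
  let x : ∀ T, X T := fun T => Nat.rec x₀ (fun T x => y T x) T
  refine ⟨fun T => (x T).1.1, fun T => (x T).1.2, fun T => i T (x T), τ₀, fun T => τ T (x T),
    hx, hτ₀, rfl, fun T => ?_⟩
  obtain ⟨h1, h2, h3, h4, h5, h6⟩ := hy T (x T)
  exact ⟨(x T).2.1.holdsQueue, h1, h2, h3, h4, h5, h6⟩

/-! ### Every output of the Main Algorithm is a cyclic schedule -/

/-- The multiset of the leaves of a tree. -/
def FTree.leaves {n : ℕ} : FTree n → Multiset (Fin n)
  | leaf i => {i}
  | node _ child => ∑ l, (child l).leaves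

/-- Every node of the tree has a child. -/
def FTree.Full {n : ℕ} : FTree n → Prop
  | leaf _ => True
  | node m child => 0 < m ∧ ∀ l, (child l).Full

theorem Places.pos {n : ℕ} {t : FTree n} {p q : ℕ} {i : Fin n} {p' q' : ℕ}
    (h : Places t p q i p' q') (hq : 0 < q) : 0 < q' := by
  induction h with
  | leaf => exact hq
  | node l _ ih => exact ih (Nat.mul_pos (by have := l.2; omega) hq)

theorem Places.mem_leaves {n : ℕ} {t : FTree n} {p q : ℕ} {i : Fin n} {p' q' : ℕ}
    (h : Places t p q i p' q') : i ∈ t.leaves := by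
  induction h with
  | leaf => simp [FTree.leaves]
  | node l _ ih =>
    rw [FTree.leaves, Multiset.mem_sum]
    exact ⟨l, Finset.mem_univ _, ih⟩

theorem Places.position {n : ℕ} {t : FTree n} {p q : ℕ} {i : Fin n} {p' q' : ℕ}
    (h : Places t p q i p' q') (k : ℕ) : ∃ k', p' + k * q' = p + k' * q := by
  induction h with
  | leaf => exact ⟨k, rfl⟩
  | @node m child p q i p' q' l _ ih =>
    obtain ⟨k', hk'⟩ := ih
    exact ⟨l + k' * m, by rw [hk']; ring⟩

/-- Occurrence `k` of a node is occurrence `k / m` of its child number `k % m`; fullness makes this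
division meaningful. -/
theorem FTree.Full.exists_places {n : ℕ} {t : FTree n} (ht : t.Full) (p q k : ℕ) :
    ∃ i p' q' k', Places t p q i p' q' ∧ p + k * q = p' + k' * q' := by
  induction t generalizing p q k with
  | leaf i => exact ⟨i, p, q, k, Places.leaf i p q, rfl⟩
  | node m child ih =>
    obtain ⟨hm, hc⟩ := ht
    let l : Fin m := ⟨k % m, Nat.mod_lt _ hm⟩
    obtain ⟨i, p', q', k', h₁, h₂⟩ := ih l (hc l) (p + (l : ℕ) * q) (m * q) (k / m)
    refine ⟨i, p', q', k', Places.node l h₁, ?_⟩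
    rw [← h₂]
    have := Nat.mod_add_div k m
    calc p + k * q = p + (k % m + m * (k / m)) * q := by rw [this]
      _ = _ := by simp only [l]; ring

/-- A common position determines the occurrence number at the node, and its residue modulo `m`
determines the child. Repeated leaves would do no harm here. -/
theorem Places.item_unique {n : ℕ} {t : FTree n} {p q : ℕ} {i : Fin n} {p₁ q₁ : ℕ}
    (h : Places t p q i p₁ q₁) (hq : 0 < q) {i' : Fin n} {p₂ q₂ k₁ k₂ : ℕ}
    (h' : Places t p q i' p₂ q₂) (heq : p₁ + k₁ * q₁ = p₂ + k₂ * q₂) : i = i' := by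
  induction h with
  | leaf => cases h'; rfl
  | @node m child p q i p₁ q₁ l hl ih =>
    cases h' with
    | node l' hl' =>
      obtain ⟨a, ha⟩ := hl.position k₁
      obtain ⟨b, hb⟩ := hl'.position k₂
      have hab : (l : ℕ) + a * m = l' + b * m := by
        apply Nat.eq_of_mul_eq_mul_right hq
        rw [ha, hb] at heq
        have e1 : p + (l : ℕ) * q + a * (m * q) = p + (l + a * m) * q := by ring
        have e2 : p + (l' : ℕ) * q + b * (m * q) = p + (l' + b * m) * q := by ring
        omega
      have hll : l = l' := by
        have := congrArg (· % m) hab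
        simp only [Nat.add_mul_mod_self_right, Nat.mod_eq_of_lt l.2, Nat.mod_eq_of_lt l'.2] at this
        exact Fin.ext this
      subst hll
      exact ih (Nat.mul_pos (by have := l.2; omega) hq) hl' heq

theorem FTree.nodup_child {n m : ℕ} {child : Fin m → FTree n}
    (h : (FTree.node m child).leaves.Nodup) (l : Fin m) : (child l).leaves.Nodup :=
  Multiset.nodup_of_le
    (Finset.single_le_sum (f := fun l => (child l).leaves) (fun _ _ => Multiset.zero_le _)
      (Finset.mem_univ l)) h

theorem FTree.child_unique {n m : ℕ} {child : Fin m → FTree n}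
    (h : (FTree.node m child).leaves.Nodup) {l l' : Fin m} {i : Fin n}
    (hl : i ∈ (child l).leaves) (hl' : i ∈ (child l').leaves) : l = l' := by
  by_contra hne
  have h₁ : (child l).leaves + (child l').leaves ≤ (FTree.node m child).leaves := by
    rw [FTree.leaves, ← Finset.sum_pair (f := fun l => (child l).leaves) hne]
    exact Finset.sum_le_sum_of_subset (Finset.subset_univ _)
  exact Multiset.disjoint_left.1 (Multiset.nodup_add.1 (Multiset.nodup_of_le h₁ h)).2.2 hl hl'

/-- When no leaf is repeated, the item determines the child to descend into at every node. -/
theorem Places.unique {n : ℕ} {t : FTree n} {p q : ℕ} {i : Fin n} {p₁ q₁ : ℕ}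
    (h : Places t p q i p₁ q₁) (ht : t.leaves.Nodup) {p₂ q₂ : ℕ}
    (h' : Places t p q i p₂ q₂) : p₁ = p₂ ∧ q₁ = q₂ := by
  induction h with
  | leaf => cases h'; exact ⟨rfl, rfl⟩
  | node l hl ih =>
    cases h' with
    | node l' hl' =>
      obtain rfl := FTree.child_unique ht hl.mem_leaves hl'.mem_leaves
      exact ih (FTree.nodup_child ht l) hl'

theorem isCyclicSchedule_of_places {n : ℕ} {t : FTree n} (ht : t.Full)
    (hl : t.leaves = Finset.univ.val) {p q : Fin n → ℕ} (h : ∀ i, Places t 0 1 i (p i) (q i)) :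
    IsCyclicSchedule p q := by
  refine ⟨fun i => (h i).pos one_pos, fun T => ?_⟩
  obtain ⟨i, p', q', k, h₁, h₂⟩ := ht.exists_places 0 1 T
  obtain ⟨rfl, rfl⟩ := h₁.unique (by rw [hl]; exact Finset.univ.nodup) (h i)
  refine ⟨i, ⟨k, by omega⟩, ?_⟩
  rintro i' ⟨k', hk'⟩
  exact (h i').item_unique one_pos (h i) (k₁ := k') (k₂ := k) (by omega)

/-- Every item is a leaf of exactly one frequency, and all trees are full. -/
def Freqs.Covers {n : ℕ} (S : Freqs n) : Prop :=
  (S.map fun x => x.2.leaves).sum = Finset.univ.val ∧ ∀ x ∈ S, x.2.Full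

theorem Combine.covers {n m : ℕ} {v : ℝ} {S S' : Freqs n} (h : Combine m v S S') (hm : 0 < m)
    (hS : S.Covers) : S'.Covers := by
  obtain ⟨R, child⟩ := h
  obtain ⟨h₁, h₂⟩ := hS
  refine ⟨?_, fun x hx => ?_⟩
  · rw [← h₁]
    simp only [Multiset.map_add, Multiset.sum_add, Multiset.map_singleton, Multiset.sum_singleton,
      Multiset.map_map, FTree.leaves]
    rfl
  · rcases Multiset.mem_add.1 hx with hx | hx
    · exact h₂ x (Multiset.mem_add.2 (Or.inl hx))
    · rw [Multiset.mem_singleton.1 hx]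
      refine ⟨hm, fun l => h₂ (v, child l) (Multiset.mem_add.2 (Or.inr ?_))⟩
      exact Multiset.mem_map.2 ⟨l, Finset.mem_univ l, rfl⟩

theorem CombineAll.covers {n m : ℕ} {v : ℝ} {S S' : Freqs n} (h : CombineAll m v S S')
    (hS : S.Covers) : S'.Covers := by
  -- The final count is below `m`, so `m` cannot be `0` and the new nodes have children.
  have hm : 0 < m := by have := h.2; omega
  have h₁ := h.1
  clear h
  induction h₁ with
  | refl => exact hS
  | tail _ h ih => exact h.covers hm ih

theorem Freqs.Covers.pushDown {n : ℕ} {S : Freqs n} (hS : S.Covers) (v w : ℝ) :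
    (pushDown v w S).Covers := by
  have key : ∀ x : ℝ × FTree n, (if x.1 = v then (w, x.2) else x).2 = x.2 := by
    intro x; split_ifs <;> rfl
  refine ⟨?_, fun x hx => ?_⟩
  · rw [← hS.1, BambooGarden.pushDown, Multiset.map_map]
    simp only [Function.comp_def, key]
  · obtain ⟨y, hy, rfl⟩ := Multiset.mem_map.1 hx
    rw [key]
    exact hS.2 y hy

theorem MergeLargest.covers {n : ℕ} {S S' : Freqs n} (h : MergeLargest S S') (hS : S.Covers) :
    S'.Covers := by
  obtain ⟨R, a, b, s, t, hab, hR⟩ := h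
  obtain ⟨h₁, h₂⟩ := hS
  refine ⟨?_, fun x hx => ?_⟩
  · rw [← h₁]
    simp only [Multiset.map_add, Multiset.sum_add, Multiset.insert_eq_cons, Multiset.map_cons,
      Multiset.map_singleton, Multiset.sum_cons, Multiset.sum_singleton, FTree.leaves,
      Fin.sum_univ_two, Matrix.cons_val_zero, Matrix.cons_val_one]
  · rcases Multiset.mem_add.1 hx with hx | hx
    · exact h₂ x (Multiset.mem_add.2 (Or.inl hx))
    · rw [Multiset.mem_singleton.1 hx]
      refine ⟨two_pos, fun l => ?_⟩
      fin_cases l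
      · exact h₂ (a, s) (by simp)
      · exact h₂ (b, t) (by simp)

theorem ForEach.invariant {α β : Type} {R : α → β → β → Prop} {I : β → Prop}
    (hR : ∀ a S S', I S → R a S S' → I S') {l : List α} {S S' : β} (h : ForEach R l S S')
    (hS : I S) : I S' := by
  induction l generalizing S with
  | nil => exact h ▸ hS
  | cons a l ih =>
    obtain ⟨S₁, h₁, h₂⟩ := h
    exact ih h₂ (hR _ _ _ hS h₁)

/-- `Freqs.Covers` survives every combination, push and merge, whatever choices are made. At the end
it says that one full tree has each item exactly once as a leaf. -/
theorem MainAlgorithm.isCyclicSchedule {n : ℕ} {hn : 0 < n} {h : Fin n → ℝ} {p q : Fin n → ℕ}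
    (H : MainAlgorithm hn h p q) : IsCyclicSchedule p q := by
  obtain ⟨lo, hi, C, f, S₃, S₄, S₅, -, -, -, -, h₃, h₄, h₅, v, t, hm, ht⟩ := H
  have c₂ : Freqs.Covers (Finset.univ.val.map fun i : Fin n => (f i, FTree.leaf i)) := by
    refine ⟨?_, fun x hx => ?_⟩
    · rw [Multiset.map_map]
      exact Multiset.sum_map_singleton _
    · obtain ⟨i, -, rfl⟩ := Multiset.mem_map.1 hx
      trivial
  have c₃ : S₃.Covers := h₃.invariant (fun k S S' hS h => h.invariant
    (fun j S S' hS h => h.covers hS) hS) c₂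
  have c₄ : S₄.Covers := h₄.invariant (fun j S S' hS h => h.covers hS) c₃
  have c₅ : S₅.Covers := h₅.invariant (fun k S S' hS h => h.invariant
    (fun j S S' hS ⟨S₁, h, h'⟩ => h' ▸ (h.covers hS).pushDown _ _) hS) c₄
  have c₆ : Freqs.Covers ({(v, t)} : Freqs n) := by
    clear ht
    generalize ({(v, t)} : Freqs n) = S at hm
    induction hm with
    | refl => exact c₅
    | tail _ h ih => exact h.covers ih
  exact isCyclicSchedule_of_places (c₆.2 (v, t) (by simp)) (by simpa using c₆.1) ht

/-! ### Grid frequencies, indexed by integers -/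

/-- The frequency `2 ^ k * (1 + j / C)` has the index `κ = k * C + j`. -/
noncomputable def gridVal (C : ℕ) (κ : ℤ) : ℝ :=
  2 ^ (κ / (C : ℤ)) * (1 + ((κ % (C : ℤ) : ℤ) : ℝ) / C)

theorem key_ediv {C : ℕ} {k j : ℤ} (h0 : 0 ≤ j) (hj : j < C) : (k * C + j) / (C : ℤ) = k := by
  rw [add_comm, Int.add_mul_ediv_right _ _ (by omega), Int.ediv_eq_zero_of_lt h0 hj, zero_add]

theorem key_emod {C : ℕ} {k j : ℤ} (h0 : 0 ≤ j) (hj : j < C) : (k * C + j) % (C : ℤ) = j := by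
  rw [add_comm, Int.add_mul_emod_self_right, Int.emod_eq_of_lt h0 hj]

theorem gridVal_eq {C : ℕ} {k j : ℤ} (h0 : 0 ≤ j) (hj : j < C) :
    gridVal C (k * C + j) = 2 ^ k * (1 + (j : ℝ) / C) := by
  rw [gridVal, key_ediv h0 hj, key_emod h0 hj]

theorem gridFreq_eq {C k j : ℕ} (hj : j < C) : gridFreq C k j = gridVal C (k * C + j) := by
  rw [gridVal_eq (by omega) (by omega), gridFreq]
  simp

/-- The formula persists across the end of a layer, since `2 ^ k * (1 + C / C)` is the first
frequency of layer `k + 1`. -/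
theorem gridVal_succ {C : ℕ} {k j : ℤ} (h0 : 0 ≤ j) (hj : j < C) :
    gridVal C (k * C + j + 1) = 2 ^ k * (1 + ((j : ℝ) + 1) / C) := by
  rcases lt_or_eq_of_le (show j + 1 ≤ C by omega) with h | h
  · rw [add_assoc, gridVal_eq (by omega) h]
    push_cast
    rfl
  · have e : k * (C : ℤ) + j + 1 = (k + 1) * C + 0 := by rw [add_assoc, h]; ring
    have hCR : (C : ℝ) ≠ 0 := by
      have : C ≠ 0 := by omega
      exact_mod_cast this
    have h' : (j : ℝ) + 1 = C := by exact_mod_cast h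
    rw [e, gridVal_eq le_rfl (by omega), zpow_add_one₀ two_ne_zero, h', div_self hCR]
    push_cast
    ring

/-- Consecutive values differ by `2 ^ k / C`. From here on, comparing frequencies is comparing
integers. -/
theorem gridVal_strictMono {C : ℕ} (hC : 0 < C) : StrictMono (gridVal C) := by
  apply strictMono_int_of_lt_succ
  intro κ
  have hCR : (0 : ℝ) < C := by exact_mod_cast hC
  have h0 := Int.emod_nonneg κ (show (C : ℤ) ≠ 0 by omega)
  have h1 := Int.emod_lt_of_pos κ (show (0 : ℤ) < C by omega)
  have e : κ = κ / C * C + κ % C := (Int.ediv_mul_add_emod κ C).symm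
  generalize κ / (C : ℤ) = k at *
  generalize κ % (C : ℤ) = j at *
  subst e
  rw [gridVal_eq h0 h1, gridVal_succ h0 h1]
  gcongr
  simp

theorem gridVal_sub (C : ℕ) (hC : 0 < C) (κ : ℤ) : gridVal C (κ - C) = gridVal C κ / 2 := by
  have hC' : (C : ℤ) ≠ 0 := by omega
  unfold gridVal
  rw [Int.sub_emod_right, Int.sub_ediv_of_dvd _ (dvd_refl _), Int.ediv_self hC',
    zpow_sub_one₀ two_ne_zero]
  ring

/-- Since `C + j = C * (1 + j / C)`, the quotient is `2 ^ lo / C`. With `C = 2 ^ c` it is a power of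
two and stays on the grid. -/
theorem gridVal_div {c : ℕ} {lo j : ℤ} (h0 : 0 ≤ j) (hj : j < (2 ^ c : ℕ)) :
    gridVal (2 ^ c) (lo * (2 ^ c : ℕ) + j) / ((2 ^ c : ℕ) + j : ℤ) =
      gridVal (2 ^ c) ((lo - c) * (2 ^ c : ℕ)) := by
  have e := gridVal_eq (C := 2 ^ c) (k := lo - c) (j := 0) le_rfl (by positivity)
  rw [add_zero] at e
  rw [gridVal_eq h0 hj, e, zpow_sub₀ two_ne_zero]
  have h1 : (0 : ℝ) < 2 ^ c := by positivity
  have h2 : (0 : ℝ) ≤ j := by exact_mod_cast h0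
  push_cast
  field_simp
  simp

/-- A key whose frequencies the Steps 3, 4 and 5 combine. -/
def Active (C lo : ℕ) (κ : ℤ) : Prop := lo ≤ κ / (C : ℤ) ∧ κ % (C : ℤ) ≠ 0

/-- The number of frequencies that are combined at a key. -/
noncomputable def arity (C lo : ℕ) (κ : ℤ) : ℕ :=
  if κ / (C : ℤ) = lo then C + (κ % (C : ℤ)).toNat else 2

/-- The key of a combined frequency. -/
noncomputable def combinedKey (c lo : ℕ) (κ : ℤ) : ℤ :=
  if κ / ((2 ^ c : ℕ) : ℤ) = lo then (lo - c) * (2 ^ c : ℕ) else κ - (2 ^ c : ℕ)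

theorem gridVal_combinedKey {c lo : ℕ} {κ : ℤ} :
    gridVal (2 ^ c) (combinedKey c lo κ) = gridVal (2 ^ c) κ / arity (2 ^ c) lo κ := by
  have hC : ((2 ^ c : ℕ) : ℤ) ≠ 0 := by positivity
  unfold combinedKey arity
  split_ifs with h
  · have h0 := Int.emod_nonneg κ hC
    have h1 := Int.emod_lt_of_pos κ (show (0 : ℤ) < (2 ^ c : ℕ) by positivity)
    rw [← gridVal_div (lo := lo) h0 h1, ← h, Int.ediv_mul_add_emod]
    congr 1
    have : ((κ % ((2 ^ c : ℕ) : ℤ)).toNat : ℤ) = κ % ((2 ^ c : ℕ) : ℤ) := Int.toNat_of_nonneg h0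
    exact_mod_cast (congrArg (fun x : ℤ => (2 ^ c : ℕ) + x) this).symm
  · rw [gridVal_sub _ (by positivity)]
    simp

/-- This makes a single descending pass sufficient: a combination never adds to a key that has been
left. -/
theorem combinedKey_lt {c lo : ℕ} {κ : ℤ} (h : Active (2 ^ c) lo κ) : combinedKey c lo κ < κ := by
  have hC : (0 : ℤ) < (2 ^ c : ℕ) := by positivity
  have h0 := Int.emod_nonneg κ hC.ne'
  have e := Int.ediv_mul_add_emod κ (2 ^ c : ℕ)
  unfold combinedKey
  split_ifs with hk
  · rw [hk] at e
    have := h.2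
    have h3 : (0 : ℤ) ≤ c * (2 ^ c : ℕ) := by positivity
    rw [sub_mul]
    omega
  · omega

theorem two_le_arity {C lo : ℕ} {κ : ℤ} (hC : 0 < C) (h : Active C lo κ) :
    2 ≤ arity C lo κ := by
  have h0 := Int.emod_nonneg κ (show (C : ℤ) ≠ 0 by omega)
  have := h.2
  unfold arity
  split_ifs <;> omega

/-! ### The Steps 3, 4 and 5 as one descent along the keys -/

variable {n : ℕ}

/-- The step at key `κ`; the frequencies left over are pushed down if `push` is true. -/
def KeyStep (push : Bool) (C lo : ℕ) (κ : ℤ) (S S' : Freqs n) : Prop :=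
  open Classical in
  if Active C lo κ then
    ∃ S₁, CombineAll (arity C lo κ) (gridVal C κ) S S₁ ∧
      S' = if push then pushDown (gridVal C κ) (gridVal C (κ - 1)) S₁ else S₁
  else S = S'

/-- `Desc R b S₀ κ S`: performing the steps `R b, R (b - 1), …, R (κ + 1)` leads from `S₀` to
`S`. -/
inductive Desc {β : Type} (R : ℤ → β → β → Prop) (b : ℤ) (S₀ : β) : ℤ → β → Prop
  | start : Desc R b S₀ b S₀
  | step {κ : ℤ} {S S' : β} (h : Desc R b S₀ κ S) (hR : R κ S S') : Desc R b S₀ (κ - 1) S'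

theorem Desc.le {β : Type} {R : ℤ → β → β → Prop} {b : ℤ} {S₀ : β} {κ : ℤ} {S : β}
    (h : Desc R b S₀ κ S) : κ ≤ b := by
  induction h with
  | start => exact le_rfl
  | step _ _ ih => omega

theorem ForEach.snoc {α β : Type} {R : α → β → β → Prop} {l : List α} {a : α} {S S' S'' : β}
    (h : ForEach R l S S') (h' : R a S' S'') : ForEach R (l ++ [a]) S S'' := by
  induction l generalizing S with
  | nil =>
    obtain rfl : S = S' := h
    exact ⟨S'', h', rfl⟩
  | cons b l ih =>
    obtain ⟨S₁, h₁, h₂⟩ := h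
    exact ⟨S₁, h₁, ih h₂⟩

theorem ForEach.of_append {α β : Type} {R : α → β → β → Prop} {l l' : List α} {S S' : β}
    (h : ForEach R (l ++ l') S S') : ∃ S₁, ForEach R l S S₁ ∧ ForEach R l' S₁ S' := by
  induction l generalizing S with
  | nil => exact ⟨S, rfl, h⟩
  | cons b l ih =>
    obtain ⟨S₁, h₁, h₂⟩ := h
    obtain ⟨S₂, h₃, h₄⟩ := ih h₂
    exact ⟨S₂, ⟨S₁, h₁, h₃⟩, h₄⟩

theorem ForEach.imp {α β : Type} {R R' : α → β → β → Prop} {l : List α} {S S' : β}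
    (h : ForEach R l S S') (hR : ∀ a ∈ l, ∀ S S', R a S S' → R' a S S') : ForEach R' l S S' := by
  induction l generalizing S with
  | nil => exact h
  | cons b l ih =>
    obtain ⟨S₁, h₁, h₂⟩ := h
    exact ⟨S₁, hR b (by simp) _ _ h₁, ih h₂ fun a ha => hR a (by simp [ha])⟩

theorem downTo_eq_append {b a : ℕ} (h : a ≤ b) : downTo b a = downTo b (a + 1) ++ [a] := by
  unfold downTo
  rw [List.Ico.eq_cons (show a < b + 1 by omega), List.reverse_cons]

theorem downTo_eq_nil {b a : ℕ} (h : b < a) : downTo b a = [] := by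
  unfold downTo
  rw [List.Ico.eq_nil_of_le (by omega)]
  rfl

theorem mem_downTo {b a k : ℕ} : k ∈ downTo b a ↔ a ≤ k ∧ k ≤ b := by
  unfold downTo
  rw [List.mem_reverse, List.Ico.mem]
  omega

/-- Standing at the key `k * C + j` means that the layers above `k` are finished and, in layer `k`,
the groups above `j`. Group `0` does nothing, so passing it closes the inner loop. The option `j + 1
= C` admits the final state just below layer `lo`. -/
theorem Desc.forEach {β : Type} {C hi lo : ℕ} (hC : 0 < C) {R : ℤ → β → β → Prop}
    {G : ℕ → ℕ → β → β → Prop} (hG : ∀ k j S S', lo ≤ k → 0 < j → j < C →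
      R ((k : ℤ) * C + j) S S' → G k j S S')
    (h0 : ∀ (k : ℕ) S S', R ((k : ℤ) * C) S S' → S = S') {S₀ : β} {κ : ℤ} {S : β}
    (h : Desc R ((hi + 1 : ℕ) * C - 1) S₀ κ S) :
    ∀ k j : ℕ, κ = k * C + j → lo ≤ k + 1 → (lo ≤ k ∨ j + 1 = C) → j < C →
      ∃ S₁, ForEach (fun k => ForEach (G k) (downTo (C - 1) 1)) (downTo hi (k + 1)) S₀ S₁ ∧
        ForEach (G k) (downTo (C - 1) (j + 1)) S₁ S := by
  induction h with
  | start =>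
    intro k j hκ hlo hlo' hj
    have hk : k = hi := by
      have h1 := key_ediv (C := C) (k := k) (j := j) (by omega) (by omega)
      rw [← hκ] at h1
      have h2 := key_ediv (C := C) (k := hi) (j := C - 1) (by omega) (by omega)
      rw [show ((hi : ℤ) * C + (C - 1)) = (hi + 1 : ℕ) * C - 1 by push_cast; ring] at h2
      exact_mod_cast h1.symm.trans h2
    subst hk
    have hjC : j = C - 1 := by
      push_cast at hκ
      rw [add_mul] at hκ
      omega
    rw [downTo_eq_nil (show k < k + 1 by omega), downTo_eq_nil (show C - 1 < j + 1 by omega)]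
    exact ⟨S₀, rfl, rfl⟩
  | @step κ S S' hD hR ih =>
    intro k j hκ hlo hlo' hj
    by_cases hjC : j + 1 < C
    · obtain ⟨S₁, h₁, h₂⟩ := ih k (j + 1) (by push_cast; omega) hlo (by omega) hjC
      refine ⟨S₁, h₁, ?_⟩
      rw [downTo_eq_append (by omega)]
      refine h₂.snoc (hG _ _ _ _ (by omega) (by omega) hjC ?_)
      rwa [show ((k : ℤ) * C + (j + 1 : ℕ)) = κ by push_cast; omega]
    · have hκ' : κ = ((k + 1 : ℕ) : ℤ) * C := by
        push_cast
        rw [add_mul]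
        omega
      obtain ⟨S₁, h₁, h₂⟩ := ih (k + 1) 0 (by rw [hκ']; simp) (by omega) (by omega) hC
      obtain rfl := h0 (k + 1) _ _ (hκ' ▸ hR)
      refine ⟨S, ?_, ?_⟩
      · by_cases hk : k + 1 ≤ hi
        · rw [downTo_eq_append hk]
          exact h₁.snoc h₂
        · have h1 := hD.le
          have h2 : ((hi + 1 : ℕ) : ℤ) * C ≤ κ := by
            rw [hκ']
            exact mul_le_mul_of_nonneg_right (by omega) (by omega)
          omega
      · rw [downTo_eq_nil (by omega)]
        rfl

/-- The frequencies of the pairs of a key and the name of a tree. -/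
noncomputable def freqs (C : ℕ) (tr : ℕ → FTree n) (M : Multiset (ℤ × ℕ)) : Freqs n :=
  M.map fun x => (gridVal C x.1, tr x.2)

/-- All steps above `κ`, and possibly some combinations at `κ`, have led from `S₀` to `S`. -/
def Reach (push : Bool) (C lo : ℕ) (b : ℤ) (S₀ : Freqs n) (κ : ℤ) (S : Freqs n) : Prop :=
  ∃ S₁, Desc (KeyStep push C lo) b S₀ κ S₁ ∧ Relation.ReflTransGen
    (fun S S' => Active C lo κ ∧ Combine (arity C lo κ) (gridVal C κ) S S') S₁ S

/-- When too few frequencies remain at `κ`, the combinations made so far are maximal and amount to a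
complete `KeyStep`. -/
theorem Reach.close {push : Bool} {C lo : ℕ} {b : ℤ} {S₀ : Freqs n} {κ : ℤ} {S S' : Freqs n}
    (h : Reach push C lo b S₀ κ S)
    (hc : Active C lo κ → Multiset.countP (fun x => x.1 = gridVal C κ) S < arity C lo κ)
    (h₁ : Active C lo κ → push = true → S' = pushDown (gridVal C κ) (gridVal C (κ - 1)) S)
    (h₂ : ¬ (Active C lo κ ∧ push = true) → S' = S) :
    Reach push C lo b S₀ (κ - 1) S' := by
  obtain ⟨S₁, hD, hR⟩ := h
  refine ⟨S', hD.step ?_, .refl⟩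
  unfold KeyStep
  split_ifs with ha hp
  · exact ⟨S, ⟨hR.lift id fun _ _ h => h.2, hc ha⟩, h₁ ha hp⟩
  · exact ⟨S, ⟨hR.lift id fun _ _ h => h.2, hc ha⟩, h₂ (by simp [hp])⟩
  · rw [h₂ (by simp [ha])]
    cases hR using Relation.ReflTransGen.head_induction_on with
    | refl => rfl
    | head h _ => exact absurd h.1 ha

theorem countP_freqs {C : ℕ} (hC : 0 < C) (tr : ℕ → FTree n) (M : Multiset (ℤ × ℕ)) (κ : ℤ) :
    Multiset.countP (fun x => x.1 = gridVal C κ) (freqs C tr M) =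
      Multiset.countP (fun x => x.1 = κ) M := by
  rw [freqs, Multiset.countP_map, Multiset.countP_eq_card_filter]
  simp only [(gridVal_strictMono hC).injective.eq_iff]

theorem pushDown_freqs {C : ℕ} (hC : 0 < C) (tr : ℕ → FTree n) (M : Multiset (ℤ × ℕ)) (κ κ' : ℤ) :
    pushDown (gridVal C κ) (gridVal C κ') (freqs C tr M) =
      freqs C tr (M.map fun x => if x.1 = κ then (κ', x.2) else x) := by
  rw [freqs, pushDown, freqs, Multiset.map_map, Multiset.map_map]
  apply Multiset.map_congr rfl
  intro x _
  simp only [Function.comp, (gridVal_strictMono hC).injective.eq_iff]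
  split_ifs <;> rfl

/-- The state of the descent: `H` is in the heap, `T` has been taken out at the key `κ`, and `L` is
in the list of the frequencies that are finished. -/
structure Descent (push : Bool) (C lo : ℕ) (b : ℤ) (S₀ : Freqs n) (tr : ℕ → FTree n) (κ : ℤ)
    (H : Multiset (ℤ × ℕ)) (T : Multiset ℕ) (L : Multiset (ℤ × ℕ)) : Prop where
  reach : Reach push C lo b S₀ κ (freqs C tr (H + T.map (fun i => (κ, i)) + L))
  heap_le : ∀ x ∈ H, x.1 ≤ κ
  list_le : ∀ x ∈ L, x.1 ≤ b
  list : ∀ x ∈ L, ¬ Active C lo x.1 ∨ (push = false ∧ κ < x.1)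
  temp_le : Active C lo κ → T.card ≤ arity C lo κ

namespace Descent

variable {push : Bool} {C lo : ℕ} {b : ℤ} {S₀ : Freqs n} {tr : ℕ → FTree n} {κ : ℤ}
    {H : Multiset (ℤ × ℕ)} {T : Multiset ℕ} {L : Multiset (ℤ × ℕ)}

theorem le (h : Descent push C lo b S₀ tr κ H T L) : κ ≤ b := by
  obtain ⟨S₁, hD, -⟩ := h.reach
  exact hD.le

theorem start (hb : ∀ x ∈ H, x.1 ≤ b) :
    Descent push C lo b (freqs C tr H) tr b H 0 0 where
  reach := by
    refine ⟨_, Desc.start, ?_⟩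
    simp only [Multiset.map_zero, add_zero]
    exact .refl
  heap_le := hb
  list_le := by simp
  list := by simp
  temp_le := by simp

theorem pop {i : ℕ} (h : Descent push C lo b S₀ tr κ ((κ, i) ::ₘ H) T L)
    (hT : Active C lo κ → T.card < arity C lo κ) : Descent push C lo b S₀ tr κ H (i ::ₘ T) L where
  reach := by
    have := h.reach
    rwa [show (κ, i) ::ₘ H + T.map (fun i => (κ, i)) + L =
      H + (i ::ₘ T).map (fun i => (κ, i)) + L by
        rw [Multiset.map_cons, Multiset.add_cons, Multiset.cons_add]] at this
  heap_le x hx := h.heap_le x (Multiset.mem_cons_of_mem hx)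
  list_le := h.list_le
  list := h.list
  temp_le ha := by
    rw [Multiset.card_cons]
    exact hT ha

/-- The trees of `H` and `L` keep their names, so the only change is that `T` gives way to the new
node. Its key is smaller than `κ`, hence it may go back to the heap. -/
theorem combine {c r : ℕ} {t : ℕ → ℕ} {cnt : ℕ}
    (h : Descent push (2 ^ c) lo b S₀ tr κ H ((Multiset.range r).map t) L)
    (ha : Active (2 ^ c) lo κ) (hr : r = arity (2 ^ c) lo κ)
    {tr' : ℕ → FTree n} (htr : ∀ x ∈ H + L, tr' x.2 = tr x.2)
    (hcnt : tr' cnt = FTree.node r fun l => tr (t l)) :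
    Descent push (2 ^ c) lo b S₀ tr' κ ((combinedKey c lo κ, cnt) ::ₘ H) 0 L where
  reach := by
    obtain ⟨S₁, hD, hR⟩ := h.reach
    refine ⟨S₁, hD, hR.tail ⟨ha, ?_⟩⟩
    have hfr : freqs (2 ^ c) tr' (H + L) = freqs (2 ^ c) tr (H + L) := by
      apply Multiset.map_congr rfl
      intro x hx
      rw [htr x hx]
    have e1 : freqs (2 ^ c) tr (H + ((Multiset.range r).map t).map (fun i => (κ, i)) + L) =
        freqs (2 ^ c) tr (H + L) +
          Finset.univ.val.map fun l : Fin r => (gridVal (2 ^ c) κ, tr (t l)) := by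
      rw [map_univ_fin_eq_map_range r fun l => (gridVal (2 ^ c) κ, tr (t l))]
      simp only [freqs, Multiset.map_add, Multiset.map_map, Function.comp_def]
      rw [add_right_comm]
    have e2 : freqs (2 ^ c) tr' ((combinedKey c lo κ, cnt) ::ₘ H +
        (0 : Multiset ℕ).map (fun i => (κ, i)) + L) = freqs (2 ^ c) tr (H + L) +
          {(gridVal (2 ^ c) κ / (r : ℝ), FTree.node r fun l => tr (t l))} := by
      rw [← hfr, hr, ← gridVal_combinedKey, ← hr, ← hcnt]
      simp only [freqs, Multiset.map_zero, add_zero, Multiset.cons_add, Multiset.map_cons]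
      rw [add_comm _ {_}, Multiset.singleton_add]
    rw [e1, e2, ← hr]
    exact Combine.mk _ _
  heap_le x hx := by
    rcases Multiset.mem_cons.1 hx with rfl | hx
    · exact (combinedKey_lt ha).le
    · exact h.heap_le x hx
  list_le := h.list_le
  list := h.list
  temp_le := by simp

/-- The frequencies at `κ` that are left over go to the list. -/
theorem flush (hC : 0 < C) (h : Descent push C lo b S₀ tr κ H T L)
    (hH : ∀ x ∈ H, x.1 < κ) (hT : Active C lo κ → T.card < arity C lo κ)
    (ha : ¬ Active C lo κ ∨ push = false) :
    Descent push C lo b S₀ tr (κ - 1) H 0 (L + T.map fun i => (κ, i)) where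
  reach := by
    refine h.reach.close (fun hact => ?_) (fun h₁ h₂ => ?_) (fun _ => ?_)
    · rw [countP_freqs hC, Multiset.countP_add, Multiset.countP_add]
      rw [Multiset.countP_eq_zero.2 fun x hx => (hH x hx).ne]
      rw [Multiset.countP_eq_zero (s := L) |>.2 fun x hx hxκ => ?_]
      · rw [add_zero, zero_add]
        refine (Multiset.countP_le_card _ _).trans_lt ?_
        rw [Multiset.card_map]
        exact hT hact
      · rcases h.list x hx with h | h
        · exact h (hxκ ▸ hact)
        · omega
    · rcases ha with ha | ha
      · exact absurd h₁ ha
      · simp [h₂] at ha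
    · rw [Multiset.map_zero, add_zero, add_assoc H, add_comm _ L]
  heap_le x hx := by have := hH x hx; omega
  list_le x hx := by
    rcases Multiset.mem_add.1 hx with hx | hx
    · exact h.list_le x hx
    · obtain ⟨i, -, rfl⟩ := Multiset.mem_map.1 hx
      exact h.le
  list x hx := by
    rcases Multiset.mem_add.1 hx with hx | hx
    · exact (h.list x hx).imp_right fun h => ⟨h.1, by omega⟩
    · obtain ⟨i, -, rfl⟩ := Multiset.mem_map.1 hx
      exact ha.imp_right fun h => ⟨h, by dsimp only; omega⟩
  temp_le := by simp

/-- Move to the next key; the frequencies in `T` are pushed down. -/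
theorem down (hC : 0 < C) (h : Descent push C lo b S₀ tr κ H T L)
    (hH : ∀ x ∈ H, x.1 < κ) (hT : T = 0 ∨ (push = true ∧ Active C lo κ ∧ T.card < arity C lo κ))
    (hT' : Active C lo (κ - 1) → T.card ≤ arity C lo (κ - 1)) :
    Descent push C lo b S₀ tr (κ - 1) H T L where
  reach := by
    have hL : ∀ x ∈ L, Active C lo κ → x.1 ≠ κ := by
      intro x hx hact hxκ
      rcases h.list x hx with h | h
      · exact h (hxκ ▸ hact)
      · omega
    refine h.reach.close (fun hact => ?_) (fun h₁ h₂ => ?_) (fun h₁ => ?_)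
    · rw [countP_freqs hC, Multiset.countP_add, Multiset.countP_add]
      rw [Multiset.countP_eq_zero.2 fun x hx => (hH x hx).ne]
      rw [Multiset.countP_eq_zero (s := L) |>.2 fun x hx => hL x hx hact]
      rw [add_zero, zero_add]
      refine (Multiset.countP_le_card _ _).trans_lt ?_
      rw [Multiset.card_map]
      rcases hT with rfl | hT
      · have := two_le_arity hC hact
        simp; omega
      · exact hT.2.2
    · rw [pushDown_freqs hC]
      congr 1
      rw [Multiset.map_add, Multiset.map_add, Multiset.map_map]
      congr 1
      · congr 1
        · conv_lhs => rw [← Multiset.map_id H]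
          apply Multiset.map_congr rfl
          intro x hx
          simp [(hH x hx).ne]
        · apply Multiset.map_congr rfl
          intro x hx
          simp
      · conv_lhs => rw [← Multiset.map_id L]
        apply Multiset.map_congr rfl
        intro x hx
        simp [hL x hx h₁]
    · rcases hT with rfl | hT
      · simp
      · exact absurd ⟨hT.2.1, hT.1⟩ h₁
  heap_le x hx := by have := hH x hx; omega
  list_le := h.list_le
  list x hx := (h.list x hx).imp_right fun h => ⟨h.1, by omega⟩
  temp_le := hT'

/-- Without frequencies taken out, the descent may go on at any key above the heap. -/
theorem move_empty (hC : 0 < C) (h : Descent push C lo b S₀ tr κ H 0 L) {κ' : ℤ} (hκ : κ' ≤ κ)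
    (hH : ∀ x ∈ H, x.1 ≤ κ') : Descent push C lo b S₀ tr κ' H 0 L := by
  induction κ, hκ using Int.leInduction with
  | base => exact h
  | succ κ hκ ih =>
    apply ih
    have := h.down hC (fun x hx => by have := hH x hx; omega) (Or.inl rfl) (by simp)
    rwa [add_sub_cancel_right] at this

/-- Frequencies are pushed down to the next key where something happens. -/
theorem move_push (hC : 0 < C) (h : Descent true C lo b S₀ tr κ H T L) {κ' : ℤ} (hκ : κ' ≤ κ)
    (hH : ∀ x ∈ H, x.1 ≤ κ') (hact : Active C lo κ) (hT : T.card < arity C lo κ)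
    (h₁ : κ / C * C ≤ κ') (h₂ : (lo - 1) * C + (T.card : ℤ) ≤ κ') :
    Descent true C lo b S₀ tr κ' H T L := by
  have hC' : (0 : ℤ) < C := by omega
  induction κ, hκ using Int.leInduction with
  | base => exact h
  | succ κ hκ ih =>
    have e := Int.ediv_mul_add_emod (κ + 1) C
    have hm := Int.emod_lt_of_pos (κ + 1) hC'
    have hm0 := Int.emod_nonneg (κ + 1) hC'.ne'
    -- The bottom of the layer is at most `κ'`, so the walk never leaves the layer.
    have hd : κ / (C : ℤ) = (κ + 1) / C := by
      have := key_ediv (C := C) (k := (κ + 1) / C) (j := κ - (κ + 1) / C * C) (by omega) (by omega)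
      rwa [add_sub_cancel] at this
    have hm' : κ % (C : ℤ) = (κ + 1) % C - 1 := by
      have := Int.ediv_mul_add_emod κ C
      rw [hd] at this
      omega
    -- In layer `lo` the arity at `κ` equals `κ - (lo - 1) * C`, so `h₂` keeps it from falling below
    -- `T.card`. In higher layers it is constantly `2`.
    have har : T.card ≤ arity C lo κ := by
      unfold arity at hT ⊢
      rw [hd]
      split_ifs at hT ⊢ with hk
      · have h3 := h₂
        rw [hk] at e
        rw [sub_mul, one_mul] at h3
        omega
      · omega
    have h' := h.down hC (fun x hx => by have := hH x hx; omega) (Or.inr ⟨rfl, hact, hT⟩)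
      (by rw [add_sub_cancel_right]; exact fun _ => har)
    rw [add_sub_cancel_right] at h'
    rcases hκ.eq_or_lt with rfl | hlt
    · exact h'
    · refine ih h' ⟨hd ▸ hact.1, ?_⟩ ?_ (hd ▸ h₁)
      · rw [hm']
        rw [hd.symm] at h₁ e
        omega
      · unfold arity at hT ⊢
        rw [hd]
        split_ifs at hT ⊢ with hk
        · have h3 := h₂
          rw [hk] at e
          rw [sub_mul, one_mul] at h3
          omega
        · omega

/-- Combined frequencies can lie below layer `lo`, so the machine may stop at a key under the
intended end. No key down there is active, hence those steps change nothing and can be dropped. -/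
theorem finish (hC : 0 < C) (hb : (lo : ℤ) * C - 1 ≤ b)
    (h : Descent push C lo b S₀ tr κ 0 0 L) :
    Desc (KeyStep push C lo) b S₀ ((lo : ℤ) * C - 1) (freqs C tr L) := by
  have hna : ∀ κ : ℤ, κ ≤ lo * C - 1 → ¬ Active C lo κ := by
    rintro κ hκ ⟨h₁, -⟩
    have h2 := Int.mul_le_of_le_ediv (show (0 : ℤ) < C by omega) h₁
    omega
  have h' := h.move_empty hC (min_le_left κ ((lo : ℤ) * C - 1)) (by simp)
  obtain ⟨S₁, hD, hR⟩ := h'.reach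
  have hm : min κ ((lo : ℤ) * C - 1) ≤ lo * C - 1 := min_le_right _ _
  generalize min κ ((lo : ℤ) * C - 1) = κ₁ at hD hR hm
  have hS : S₁ = freqs C tr L := by
    rw [Multiset.map_zero, add_zero, zero_add] at hR
    cases hR using Relation.ReflTransGen.head_induction_on with
    | refl => rfl
    | head h _ => exact absurd h.1 (hna _ hm)
  subst hS
  clear hR h' h
  generalize freqs C tr L = S at hD
  induction hD with
  | start =>
    rw [le_antisymm hm hb]
    exact Desc.start
  | @step κ S S' hD hR ih =>
    rcases hm.eq_or_lt with h | h
    · rw [← h]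
      exact hD.step hR
    · have hκ : κ ≤ lo * C - 1 := by omega
      rw [KeyStep, if_neg (hna κ hκ)] at hR
      exact hR ▸ ih hκ

end Descent

/-! ### The parts of the memory -/

/-- A pair of a key and a name as it is stored. -/
def entry (x : ℤ × ℕ) : ℝ × ℝ := (-(x.1 : ℝ), (x.2 : ℝ))

/-- The heap holds the pairs `H`, those with the largest keys at the top. -/
def HeapAt (σ : Mem) (H : Multiset (ℤ × ℕ)) : Prop := Heap σ H.card (H.map entry)

/-- The array `10` holds the names `T`, and register `19` their number. -/
def TempAt (σ : Mem) (T : Multiset ℕ) : Prop :=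
  σ.reg 19 = T.card ∧ ∃ t : ℕ → ℕ, T = (Multiset.range T.card).map t ∧
    ∀ l < T.card, σ.arr 10 l = t l

/-- The arrays `8` and `9` hold the pairs `L`, and register `17` their number. -/
def ListAt (σ : Mem) (L : Multiset (ℤ × ℕ)) : Prop :=
  σ.reg 17 = L.card ∧
    ((Multiset.range L.card).map fun i => (σ.arr 8 i, σ.arr 9 i)) = L.map entry

/-- The arrays `5`, `6` and `7` hold the parent of the tree `i`, the number of `i` among the children
of the parent, and the number of these children. -/
def HasParent (σ : Mem) (tr : ℕ → FTree n) (cnt i : ℕ) : Prop :=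
  ∃ (t m : ℕ) (child : Fin m → FTree n) (l : Fin m), i < t ∧ t < cnt ∧ σ.arr 5 i = t ∧
    σ.arr 6 i = (l : ℕ) ∧ σ.arr 7 t = m ∧ tr t = FTree.node m child ∧ child l = tr i

/-- The memory holds the trees `tr i` with `i < cnt`; those with names in `A` have no parent. -/
structure Forest (σ : Mem) (tr : ℕ → FTree n) (cnt : ℕ) (A : Multiset ℕ) : Prop where
  reg : σ.reg 16 = cnt
  leaf : ∀ i : Fin n, tr i = FTree.leaf i
  le : n ≤ cnt
  lt : ∀ i ∈ A, i < cnt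
  nodup : A.Nodup
  parent : ∀ i < cnt, i ∈ A ∨ HasParent σ tr cnt i
  card : cnt + A.card ≤ 2 * n

section congr

variable {σ σ' : Mem}

theorem HeapAt.congr {H : Multiset (ℤ × ℕ)} (h : HeapAt σ H) (h2 : σ'.reg 2 = σ.reg 2)
    (h3 : σ'.arr 3 = σ.arr 3) (h4 : σ'.arr 4 = σ.arr 4) : HeapAt σ' H :=
  Heap.congr h h2 h3 h4

theorem TempAt.congr {T : Multiset ℕ} (h : TempAt σ T) (h19 : σ'.reg 19 = σ.reg 19)
    (h10 : σ'.arr 10 = σ.arr 10) : TempAt σ' T := by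
  unfold TempAt at *
  rwa [h19, h10]

theorem ListAt.congr {L : Multiset (ℤ × ℕ)} (h : ListAt σ L) (h17 : σ'.reg 17 = σ.reg 17)
    (h8 : σ'.arr 8 = σ.arr 8) (h9 : σ'.arr 9 = σ.arr 9) : ListAt σ' L := by
  unfold ListAt at *
  rwa [h17, h8, h9]

theorem Forest.congr {tr : ℕ → FTree n} {cnt : ℕ} {A : Multiset ℕ} (h : Forest σ tr cnt A)
    (h16 : σ'.reg 16 = σ.reg 16) (h5 : σ'.arr 5 = σ.arr 5) (h6 : σ'.arr 6 = σ.arr 6)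
    (h7 : σ'.arr 7 = σ.arr 7) : Forest σ' tr cnt A where
  reg := h16.trans h.reg
  leaf := h.leaf
  le := h.le
  lt := h.lt
  nodup := h.nodup
  parent i hi := by
    have := h.parent i hi
    unfold HasParent at *
    rwa [h5, h6, h7]
  card := h.card

end congr

theorem HeapAt.reg {σ : Mem} {H : Multiset (ℤ × ℕ)} (h : HeapAt σ H) : σ.reg 2 = H.card := h.1

/-- Keys are stored negated, which turns the minimum of the heap into the largest frequency. -/
theorem HeapAt.top {σ : Mem} {H : Multiset (ℤ × ℕ)} (h : HeapAt σ H) (h0 : H ≠ 0) :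
    ∃ κ : ℤ, σ.arr 4 0 = -(κ : ℝ) ∧ (∃ x ∈ H, x.1 = κ) ∧ ∀ x ∈ H, x.1 ≤ κ := by
  obtain ⟨⟨y, hy, hy'⟩, h₂⟩ := Heap.top h (Multiset.card_pos.2 h0)
  obtain ⟨x, hx, rfl⟩ := Multiset.mem_map.1 hy
  refine ⟨x.1, hy'.symm, ⟨x, hx, rfl⟩, fun z hz => ?_⟩
  have := h₂ _ (Multiset.mem_map_of_mem entry hz)
  rw [← hy'] at this
  simp only [entry, neg_le_neg_iff, Int.cast_le] at this
  exact this

/-! ### Heap operations on integer keys -/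

theorem heapInsert_at {σ : Mem} {H : Multiset (ℤ × ℕ)} {κ : ℤ} {i : ℕ} (h : HeapAt σ H)
    (h6 : σ.reg 6 = -(κ : ℝ)) (h7 : σ.reg 7 = i) :
    Runs heapInsert σ fun σ' τ => τ ≤ 60 * Nat.log 2 (H.card + 1) + 40 ∧
      HeapAt σ' ((κ, i) ::ₘ H) := by
  refine (heapInsert_spec h).mono ?_
  rintro σ' τ ⟨hτ, hH⟩
  refine ⟨hτ, ?_⟩
  unfold HeapAt
  rwa [Multiset.card_cons, Multiset.map_cons, entry, ← h6, ← h7]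

theorem heapPop_at {σ : Mem} {H : Multiset (ℤ × ℕ)} (h : HeapAt σ H) (h0 : H ≠ 0) :
    Runs heapPop σ fun σ' τ => τ ≤ 150 * Nat.log 2 H.card + 80 ∧ ∃ κ i H', H = (κ, i) ::ₘ H' ∧
      (∀ x ∈ H, x.1 ≤ κ) ∧ σ.arr 4 0 = -(κ : ℝ) ∧ σ'.reg 6 = -(κ : ℝ) ∧ σ'.reg 7 = i ∧
      HeapAt σ' H' := by
  obtain ⟨s, hs⟩ : ∃ s, H.card = s + 1 := ⟨H.card - 1, by
    have := Multiset.card_pos.2 h0; omega⟩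
  obtain ⟨κ₀, e₀, -, hmax⟩ := h.top h0
  have h' : Heap σ (s + 1) (H.map entry) := hs ▸ h
  refine (heapPop_spec h').mono ?_
  rintro σ' τ ⟨hτ, h6, M', hM, hH⟩
  obtain ⟨x, hx, hxe, hM'⟩ := (Multiset.map_eq_cons entry H M' _).2 hM
  obtain ⟨κ, i⟩ := x
  have e := Multiset.cons_erase hx
  have e6 : σ'.reg 6 = -(κ : ℝ) := (congrArg Prod.fst hxe).symm
  have hκ : κ = κ₀ := by
    rw [e6, e₀] at h6
    exact_mod_cast neg_injective h6
  refine ⟨?_, κ, i, H.erase (κ, i), e.symm, hκ ▸ hmax, hκ ▸ e₀, e6,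
    (congrArg Prod.snd hxe).symm, ?_⟩
  · have : Nat.log 2 s ≤ Nat.log 2 H.card := Nat.log_mono_right (by omega)
    omega
  · have hc : (H.erase (κ, i)).card = s := by
      have := congrArg Multiset.card e
      rw [Multiset.card_cons] at this
      omega
    unfold HeapAt
    rwa [hc, hM']

/-! ### Building trees, and moving frequencies between array, list and heap -/

/-- Put the trees in the array `10` under a new tree and insert this one into the heap, with the key
in register `6`. -/
def combineProg : Prog :=
  .seq (.setReg 23 (const 0)) <|
  .seq (.loop (.lt (reg 23) (reg 19)) <|
    .seq (.setCell 5 (cell 10 (reg 23)) (reg 16)) <|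
    .seq (.setCell 6 (cell 10 (reg 23)) (reg 23)) <|
    .setReg 23 (add (reg 23) (const 1))) <|
  .seq (.setCell 7 (reg 16) (reg 19)) <|
  .seq (.setReg 7 (reg 16)) <|
  .seq (.setReg 16 (add (reg 16) (const 1))) <|
  .seq (.setReg 19 (const 0)) heapInsert

/-- Distinct names ensure that a later child does not overwrite the record of an earlier one. -/
theorem combineLoop_spec {σ : Mem} {r cnt : ℕ} {t : ℕ → ℕ} (h19 : σ.reg 19 = r)
    (h16 : σ.reg 16 = cnt) (h23 : σ.reg 23 = 0) (ht : ∀ l < r, σ.arr 10 l = t l)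
    (hinj : ∀ l < r, ∀ l' < r, t l = t l' → l = l') :
    Runs (.loop (.lt (reg 23) (reg 19)) <|
      .seq (.setCell 5 (cell 10 (reg 23)) (reg 16)) <|
      .seq (.setCell 6 (cell 10 (reg 23)) (reg 23)) <|
      .setReg 23 (add (reg 23) (const 1))) σ fun σ' τ => τ ≤ 30 * r + 10 ∧
        (∀ l < r, σ'.arr 5 (t l) = cnt ∧ σ'.arr 6 (t l) = l) ∧
        ∀ i, (∀ l < r, i ≠ t l) → σ'.arr 5 i = σ.arr 5 i ∧ σ'.arr 6 i = σ.arr 6 i := by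
  refine Runs.loop (fun σ' B => ∃ k ≤ r, σ'.reg 23 = (k : ℕ) ∧ σ'.reg 19 = r ∧ σ'.reg 16 = cnt ∧
    σ'.arr 10 = σ.arr 10 ∧ (∀ l < k, σ'.arr 5 (t l) = cnt ∧ σ'.arr 6 (t l) = l) ∧
    (∀ i, (∀ l < r, i ≠ t l) → σ'.arr 5 i = σ.arr 5 i ∧ σ'.arr 6 i = σ.arr 6 i) ∧
    B = 30 * (r - k)) (30 * r) ?_ ?_ ?_
  · exact ⟨0, by omega, by simpa using h23, h19, h16, rfl, by omega, fun i _ => ⟨rfl, rfl⟩, rfl⟩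
  · rintro σ' B ⟨k, hk, e23, e19, e16, e10, h₁, h₂, rfl⟩ hb
    have hkr : k < r := by simpa [e23, e19] using hb
    repeat' with_reducible first | apply Runs.seq | apply Runs.setReg | apply Runs.setCell
    have etk := ht k hkr
    refine ⟨_, ⟨k + 1, hkr, by simp [e23], by simp [e19], by simp [e16], ?_, ?_, ?_, rfl⟩, ?_⟩
    · funext i
      simp [e10]
    · intro l hl
      rcases Nat.lt_succ_iff_lt_or_eq.1 hl with hl | rfl
      · have hne : t l ≠ t k := fun h => by
          have := hinj l (by omega) k hkr h
          omega
        simpa [e23, e10, etk, hne] using h₁ l hl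
      · simp [e23, e10, etk, e16]
    · intro i hi
      have hne : i ≠ t k := hi k hkr
      simpa [e23, e10, etk, hne] using h₂ i hi
    · simp
      omega
  · rintro σ' τ B' ⟨k, hk, e23, e19, e16, e10, h₁, h₂, rfl⟩ hb hτ
    have hkr : k = r := by
      have : r ≤ k := by simpa [e23, e19] using hb
      omega
    subst hkr
    simp at hτ
    exact ⟨by omega, h₁, h₂⟩

/-- One name is added and at least two roots become one, so the bound `cnt + A.card ≤ 2 * n` in
`Forest` survives. This uses `2 ≤ T.card`. -/
theorem combineProg_spec {σ : Mem} {tr : ℕ → FTree n} {cnt : ℕ} {H : Multiset (ℤ × ℕ)}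
    {T A : Multiset ℕ} {κ : ℤ} (hH : HeapAt σ H) (hT : TempAt σ T) (hF : Forest σ tr cnt (T + A))
    (h6 : σ.reg 6 = -(κ : ℝ)) (hT2 : 2 ≤ T.card) :
    Runs combineProg σ fun σ' τ => τ ≤ 30 * T.card + 60 * Nat.log 2 (H.card + 1) + 80 ∧
      ∃ (tr' : ℕ → FTree n) (t : ℕ → ℕ), HeapAt σ' ((κ, cnt) ::ₘ H) ∧ TempAt σ' 0 ∧
        Forest σ' tr' (cnt + 1) (cnt ::ₘ A) ∧ (∀ i < cnt, tr' i = tr i) ∧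
        T = (Multiset.range T.card).map t ∧ (∀ l < T.card, σ.arr 10 l = t l) ∧
        tr' cnt = FTree.node T.card fun l => tr (t l) := by
  obtain ⟨h19, t, hTt, ht⟩ := hT
  have hTn : T.Nodup := (Multiset.nodup_add.1 hF.nodup).1
  have hinj : ∀ l < T.card, ∀ l' < T.card, t l = t l' → l = l' := by
    rw [hTt] at hTn
    intro l hl l' hl' he
    exact Multiset.inj_on_of_nodup_map hTn l (by simpa using hl) l' (by simpa using hl') he
  have htm : ∀ l < T.card, t l ∈ T := by
    intro l hl
    rw [hTt]
    exact Multiset.mem_map_of_mem t (by simpa using hl)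
  apply Runs.seq
  apply Runs.setReg
  refine Runs.seq_spec (combineLoop_spec (r := T.card) (cnt := cnt) (t := t) (by simpa using h19)
    (by simpa using hF.reg) (by simp) (by simpa using ht) hinj) ?_
  rintro σ₁ τ₁ hfr ⟨hτ₁, h₁, h₂⟩
  have e16 : σ₁.reg 16 = cnt := by rw [hfr.1 16 rfl]; simpa using hF.reg
  have e19 : σ₁.reg 19 = T.card := by rw [hfr.1 19 rfl]; simpa using h19
  have e7 : σ₁.arr 7 = σ.arr 7 := by rw [hfr.2 7 rfl]; rfl
  have e6 : σ₁.reg 6 = -(κ : ℝ) := by rw [hfr.1 6 rfl]; simpa using h6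
  have hH₁ : HeapAt σ₁ H := hH.congr (by rw [hfr.1 2 rfl]; simp) (by rw [hfr.2 3 rfl]; rfl)
    (by rw [hfr.2 4 rfl]; rfl)
  repeat' with_reducible first | apply Runs.seq | apply Runs.setReg | apply Runs.setCell
  refine Runs.mono (Runs.frame (heapInsert_at (H := H) (κ := κ) (i := cnt)
    (hH₁.congr (by simp) (by funext i; simp) (by funext i; simp)) (by simpa using e6)
    (by simpa using e16))) ?_
  rintro σ₂ τ₂ ⟨hfr₂, hτ₂, hH₂⟩
  have f5 : σ₂.arr 5 = σ₁.arr 5 := by rw [hfr₂.2 5 rfl]; funext i; simp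
  have f6 : σ₂.arr 6 = σ₁.arr 6 := by rw [hfr₂.2 6 rfl]; funext i; simp
  have f7 : ∀ i, σ₂.arr 7 i = if i = cnt then (T.card : ℝ) else σ.arr 7 i := by
    intro i
    rw [hfr₂.2 7 rfl]
    simp [e16, e19, e7]
  -- The name `cnt` is fresh, so the update affects no existing tree.
  let tr' : ℕ → FTree n := Function.update tr cnt (FTree.node T.card fun l => tr (t l))
  have htr : ∀ i < cnt, tr' i = tr i := fun i hi => Function.update_of_ne hi.ne _ _
  have htr' : tr' cnt = FTree.node T.card fun l => tr (t l) := Function.update_self _ _ _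
  refine ⟨?_, tr', t, hH₂, ⟨?_, t, by simp, by simp⟩, ?_, htr, hTt, ht, htr'⟩
  · simp
    omega
  · rw [hfr₂.1 19 rfl]; simp
  · refine ⟨?_, fun i => ?_, by have := hF.le; omega, ?_, ?_, ?_, ?_⟩
    · rw [hfr₂.1 16 rfl]; simp [e16]
    · rw [htr i (by have := i.2; have := hF.le; omega)]
      exact hF.leaf i
    · intro i hi
      rcases Multiset.mem_cons.1 hi with rfl | hi
      · omega
      · have := hF.lt i (Multiset.mem_add.2 (Or.inr hi)); omega
    · refine Multiset.nodup_cons.2 ⟨fun h => ?_, (Multiset.nodup_add.1 hF.nodup).2.1⟩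
      exact (hF.lt cnt (Multiset.mem_add.2 (Or.inr h))).false
    · intro i hi
      rcases Nat.lt_succ_iff_lt_or_eq.1 hi with hi | rfl
      · by_cases hiT : i ∈ T
        · right
          rw [hTt] at hiT
          obtain ⟨l, hl, rfl⟩ := Multiset.mem_map.1 hiT
          have hl' : l < T.card := by simpa using hl
          refine ⟨cnt, T.card, fun l => tr (t l), ⟨l, hl'⟩, hi, by omega, ?_, ?_, ?_, htr', ?_⟩
          · rw [f5]; exact (h₁ l hl').1
          · rw [f6]; exact (h₁ l hl').2
          · rw [f7]; simp
          · rw [htr _ hi]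
        · have h₂' := h₂ i fun l hl h => hiT (h ▸ htm l hl)
          rcases hF.parent i hi with h | ⟨p, m, child, l, hip, hpc, g5, g6, g7, g, g'⟩
          · left
            rcases Multiset.mem_add.1 h with h | h
            · exact absurd h hiT
            · exact Multiset.mem_cons_of_mem h
          · right
            refine ⟨p, m, child, l, hip, by omega, ?_, ?_, ?_, ?_, ?_⟩
            · rw [f5, h₂'.1]; simpa using g5
            · rw [f6, h₂'.2]; simpa using g6
            · rw [f7, if_neg hpc.ne]; exact g7
            · rw [htr _ hpc, g]
            · rw [htr _ hi, g']
      · left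
        exact Multiset.mem_cons_self _ _
    · have h₃ := hF.card
      rw [Multiset.card_add] at h₃
      rw [Multiset.card_cons]
      omega

/-- Move the trees in the array `10` to the list, with the key in register `20`. -/
def flushProg : Prog :=
  .loop (.le (const 1) (reg 19)) <|
  .seq (.setReg 19 (sub (reg 19) (const 1))) <|
  .seq (.setCell 8 (reg 17) (sub (const 0) (reg 20))) <|
  .seq (.setCell 9 (reg 17) (cell 10 (reg 19))) <|
  .setReg 17 (add (reg 17) (const 1))

theorem flushProg_spec {σ : Mem} {T : Multiset ℕ} {L : Multiset (ℤ × ℕ)} {κ : ℤ}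
    (hT : TempAt σ T) (hL : ListAt σ L) (h20 : σ.reg 20 = κ) :
    Runs flushProg σ fun σ' τ => τ ≤ 40 * T.card + 10 ∧ TempAt σ' 0 ∧
      ListAt σ' (L + T.map fun i => (κ, i)) := by
  refine Runs.loop (fun σ' B => ∃ T' T'', T = T' + T'' ∧ TempAt σ' T' ∧
    ListAt σ' (L + T''.map fun i => (κ, i)) ∧ σ'.reg 20 = κ ∧ B = 40 * T'.card)
    (40 * T.card) ⟨T, 0, by simp, hT, by simpa using hL, h20, rfl⟩ ?_ ?_
  · rintro σ₁ B ⟨T', T'', rfl, ⟨h19, t, hTt, ht⟩, ⟨h17, hL⟩, h20, rfl⟩ hb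
    have h0 : 1 ≤ T'.card := by simpa [h19] using hb
    obtain ⟨r, hr⟩ : ∃ r, T'.card = r + 1 := ⟨T'.card - 1, by omega⟩
    rw [hr] at hTt ht h19
    rw [Multiset.range_succ, Multiset.map_cons] at hTt
    repeat' with_reducible first | apply Runs.seq | apply Runs.setReg | apply Runs.setCell
    have hc : ((Multiset.range r).map t).card = r := by simp
    refine ⟨_, ⟨(Multiset.range r).map t, t r ::ₘ T'', ?_, ⟨?_, t, by rw [hc], ?_⟩, ⟨?_, ?_⟩, by simp [h20],
      rfl⟩, ?_⟩
    · rw [hTt, Multiset.cons_add, Multiset.add_cons]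
    · simp [h19]
    · rw [hc]
      intro l hl
      simpa using ht l (by omega)
    · simp [h17]
    · have e : L + (t r ::ₘ T'').map (fun i => (κ, i)) =
          (κ, t r) ::ₘ (L + T''.map fun i => (κ, i)) := by
        rw [Multiset.map_cons, Multiset.add_cons]
      have e1 := ht r (by omega)
      rw [e, Multiset.card_cons, Multiset.range_succ, Multiset.map_cons, Multiset.map_cons, ← hL]
      generalize (L + T''.map fun i => (κ, i)).card = N at h17
      congr 1
      · simp [h17, h19, h20, e1, entry]
      · apply Multiset.map_congr rfl
        intro i hi
        have : i ≠ N := (Multiset.mem_range.1 hi).ne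
        simp [h17, this]
    · simp [hr]
      omega
  · rintro σ' τ B' ⟨T', T'', rfl, hT', hL', h20, rfl⟩ hb hτ
    have h0 : T' = 0 := by
      have : T'.card < 1 := by simpa [hT'.1] using hb
      exact Multiset.card_eq_zero.1 (by omega)
    subst h0
    simp at hτ
    refine ⟨by simp; omega, hT', by simpa using hL'⟩

/-- Move the list to the heap. -/
def loadProg : Prog :=
  .seq (.setReg 11 (const 0)) <|
  .seq (.loop (.lt (reg 11) (reg 17)) <|
    .seq (.setReg 6 (cell 8 (reg 11))) <|
    .seq (.setReg 7 (cell 9 (reg 11))) <|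
    .seq (.setReg 11 (add (reg 11) (const 1))) heapInsert) <|
  .setReg 17 (const 0)

theorem loadProg_spec {σ : Mem} {L : Multiset (ℤ × ℕ)} (hH : HeapAt σ 0) (hL : ListAt σ L) :
    Runs loadProg σ fun σ' τ => τ ≤ L.card * (60 * Nat.log 2 L.card + 80) + 20 ∧
      HeapAt σ' L ∧ ListAt σ' 0 := by
  obtain ⟨h17, hL⟩ := hL
  apply Runs.seq
  apply Runs.setReg
  apply Runs.seq
  refine Runs.loop (fun σ' B => ∃ s ≤ L.card, σ'.reg 11 = (s : ℕ) ∧ σ'.reg 17 = L.card ∧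
    σ'.arr 8 = σ.arr 8 ∧ σ'.arr 9 = σ.arr 9 ∧
    Heap σ' s ((Multiset.range s).map fun i => (σ.arr 8 i, σ.arr 9 i)) ∧
    B = (L.card - s) * (60 * Nat.log 2 L.card + 80)) (L.card * (60 * Nat.log 2 L.card + 80))
    ?_ ?_ ?_
  · exact ⟨0, by omega, by simp, by simpa using h17, rfl, rfl, Heap.congr hH (by simp) rfl rfl, rfl⟩
  · rintro σ' B ⟨s, hs, h11, h17, h8, h9, hH, rfl⟩ hb
    have hsL : s < L.card := by simpa [h11, h17] using hb
    repeat' with_reducible first | apply Runs.seq | apply Runs.setReg | apply Runs.setCell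
    refine Runs.mono (Runs.frame (heapInsert_spec (s := s)
      (M := (Multiset.range s).map fun i => (σ.arr 8 i, σ.arr 9 i))
      (hH.congr (by simp) rfl rfl))) ?_
    rintro σ₁ τ₁ ⟨hfr, hτ, hH'⟩
    refine ⟨_, ⟨s + 1, hsL, ?_, ?_, ?_, ?_, ?_, rfl⟩, ?_⟩
    · rw [hfr.1 11 rfl]; simp [h11]
    · rw [hfr.1 17 rfl]; simp [h17]
    · rw [hfr.2 8 rfl]; simp [h8]
    · rw [hfr.2 9 rfl]; simp [h9]
    · simpa [h11, h8, h9] using hH'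
    · have h3 : Nat.log 2 (s + 1) ≤ Nat.log 2 L.card := Nat.log_mono_right hsL
      have h4 : L.card - s = L.card - (s + 1) + 1 := by omega
      rw [h4, add_mul]
      simp
      omega
  · rintro σ' τ B' ⟨s, hs, h11, h17, h8, h9, hH, rfl⟩ hb hτ
    have : s = L.card := by
      have : L.card ≤ s := by simpa [h11, h17] using hb
      omega
    subst this
    apply Runs.setReg
    rw [hL] at hH
    refine ⟨?_, Heap.congr hH (by simp) rfl rfl, by simp, by simp⟩
    simp at hτ ⊢
    omega

/-! ### The descent along the keys -/

/-- Compute the layer, the number of frequencies to be combined, and the activity of the key in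
register `20`. -/
def keyData : Prog :=
  .seq (.setReg 12 (floor (divide (reg 20) (reg 10)))) <|
  .seq (.ite (.eq (reg 12) (reg 9))
    (.setReg 22 (add (reg 10) (sub (reg 20) (mul (reg 12) (reg 10))))) (.setReg 22 (const 2))) <|
  .ite (.and (.le (reg 9) (reg 12)) (.not (.eq (mul (reg 12) (reg 10)) (reg 20))))
    (.setReg 24 (const 1)) (.setReg 24 (const 0))

/-- The registers that `keyData` computes. -/
structure KeyData (σ : Mem) (C lo : ℕ) (κ : ℤ) : Prop where
  layer : σ.reg 12 = (κ / (C : ℤ) : ℤ)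
  arity : σ.reg 22 = arity C lo κ
  active : σ.reg 24 = 1 ↔ Active C lo κ

theorem keyData_spec {σ : Mem} {C lo : ℕ} {κ : ℤ} (hC : 0 < C) (h20 : σ.reg 20 = κ)
    (h10 : σ.reg 10 = C) (h9 : σ.reg 9 = lo) :
    Runs keyData σ fun σ' τ => τ ≤ 60 ∧ KeyData σ' C lo κ := by
  have hC' : (0 : ℤ) < C := by omega
  have hk : ⌊(κ : ℝ) / (C : ℝ)⌋ = κ / (C : ℤ) := by
    rw [Int.floor_div_natCast, Int.floor_intCast]
  have e := Int.ediv_mul_add_emod κ C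
  have h0 := Int.emod_nonneg κ hC'.ne'
  have e1 : ((κ / (C : ℤ) : ℤ) : ℝ) = lo ↔ κ / (C : ℤ) = lo := by norm_cast
  have e2 : ((κ / (C : ℤ) : ℤ) : ℝ) * C = κ ↔ κ % (C : ℤ) = 0 := by
    have : κ % (C : ℤ) = 0 ↔ κ / (C : ℤ) * C = κ := by omega
    rw [this]
    norm_cast
  have e3 : (lo : ℝ) ≤ ((κ / (C : ℤ) : ℤ) : ℝ) ↔ lo ≤ κ / (C : ℤ) := by norm_cast
  have e4 : (C : ℝ) + (κ - ((κ / (C : ℤ) : ℤ) : ℝ) * C) = ((C + (κ % (C : ℤ)).toNat : ℕ) : ℝ) := by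
    have : (C : ℤ) + (κ - κ / (C : ℤ) * C) = (C + (κ % (C : ℤ)).toNat : ℕ) := by
      push_cast
      omega
    exact_mod_cast this
  unfold keyData
  apply Runs.seq
  apply Runs.setReg
  apply Runs.seq
  apply Runs.ite
  · intro hlo
    simp [h20, h10, h9, hk, e1] at hlo
    apply Runs.setReg
    apply Runs.ite
    · intro ha
      simp [h20, h10, h9, hk, e2, e3] at ha
      apply Runs.setReg
      refine ⟨by simp, by simp [h20, h10, hk], ?_, ?_⟩
      · simp [h20, h10, hk, BambooGarden.arity, hlo] at e4 ⊢
        exact e4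
      · simpa [Active] using ha
    · intro ha
      simp [h20, h10, h9, hk, e2, e3] at ha
      apply Runs.setReg
      refine ⟨by simp, by simp [h20, h10, hk], ?_, ?_⟩
      · simp [h20, h10, hk, BambooGarden.arity, hlo] at e4 ⊢
        exact e4
      · simpa [Active] using ha
  · intro hlo
    simp [h20, h10, h9, hk, e1] at hlo
    apply Runs.setReg
    apply Runs.ite
    · intro ha
      simp [h20, h10, h9, hk, e2, e3] at ha
      apply Runs.setReg
      refine ⟨by simp, by simp [h20, h10, hk], ?_, ?_⟩
      · simp [BambooGarden.arity, hlo]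
      · simpa [Active] using ha
    · intro ha
      simp [h20, h10, h9, hk, e2, e3] at ha
      apply Runs.setReg
      refine ⟨by simp, by simp [h20, h10, hk], ?_, ?_⟩
      · simp [BambooGarden.arity, hlo]
      · simpa [Active] using ha

/-- Set register `20` to the next key where something happens. -/
def nextKey : Prog :=
  .seq (.setReg 20 (add (mul (sub (reg 9) (const 1)) (reg 10)) (reg 19))) <|
  .seq (.ite (.lt (reg 20) (mul (reg 12) (reg 10))) (.setReg 20 (mul (reg 12) (reg 10))) .skip) <|
  .ite (.and (.le (const 1) (reg 2)) (.lt (reg 20) (sub (const 0) (cell 4 (const 0)))))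
    (.setReg 20 (sub (const 0) (cell 4 (const 0)))) .skip

/-- The result is the maximum of three candidates: the bottom of the layer, where pushing ends; the
key of layer `lo` whose arity is `r`, where the waiting frequencies suffice for a combination; and
the largest key in the heap. -/
theorem nextKey_spec {σ : Mem} {C lo r : ℕ} {k : ℤ} {H : Multiset (ℤ × ℕ)} (hH : HeapAt σ H)
    (h19 : σ.reg 19 = r) (h12 : σ.reg 12 = k) (h10 : σ.reg 10 = C) (h9 : σ.reg 9 = lo) :
    Runs nextKey σ fun σ' τ => τ ≤ 60 ∧ ∃ κ : ℤ, σ'.reg 20 = κ ∧ k * C ≤ κ ∧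
      (lo - 1) * C + (r : ℤ) ≤ κ ∧ (∀ x ∈ H, x.1 ≤ κ) ∧
      (κ = k * C ∨ κ = (lo - 1) * C + (r : ℤ) ∨ ∃ x ∈ H, x.1 = κ) := by
  have h2 := hH.reg
  have e1 : ((lo : ℝ) - 1) * C + r = (((lo - 1) * C + r : ℤ) : ℝ) := by push_cast; ring
  have e2 : (k : ℝ) * C = ((k * C : ℤ) : ℝ) := by push_cast; ring
  have step : ∀ (σ₁ : Mem) (κ : ℤ), σ₁.reg 20 = κ → σ₁.reg 2 = σ.reg 2 → σ₁.arr = σ.arr →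
      k * C ≤ κ → (lo - 1) * C + (r : ℤ) ≤ κ → (κ = k * C ∨ κ = (lo - 1) * C + (r : ℤ)) →
      Runs (.ite (.and (.le (const 1) (reg 2)) (.lt (reg 20) (sub (const 0) (cell 4 (const 0)))))
        (.setReg 20 (sub (const 0) (cell 4 (const 0)))) .skip) σ₁ fun σ' τ => τ ≤ 20 ∧
      ∃ κ : ℤ, σ'.reg 20 = κ ∧ k * C ≤ κ ∧ (lo - 1) * C + (r : ℤ) ≤ κ ∧ (∀ x ∈ H, x.1 ≤ κ) ∧
      (κ = k * C ∨ κ = (lo - 1) * C + (r : ℤ) ∨ ∃ x ∈ H, x.1 = κ) := by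
    intro σ₁ κ h20 g2 ga hk₁ hk₂ hk₃
    apply Runs.ite
    · intro hb
      simp [h20, g2, ga, h2] at hb
      have hH0 : H ≠ 0 := by
        rintro rfl
        simp at hb
      obtain ⟨κ₁, e₁, hx, hmax⟩ := hH.top hH0
      have hlt : κ < κ₁ := by
        have := hb.2
        rw [e₁, neg_neg] at this
        exact_mod_cast this
      apply Runs.setReg
      refine ⟨by simp, κ₁, by simp [ga, e₁], by omega, by omega, hmax, Or.inr (Or.inr hx)⟩
    · intro hb
      simp [h20, g2, ga, h2] at hb
      apply Runs.skip
      refine ⟨by simp, κ, h20, hk₁, hk₂, ?_, by tauto⟩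
      by_cases hH0 : H = 0
      · simp [hH0]
      · obtain ⟨κ₁, e₁, hx, hmax⟩ := hH.top hH0
        have hle := hb (Multiset.card_pos.2 hH0)
        rw [e₁, neg_neg] at hle
        have hle' : κ₁ ≤ κ := by exact_mod_cast hle
        exact fun x hx => (hmax x hx).trans hle'
  unfold nextKey
  apply Runs.seq
  apply Runs.setReg
  apply Runs.seq
  apply Runs.ite
  · intro hb
    simp [h19, h12, h10, h9] at hb
    rw [e1, e2, Int.cast_lt] at hb
    apply Runs.setReg
    refine (step _ (k * C) ?_ ?_ ?_ ?_ ?_ ?_).mono ?_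
    · simp [h12, h10]
    · simp
    · rfl
    · exact le_rfl
    · exact hb.le
    · exact Or.inl rfl
    · rintro σ' τ ⟨hτ, h⟩
      refine ⟨?_, h⟩
      simp
      omega
  · intro hb
    simp [h19, h12, h10, h9] at hb
    rw [e1, e2, Int.cast_le] at hb
    apply Runs.skip
    refine (step _ ((lo - 1) * C + r) ?_ ?_ ?_ ?_ ?_ ?_).mono ?_
    · simp [h19, h10, h9]
    · simp
    · rfl
    · exact hb
    · exact le_rfl
    · exact Or.inr rfl
    · rintro σ' τ ⟨hτ, h⟩
      refine ⟨?_, h⟩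
      simp
      omega

/-- The memory during the descent. -/
structure DescentAt (push : Bool) (c lo : ℕ) (b : ℤ) (S₀ : Freqs n) (σ : Mem) (tr : ℕ → FTree n)
    (cnt : ℕ) (κ : ℤ) (H : Multiset (ℤ × ℕ)) (T : Multiset ℕ) (L : Multiset (ℤ × ℕ)) : Prop where
  heap : HeapAt σ H
  temp : TempAt σ T
  list : ListAt σ L
  forest : Forest σ tr cnt (T + (H + L).map Prod.snd)
  reg9 : σ.reg 9 = lo
  reg10 : σ.reg 10 = (2 ^ c : ℕ)
  reg25 : σ.reg 25 = c
  push_iff : σ.reg 21 = 1 ↔ push = true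
  reg20 : T ≠ 0 → σ.reg 20 = κ
  descent : Descent push (2 ^ c) lo b S₀ tr κ H T L

/-- Choose the key at which the descent continues. -/
def chooseKey : Prog :=
  .seq (.ite (.le (const 1) (reg 19)) .skip (.setReg 20 (sub (const 0) (cell 4 (const 0))))) <|
  .seq keyData <|
  .ite (.and (.and (.eq (reg 21) (const 1)) (.eq (reg 24) (const 1)))
      (.and (.lt (reg 19) (reg 22))
        (.not (.and (.le (const 1) (reg 2)) (.eq (cell 4 (const 0)) (sub (const 0) (reg 20)))))))
    (.seq nextKey keyData) .skip

theorem top_iff {σ : Mem} {H : Multiset (ℤ × ℕ)} (hH : HeapAt σ H) {κ : ℤ} (hκ : ∀ x ∈ H, x.1 ≤ κ) :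
    ((1 : ℝ) ≤ σ.reg 2 ∧ σ.arr 4 0 = -(κ : ℝ)) ↔ ∃ x ∈ H, x.1 = κ := by
  rw [hH.reg]
  constructor
  · rintro ⟨h₁, h₂⟩
    have hH0 : H ≠ 0 := by
      rintro rfl
      norm_num at h₁
    obtain ⟨κ₁, e₁, hx, hmax⟩ := hH.top hH0
    rw [e₁, neg_inj, Int.cast_inj] at h₂
    exact h₂ ▸ hx
  · rintro ⟨x, hx, rfl⟩
    have hH0 : H ≠ 0 := by
      rintro rfl
      simp at hx
    obtain ⟨κ₁, e₁, ⟨y, hy, hy'⟩, hmax⟩ := hH.top hH0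
    refine ⟨by exact_mod_cast Multiset.card_pos.2 hH0, ?_⟩
    rw [e₁, le_antisymm (hmax x hx) (hy' ▸ hκ y hy)]

theorem DescentAt.congr {push : Bool} {c lo : ℕ} {b : ℤ} {S₀ : Freqs n} {σ σ' : Mem}
    {tr : ℕ → FTree n} {cnt : ℕ} {κ κ' : ℤ} {H : Multiset (ℤ × ℕ)} {T : Multiset ℕ}
    {L : Multiset (ℤ × ℕ)} (h : DescentAt push c lo b S₀ σ tr cnt κ H T L)
    (hreg : ∀ r, r ≠ 12 → r ≠ 20 → r ≠ 22 → r ≠ 24 → σ'.reg r = σ.reg r) (harr : σ'.arr = σ.arr)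
    (h20 : T ≠ 0 → σ'.reg 20 = κ') (hD : Descent push (2 ^ c) lo b S₀ tr κ' H T L) :
    DescentAt push c lo b S₀ σ' tr cnt κ' H T L where
  heap := h.heap.congr (hreg 2 (by simp) (by simp) (by simp) (by simp)) (by rw [harr]) (by rw [harr])
  temp := h.temp.congr (hreg 19 (by simp) (by simp) (by simp) (by simp)) (by rw [harr])
  list := h.list.congr (hreg 17 (by simp) (by simp) (by simp) (by simp)) (by rw [harr])
    (by rw [harr])
  forest := h.forest.congr (hreg 16 (by simp) (by simp) (by simp) (by simp)) (by rw [harr])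
    (by rw [harr]) (by rw [harr])
  reg9 := by rw [hreg 9 (by simp) (by simp) (by simp) (by simp), h.reg9]
  reg10 := by rw [hreg 10 (by simp) (by simp) (by simp) (by simp), h.reg10]
  reg25 := by rw [hreg 25 (by simp) (by simp) (by simp) (by simp), h.reg25]
  push_iff := by rw [hreg 21 (by simp) (by simp) (by simp) (by simp), h.push_iff]
  reg20 := h20
  descent := hD

theorem Frame.arr {P : Prog} {σ σ' : Mem} (h : Frame P σ σ') (hP : ∀ a, P.writesArr a = false) :
    σ'.arr = σ.arr := funext fun a => h.2 a (hP a)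

/-- The last two clauses guarantee that something can be done at the chosen key. In particular,
leftovers at an active key are not flushed while pushing down. -/
theorem chooseKey_spec {push : Bool} {c lo : ℕ} {b : ℤ} {S₀ : Freqs n} {σ : Mem}
    {tr : ℕ → FTree n} {cnt : ℕ} {κ : ℤ} {H : Multiset (ℤ × ℕ)} {T : Multiset ℕ}
    {L : Multiset (ℤ × ℕ)} (h : DescentAt push c lo b S₀ σ tr cnt κ H T L)
    (hHT : H ≠ 0 ∨ T ≠ 0) :
    Runs chooseKey σ fun σ' τ => τ ≤ 260 ∧ ∃ κ' : ℤ, DescentAt push c lo b S₀ σ' tr cnt κ' H T L ∧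
      σ'.reg 20 = κ' ∧ KeyData σ' (2 ^ c) lo κ' ∧ (T = 0 → ∃ x ∈ H, x.1 = κ') ∧
      (push = true → Active (2 ^ c) lo κ' → T.card < arity (2 ^ c) lo κ' → ∃ x ∈ H, x.1 = κ') := by
  have hC : 0 < 2 ^ c := by positivity
  have first : Runs (.ite (.le (const 1) (reg 19)) .skip
      (.setReg 20 (sub (const 0) (cell 4 (const 0))))) σ fun σ' τ => τ ≤ 20 ∧ ∃ κ' : ℤ,
      DescentAt push c lo b S₀ σ' tr cnt κ' H T L ∧ σ'.reg 20 = κ' ∧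
      (T = 0 → ∃ x ∈ H, x.1 = κ') := by
    apply Runs.ite
    · intro hb
      have hT0 : T ≠ 0 := by
        rintro rfl
        simp [h.temp.1] at hb
        norm_num at hb
      exact Runs.skip ⟨by simp, κ, h, h.reg20 hT0, fun h => absurd h hT0⟩
    · intro hb
      have hT0 : T = 0 := by
        simp [h.temp.1] at hb
        simpa using hb
      subst hT0
      have hH0 : H ≠ 0 := by simpa using hHT
      obtain ⟨κ₁, e₁, hx, hmax⟩ := h.heap.top hH0
      apply Runs.setReg
      refine ⟨by simp, κ₁, ?_, by simp [e₁], fun _ => hx⟩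
      refine h.congr (fun r _ h _ _ => by simp [h]) rfl (by simp) ?_
      obtain ⟨x, hx, rfl⟩ := hx
      exact h.descent.move_empty hC (h.descent.heap_le x hx) hmax
  refine Runs.seq_spec first ?_
  rintro σ₁ τ₁ - ⟨hτ₁, κ₁, h₁, h20, hT₁⟩
  refine Runs.seq_spec (keyData_spec hC h20 h₁.reg10 h₁.reg9) ?_
  rintro σ₂ τ₂ hfr₂ ⟨hτ₂, hkd⟩
  have g20 : σ₂.reg 20 = κ₁ := by rw [hfr₂.1 20 rfl, h20]
  have h₂ : DescentAt push c lo b S₀ σ₂ tr cnt κ₁ H T L := by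
    refine h₁.congr (fun r h12 _ h22 h24 => hfr₂.1 r ?_) (hfr₂.arr fun a => rfl) (fun _ => g20)
      h₁.descent
    simp [keyData, Prog.writesReg, h12, h22, h24]
  have htop := top_iff h₂.heap h₂.descent.heap_le
  apply Runs.ite
  · intro hb
    simp [hkd.arity, h₂.temp.1, hkd.active, h₂.push_iff, g20] at hb
    obtain ⟨⟨hpush, hact⟩, hlt, hnt⟩ := hb
    subst hpush
    have hnt' : ¬ ∃ x ∈ H, x.1 = κ₁ := fun h => by
      have := htop.2 h
      exact hnt this.1 this.2
    have hT0 : T ≠ 0 := fun h => hnt' (hT₁ h)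
    refine Runs.seq_spec (nextKey_spec h₂.heap h₂.temp.1 hkd.layer h₂.reg10 h₂.reg9) ?_
    rintro σ₃ τ₃ hfr₃ ⟨hτ₃, κ₂, g20, hk₁, hk₂, hk₃, hk₄⟩
    -- No candidate lies above the present key. For the second one, this is the assumption that
    -- `T.card` is below the arity.
    have hle : κ₂ ≤ κ₁ := by
      have e := Int.ediv_mul_add_emod κ₁ (2 ^ c : ℕ)
      have h0 := Int.emod_nonneg κ₁ (show ((2 ^ c : ℕ) : ℤ) ≠ 0 by positivity)
      rcases hk₄ with rfl | rfl | ⟨x, hx, rfl⟩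
      · omega
      · have hl := hact.1
        unfold arity at hlt
        split_ifs at hlt with hk
        · rw [hk] at e
          rw [sub_mul, one_mul]
          omega
        · have : ((lo : ℤ) + 1) * (2 ^ c : ℕ) ≤ κ₁ / (2 ^ c : ℕ) * (2 ^ c : ℕ) :=
            mul_le_mul_of_nonneg_right (by omega) (by positivity)
          rw [add_mul, one_mul] at this
          rw [sub_mul, one_mul]
          have h1 : 0 < 2 ^ c := hC
          omega
      · exact h₂.descent.heap_le x hx
    have hD₃ := h₂.descent.move_push hC hle hk₃ hact hlt hk₁ hk₂
    have h₃ : DescentAt true c lo b S₀ σ₃ tr cnt κ₂ H T L := by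
      refine h₂.congr (fun r _ h20 _ _ => hfr₃.1 r ?_) (hfr₃.arr fun a => rfl) (fun _ => g20) hD₃
      simp [nextKey, Prog.writesReg, h20]
    refine Runs.mono (Runs.frame (keyData_spec hC g20 h₃.reg10 h₃.reg9)) ?_
    rintro σ₄ τ₄ ⟨hfr₄, hτ₄, hkd₄⟩
    have g20' : σ₄.reg 20 = κ₂ := by rw [hfr₄.1 20 rfl, g20]
    have h₄ : DescentAt true c lo b S₀ σ₄ tr cnt κ₂ H T L := by
      refine h₃.congr (fun r h12 _ h22 h24 => hfr₄.1 r ?_) (hfr₄.arr fun a => rfl) (fun _ => g20')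
        h₃.descent
      simp [keyData, Prog.writesReg, h12, h22, h24]
    refine ⟨by simp; omega, κ₂, h₄, g20', hkd₄, fun h => absurd h hT0, fun _ hact₂ hlt₂ => ?_⟩
    rcases hk₄ with rfl | rfl | hx
    · exact absurd (Int.mul_emod_left _ _) hact₂.2
    -- At this key of layer `lo` the arity is exactly `T.card`. In a higher layer the arity is `2`,
    -- and then `T.card < 2` would make the key too small for that layer.
    · exfalso
      have hl := hact₂.1
      unfold arity at hlt₂
      have e := Int.ediv_mul_add_emod ((lo - 1) * (2 ^ c : ℕ) + (T.card : ℤ)) (2 ^ c : ℕ)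
      have h0 := Int.emod_nonneg ((lo - 1) * (2 ^ c : ℕ) + (T.card : ℤ))
        (show ((2 ^ c : ℕ) : ℤ) ≠ 0 by positivity)
      split_ifs at hlt₂ with hk
      · rw [hk, sub_mul, one_mul] at e
        rw [sub_mul, one_mul] at h0
        rw [sub_mul, one_mul] at hlt₂
        omega
      · have : ((lo : ℤ) + 1) * (2 ^ c : ℕ) ≤
          ((lo - 1) * (2 ^ c : ℕ) + (T.card : ℤ)) / (2 ^ c : ℕ) * (2 ^ c : ℕ) :=
            mul_le_mul_of_nonneg_right (by omega) (by positivity)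
        have h1 : 0 < 2 ^ c := hC
        have e3 : ((lo : ℤ) + 1) * (2 ^ c : ℕ) = (lo - 1) * (2 ^ c : ℕ) + 2 * (2 ^ c : ℕ) := by ring
        omega
    · exact hx
  · intro hb
    simp [hkd.arity, h₂.temp.1, hkd.active, h₂.push_iff, g20] at hb
    refine Runs.skip ⟨by simp; omega, κ₁, h₂, g20, hkd, hT₁, fun hp ha hlt => ?_⟩
    exact htop.1 (hb hp ha hlt)

/-- Combine the frequencies taken out, or take out another one, or move them to the list. -/
def descendAction : Prog :=
  .ite (.and (.eq (reg 24) (const 1)) (.eq (reg 19) (reg 22)))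
    (.seq (.ite (.eq (reg 12) (reg 9))
        (.setReg 6 (sub (const 0) (mul (sub (reg 9) (reg 25)) (reg 10))))
        (.setReg 6 (sub (reg 10) (reg 20)))) combineProg)
    (.ite (.and (.le (const 1) (reg 2)) (.eq (cell 4 (const 0)) (sub (const 0) (reg 20))))
      (.seq heapPop (.seq (.setCell 10 (reg 19) (reg 7)) (.setReg 19 (add (reg 19) (const 1)))))
      flushProg)

/-- A bound on the cost of a heap operation, up to a constant. -/
def unitCost (n : ℕ) : ℕ := 150 * Nat.log 2 n + 700

theorem Forest.card_le {σ : Mem} {tr : ℕ → FTree n} {cnt : ℕ} {A : Multiset ℕ}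
    (h : Forest σ tr cnt A) : A.card ≤ n := by
  have := h.card
  have := h.le
  omega

/-- In units of `unitCost n`, a frequency in the heap has potential 9 and one taken out has 6. A pop
releases 3, a combination of `r ≥ 2` releases `6 * r - 9 ≥ 3`, and a flush releases 6 per frequency.
The summand 300 prepays the choice of the key and the loop test. -/
theorem descendAction_spec {push : Bool} {c lo : ℕ} {b : ℤ} {S₀ : Freqs n} {σ : Mem}
    {tr : ℕ → FTree n} {cnt : ℕ} {κ : ℤ} {H : Multiset (ℤ × ℕ)} {T : Multiset ℕ}
    {L : Multiset (ℤ × ℕ)} (h : DescentAt push c lo b S₀ σ tr cnt κ H T L)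
    (h20 : σ.reg 20 = κ) (hkd : KeyData σ (2 ^ c) lo κ) (hT0 : T = 0 → ∃ x ∈ H, x.1 = κ)
    (hev : push = true → Active (2 ^ c) lo κ → T.card < arity (2 ^ c) lo κ → ∃ x ∈ H, x.1 = κ) :
    Runs descendAction σ fun σ' τ => ∃ tr' cnt' κ' H' T' L',
      DescentAt push c lo b S₀ σ' tr' cnt' κ' H' T' L' ∧
      τ + 300 + unitCost n * (9 * H'.card + 6 * T'.card) ≤
        unitCost n * (9 * H.card + 6 * T.card) := by
  have hC : 0 < 2 ^ c := by positivity
  have hcard := h.forest.card_le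
  simp only [Multiset.card_add, Multiset.card_map] at hcard
  apply Runs.ite
  · intro hb
    simp [hkd.active, hkd.arity, h.temp.1] at hb
    obtain ⟨hact, hr⟩ := hb
    have h2 := two_le_arity hC hact
    have key : Runs (.ite (.eq (reg 12) (reg 9))
        (.setReg 6 (sub (const 0) (mul (sub (reg 9) (reg 25)) (reg 10))))
        (.setReg 6 (sub (reg 10) (reg 20)))) σ fun σ' τ => τ ≤ 30 ∧
          σ'.reg 6 = -((combinedKey c lo κ : ℤ) : ℝ) := by
      have e1 : ((κ / ((2 ^ c : ℕ) : ℤ) : ℤ) : ℝ) = lo ↔ κ / ((2 ^ c : ℕ) : ℤ) = lo := by norm_cast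
      apply Runs.ite
      · intro hb
        simp only [RTest.holds_eq, RExpr.eval, hkd.layer, h.reg9, e1] at hb
        apply Runs.setReg
        refine ⟨by simp, ?_⟩
        simp [combinedKey, h.reg9, h.reg10, h.reg25] at hb ⊢
        simp [hb]
      · intro hb
        simp only [RTest.holds_eq, RExpr.eval, hkd.layer, h.reg9, e1] at hb
        apply Runs.setReg
        refine ⟨by simp, ?_⟩
        simp [combinedKey, h.reg10, h20] at hb ⊢
        simp [hb]
    refine Runs.seq_spec key ?_
    rintro σ₁ τ₁ hfr ⟨hτ₁, h6⟩
    have ga : σ₁.arr = σ.arr := hfr.arr fun a => rfl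
    have hF : Forest σ₁ tr cnt (T + (H + L).map Prod.snd) :=
      h.forest.congr (hfr.1 16 rfl) (by rw [ga]) (by rw [ga]) (by rw [ga])
    have hT : TempAt σ₁ T := h.temp.congr (hfr.1 19 rfl) (by rw [ga])
    refine Runs.mono (Runs.frame (combineProg_spec
      (h.heap.congr (hfr.1 2 rfl) (by rw [ga]) (by rw [ga])) hT hF h6 (by omega))) ?_
    rintro σ₂ τ₂ ⟨hfr₂, hτ₂, tr', t, hH', hT', hF', htr, hTt, -, hnode⟩
    refine ⟨tr', cnt + 1, κ, (combinedKey c lo κ, cnt) ::ₘ H, 0, L, ⟨hH', hT', ?_, ?_, ?_, ?_, ?_,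
      ?_, by simp, ?_⟩, ?_⟩
    · exact h.list.congr ((hfr₂.1 17 rfl).trans (hfr.1 17 rfl))
        ((hfr₂.2 8 rfl).trans (by rw [ga])) ((hfr₂.2 9 rfl).trans (by rw [ga]))
    · simpa using hF'
    · rw [hfr₂.1 9 rfl, hfr.1 9 rfl, h.reg9]
    · rw [hfr₂.1 10 rfl, hfr.1 10 rfl, h.reg10]
    · rw [hfr₂.1 25 rfl, hfr.1 25 rfl, h.reg25]
    · rw [hfr₂.1 21 rfl, hfr.1 21 rfl, h.push_iff]
    · have hd := h.descent
      rw [hTt] at hd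
      refine hd.combine hact hr (fun x hx => htr _ (h.forest.lt _ ?_)) hnode
      exact Multiset.mem_add.2 (Or.inr (Multiset.mem_map_of_mem _ hx))
    · have hlog : Nat.log 2 (H.card + 1) ≤ Nat.log 2 n := Nat.log_mono_right (by omega)
      obtain ⟨r, hr'⟩ : ∃ r, T.card = r + 2 := ⟨T.card - 2, by omega⟩
      simp only [hr', Multiset.card_cons, Multiset.card_zero]
      rw [hr'] at hτ₂
      have e : unitCost n * (9 * H.card + 6 * (r + 2)) =
        unitCost n * (9 * (H.card + 1) + 6 * 0) + (3 * unitCost n + unitCost n * r * 6) := by ring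
      have e' : 700 * r ≤ unitCost n * r := Nat.mul_le_mul_right _ (by unfold unitCost; omega)
      rw [e]
      have : unitCost n = 150 * Nat.log 2 n + 700 := rfl
      simp
      omega
  · intro hb
    simp [hkd.active, hkd.arity, h.temp.1] at hb
    have hlt : Active (2 ^ c) lo κ → T.card < arity (2 ^ c) lo κ := fun ha =>
      lt_of_le_of_ne (h.descent.temp_le ha) (hb ha)
    have htop := top_iff h.heap h.descent.heap_le
    apply Runs.ite
    · intro hb
      have hx : ∃ x ∈ H, x.1 = κ := htop.1 (by simpa [h20] using hb)
      have hH0 : H ≠ 0 := by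
        rintro rfl
        simp at hx
      refine Runs.seq_spec (heapPop_at h.heap hH0) ?_
      rintro σ₁ τ₁ hfr ⟨hτ₁, κ₁, i, H', rfl, hmax, e₁, -, h7, hH'⟩
      have hκ : κ₁ = κ := by
        have := (htop.2 hx).2
        rw [e₁] at this
        exact_mod_cast neg_injective this
      subst hκ
      apply Runs.seq
      apply Runs.setCell
      apply Runs.setReg
      obtain ⟨h19, t, hTt, ht⟩ := h.temp
      have g19 : σ₁.reg 19 = T.card := by rw [hfr.1 19 rfl, h19]
      have g10 : σ₁.arr 10 = σ.arr 10 := hfr.2 10 rfl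
      refine ⟨tr, cnt, κ₁, H', i ::ₘ T, L, ⟨?_, ⟨?_, ?_⟩, ?_, ?_, ?_, ?_, ?_, ?_, ?_,
        h.descent.pop hlt⟩, ?_⟩
      · exact hH'.congr (by simp) (by funext j; simp) (by funext j; simp)
      · simp [g19]
      · refine ⟨Function.update t T.card i, ?_, ?_⟩
        · rw [Multiset.card_cons, Multiset.range_succ, Multiset.map_cons, Function.update_self]
          congr 1
          conv_lhs => rw [hTt]
          apply Multiset.map_congr rfl
          intro l hl
          rw [Function.update_of_ne (Multiset.mem_range.1 hl).ne]
        · intro l hl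
          rw [Multiset.card_cons] at hl
          by_cases hl' : l = T.card
          · subst hl'
            simp [g19, h7]
          · have := ht l (by omega)
            simp [g19, hl', g10, this]
      · exact h.list.congr (by simp [hfr.1 17 rfl]) (by funext j; simp [hfr.2 8 rfl])
          (by funext j; simp [hfr.2 9 rfl])
      · have := h.forest.congr (σ' := (σ₁.setCell 10 ⌊(reg 19).eval σ₁⌋₊ ((reg 7).eval σ₁)).setReg 19
          (((reg 19).add (const 1)).eval (σ₁.setCell 10 ⌊(reg 19).eval σ₁⌋₊ ((reg 7).eval σ₁))))
          (by simp [hfr.1 16 rfl]) (by funext j; simp [hfr.2 5 rfl])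
          (by funext j; simp [hfr.2 6 rfl]) (by funext j; simp [hfr.2 7 rfl])
        have e : i ::ₘ T + (H' + L).map Prod.snd = T + ((κ₁, i) ::ₘ H' + L).map Prod.snd := by
          simp
        rwa [e]
      · simp [hfr.1 9 rfl, h.reg9]
      · simp [hfr.1 10 rfl, h.reg10]
      · simp [hfr.1 25 rfl, h.reg25]
      · simp [hfr.1 21 rfl, h.push_iff]
      · intro _
        simp [hfr.1 20 rfl, h20]
      · have hlog : Nat.log 2 ((κ₁, i) ::ₘ H').card ≤ Nat.log 2 n := Nat.log_mono_right (by omega)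
        simp only [Multiset.card_cons] at hlog hτ₁ ⊢
        have e : unitCost n * (9 * (H'.card + 1) + 6 * T.card) =
          unitCost n * (9 * H'.card + 6 * (T.card + 1)) + 3 * unitCost n := by ring
        rw [e]
        have : unitCost n = 150 * Nat.log 2 n + 700 := rfl
        simp
        omega
    · intro hb
      have hx : ¬ ∃ x ∈ H, x.1 = κ := fun hx => hb (by simpa [h20] using htop.2 hx)
      have hT1 : 1 ≤ T.card := Multiset.card_pos.2 fun h => hx (hT0 h)
      refine Runs.mono (Runs.frame (flushProg_spec h.temp h.list h20)) ?_
      rintro σ₁ τ₁ ⟨hfr, hτ₁, hT', hL'⟩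
      refine ⟨tr, cnt, κ - 1, H, 0, L + T.map fun i => (κ, i), ⟨?_, hT', hL', ?_, ?_, ?_, ?_, ?_,
        by simp, ?_⟩, ?_⟩
      · exact h.heap.congr (hfr.1 2 rfl) (hfr.2 3 rfl) (hfr.2 4 rfl)
      · have e : 0 + (H + (L + T.map fun i => (κ, i))).map Prod.snd =
            T + (H + L).map Prod.snd := by
          simp only [Multiset.map_add, Multiset.map_map, Function.comp_def, Multiset.map_id']
          rw [zero_add, ← add_assoc, add_comm]
        rw [e]
        exact h.forest.congr (hfr.1 16 rfl) (hfr.2 5 rfl) (hfr.2 6 rfl) (hfr.2 7 rfl)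
      · rw [hfr.1 9 rfl, h.reg9]
      · rw [hfr.1 10 rfl, h.reg10]
      · rw [hfr.1 25 rfl, h.reg25]
      · rw [hfr.1 21 rfl, h.push_iff]
      · refine h.descent.flush hC (fun x hx' => lt_of_le_of_ne (h.descent.heap_le x hx')
          fun he => hx ⟨x, hx', he⟩) hlt ?_
        -- Pushing at an active key with too few frequencies would require a heap entry at this key
        -- by `hev`, but the pop branch was refused.
        by_contra hcon
        push Not at hcon
        exact hx (hev (by simpa using hcon.2) hcon.1 (hlt hcon.1))
      · rw [Multiset.card_zero]
        have e : unitCost n * (9 * H.card + 6 * T.card) =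
          unitCost n * (9 * H.card + 6 * 0) + unitCost n * T.card * 6 := by ring
        have e' : 700 * T.card ≤ unitCost n * T.card :=
          Nat.mul_le_mul_right _ (by unfold unitCost; omega)
        rw [e]
        simp
        omega

/-- The descent along all keys. -/
def descendProg : Prog :=
  .loop (.le (const 1) (add (reg 2) (reg 19))) (.seq chooseKey descendAction)

/-- The potential alone is the loop budget, so the number of keys passed over does not enter the
bound. -/
theorem descendProg_spec {push : Bool} {c lo : ℕ} {b : ℤ} {S₀ : Freqs n} {σ : Mem}
    {tr : ℕ → FTree n} {cnt : ℕ} {κ : ℤ} {H : Multiset (ℤ × ℕ)} {T : Multiset ℕ}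
    {L : Multiset (ℤ × ℕ)} (h : DescentAt push c lo b S₀ σ tr cnt κ H T L) :
    Runs descendProg σ fun σ' τ => τ ≤ unitCost n * (9 * H.card + 6 * T.card) + 10 ∧
      ∃ tr' cnt' κ' L', DescentAt push c lo b S₀ σ' tr' cnt' κ' 0 0 L' := by
  refine Runs.loop (fun σ B => ∃ tr cnt κ H T L, DescentAt push c lo b S₀ σ tr cnt κ H T L ∧
    B = unitCost n * (9 * H.card + 6 * T.card)) _ ⟨tr, cnt, κ, H, T, L, h, rfl⟩ ?_ ?_
  · rintro σ B ⟨tr, cnt, κ, H, T, L, h, rfl⟩ hb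
    have hHT : H ≠ 0 ∨ T ≠ 0 := by
      by_contra hcon
      push Not at hcon
      obtain ⟨rfl, rfl⟩ := hcon
      simp [h.heap.reg, h.temp.1] at hb
      norm_num at hb
    refine Runs.seq_spec (chooseKey_spec h hHT) ?_
    rintro σ₁ τ₁ - ⟨hτ₁, κ₁, h₁, h20, hkd, hT0, hev⟩
    refine (descendAction_spec h₁ h20 hkd hT0 hev).mono ?_
    rintro σ₂ τ₂ ⟨tr', cnt', κ', H', T', L', h₂, hτ₂⟩
    refine ⟨_, ⟨tr', cnt', κ', H', T', L', h₂, rfl⟩, ?_⟩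
    simp
    omega
  · rintro σ' τ B' ⟨tr, cnt, κ, H, T, L, h, rfl⟩ hb hτ
    simp [h.heap.reg, h.temp.1] at hb hτ
    have hb' : H.card + T.card < 1 := by exact_mod_cast hb
    obtain rfl : H = 0 := Multiset.card_eq_zero.1 (by omega)
    obtain rfl : T = 0 := Multiset.card_eq_zero.1 (by omega)
    exact ⟨by omega, tr, cnt, κ, L, h⟩

/-- The memory between two descents. -/
structure ListState (c lo : ℕ) (σ : Mem) (tr : ℕ → FTree n) (cnt : ℕ) (L : Multiset (ℤ × ℕ)) :
    Prop where
  heap : HeapAt σ 0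
  temp : TempAt σ 0
  list : ListAt σ L
  forest : Forest σ tr cnt (L.map Prod.snd)
  reg9 : σ.reg 9 = lo
  reg10 : σ.reg 10 = (2 ^ c : ℕ)
  reg25 : σ.reg 25 = c

/-- Load the list into the heap and descend along the keys. -/
def descentPhase (flag : ℤ) : Prog :=
  .seq (.setReg 21 (const flag)) (.seq loadProg descendProg)

theorem descentPhase_spec {push : Bool} {flag : ℤ} (hflag : flag = 1 ↔ push = true) {c lo : ℕ}
    {b : ℤ} {σ : Mem} {tr : ℕ → FTree n} {cnt : ℕ} {L : Multiset (ℤ × ℕ)}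
    (h : ListState c lo σ tr cnt L) (hb : ∀ x ∈ L, x.1 ≤ b)
    (hlo : (lo : ℤ) * (2 ^ c : ℕ) - 1 ≤ b) :
    Runs (descentPhase flag) σ fun σ' τ => τ ≤ 11 * unitCost n * n + 50 ∧ ∃ tr' cnt' L',
      ListState c lo σ' tr' cnt' L' ∧ (∀ x ∈ L', x.1 ≤ b) ∧
      Desc (KeyStep push (2 ^ c) lo) b (freqs (2 ^ c) tr L) ((lo : ℤ) * (2 ^ c : ℕ) - 1)
        (freqs (2 ^ c) tr' L') := by
  have hcard := h.forest.card_le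
  rw [Multiset.card_map] at hcard
  apply Runs.seq
  apply Runs.setReg
  refine Runs.seq_spec (loadProg_spec (h.heap.congr (by simp) rfl rfl)
    (h.list.congr (by simp) rfl rfl)) ?_
  rintro σ₁ τ₁ hfr ⟨hτ₁, hH, hL⟩
  have hD : DescentAt push c lo b (freqs (2 ^ c) tr L) σ₁ tr cnt b L 0 0 := by
    refine ⟨hH, ?_, hL, ?_, ?_, ?_, ?_, ?_, by simp, Descent.start hb⟩
    · exact h.temp.congr (by rw [hfr.1 19 rfl]; simp) (hfr.2 10 rfl)
    · simpa using h.forest.congr (σ' := σ₁) (by rw [hfr.1 16 rfl]; simp) (hfr.2 5 rfl)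
        (hfr.2 6 rfl) (hfr.2 7 rfl)
    · rw [hfr.1 9 rfl]; simp [h.reg9]
    · rw [hfr.1 10 rfl]; simp [h.reg10]
    · rw [hfr.1 25 rfl]; simp [h.reg25]
    · rw [hfr.1 21 rfl]
      simp only [Mem.reg_setReg, if_true, RExpr.eval]
      rw [← hflag]
      norm_cast
  refine (descendProg_spec hD).mono ?_
  rintro σ₂ τ₂ ⟨hτ₂, tr', cnt', κ', L', h'⟩
  refine ⟨?_, tr', cnt', L', ⟨h'.heap, h'.temp, h'.list, ?_, h'.reg9, h'.reg10, h'.reg25⟩,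
    h'.descent.list_le, h'.descent.finish (by positivity) hlo⟩
  · have h1 : Nat.log 2 L.card ≤ Nat.log 2 n := Nat.log_mono_right hcard
    have h2 : L.card * (60 * Nat.log 2 L.card + 80) ≤ n * unitCost n :=
      Nat.mul_le_mul hcard (by unfold unitCost; omega)
    have h3 : unitCost n * (9 * L.card + 6 * (0 : Multiset ℕ).card) ≤ unitCost n * (9 * n) :=
      Nat.mul_le_mul_left _ (by simp; omega)
    -- One share pays for loading the heap and nine are the initial potential; the last one is
    -- slack.
    have e : 11 * unitCost n * n = n * unitCost n + unitCost n * (9 * n) + unitCost n * n := by ring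
    rw [e]
    simp
    omega
  · simpa using h'.forest

/-! ### Merging and expanding -/

/-- Merge the two largest frequencies until a single one is left. -/
def mergeProg : Prog :=
  .loop (.le (const 2) (reg 2)) <|
  .seq heapPop <|
  .seq (.setCell 10 (const 1) (reg 7)) <|
  .seq heapPop <|
  .seq (.setCell 10 (const 0) (reg 7)) <|
  .seq (.setReg 6 (add (reg 6) (reg 10))) <|
  .seq (.setReg 19 (const 2)) combineProg

/-- Parents have larger names than their children, so the newest tree is a root. When only one root
is left, this gives its name. -/
theorem Forest.ne_zero {σ : Mem} {tr : ℕ → FTree n} {cnt : ℕ} {A : Multiset ℕ}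
    (h : Forest σ tr cnt A) (hn : 0 < n) : cnt - 1 ∈ A := by
  have h1 := h.le
  rcases h.parent (cnt - 1) (by omega) with h | ⟨t, m, child, l, h₁, h₂, -⟩
  · exact h
  · omega

/-- The first pop yields the larger frequency `b`, which goes to slot `1`; the second yields `a`,
the first child in slot `0`. The register then holds the negated key of `a`, and adding `C` gives
that of `a / 2`. -/
theorem mergeBody_spec {C : ℕ} (hC : 0 < C) {σ : Mem} {tr : ℕ → FTree n} {cnt : ℕ}
    {H : Multiset (ℤ × ℕ)} (hH : HeapAt σ H) (hF : Forest σ tr cnt (H.map Prod.snd))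
    (h10 : σ.reg 10 = C) (h2 : 2 ≤ H.card) :
    Runs (.seq heapPop <|
      .seq (.setCell 10 (const 1) (reg 7)) <|
      .seq heapPop <|
      .seq (.setCell 10 (const 0) (reg 7)) <|
      .seq (.setReg 6 (add (reg 6) (reg 10))) <|
      .seq (.setReg 19 (const 2)) combineProg) σ fun σ' τ => τ ≤ 3 * unitCost n - 10 ∧
      ∃ tr' cnt' H', HeapAt σ' H' ∧ Forest σ' tr' cnt' (H'.map Prod.snd) ∧ σ'.reg 10 = C ∧
        H.card = H'.card + 1 ∧ MergeLargest (freqs C tr H) (freqs C tr' H') := by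
  have hcard := hF.card_le
  rw [Multiset.card_map] at hcard
  have hH0 : H ≠ 0 := by
    rintro rfl
    simp at h2
  refine Runs.seq_spec (heapPop_at hH hH0) ?_
  rintro σ₁ τ₁ hfr ⟨hτ₁, κb, ib, H₁, rfl, hmax₁, -, -, h7, hH₁⟩
  rw [Multiset.card_cons] at h2 hcard hτ₁
  have hH₁0 : H₁ ≠ 0 := by
    rintro rfl
    simp at h2
  apply Runs.seq
  apply Runs.setCell
  refine Runs.seq_spec (heapPop_at (hH₁.congr (σ' := σ₁.setCell 10 ⌊(const 1).eval σ₁⌋₊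
    ((reg 7).eval σ₁)) rfl (by funext i; simp) (by funext i; simp)) hH₁0) ?_
  rintro σ₂ τ₂ hfr₂ ⟨hτ₂, κa, ia, H₂, rfl, hmax₂, -, h6, h7', hH₂⟩
  rw [Multiset.card_cons] at h2 hcard hτ₁ hτ₂
  have g10 : ∀ i, σ₂.arr 10 i = if i = 1 then (ib : ℝ) else σ.arr 10 i := by
    intro i
    rw [hfr₂.2 10 rfl]
    simp [h7, hfr.2 10 rfl]
  apply Runs.seq
  apply Runs.setCell
  apply Runs.seq
  apply Runs.setReg
  apply Runs.seq
  apply Runs.setReg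
  have hF₂ : Forest σ₂ tr cnt ((ia ::ₘ {ib}) + H₂.map Prod.snd) := by
    have := hF.congr (σ' := σ₂) (by rw [hfr₂.1 16 rfl]; simp [hfr.1 16 rfl])
      (by rw [hfr₂.2 5 rfl]; funext i; simp [hfr.2 5 rfl])
      (by rw [hfr₂.2 6 rfl]; funext i; simp [hfr.2 6 rfl])
      (by rw [hfr₂.2 7 rfl]; funext i; simp [hfr.2 7 rfl])
    rw [Multiset.map_cons, Multiset.map_cons] at this
    rwa [Multiset.cons_add, Multiset.singleton_add, Multiset.cons_swap]
  have k10 : σ₂.reg 10 = C := by rw [hfr₂.1 10 rfl]; simp [hfr.1 10 rfl, h10]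
  refine Runs.mono (Runs.frame (combineProg_spec (H := H₂) (T := ia ::ₘ {ib})
    (A := H₂.map Prod.snd) (κ := κa - C) (tr := tr) (cnt := cnt)
    (hH₂.congr (by simp) (by funext i; simp) (by funext i; simp)) ⟨by simp, fun l => if l = 0 then ia
      else ib, ?_, ?_⟩ (hF₂.congr (by simp) (by funext i; simp) (by funext i; simp)
      (by funext i; simp)) ?_ (by simp))) ?_
  · simp [Multiset.range_succ]
    exact Multiset.cons_swap ia ib 0
  · intro l hl
    have : l = 0 ∨ l = 1 := by simp at hl; omega
    rcases this with rfl | rfl <;> simp [h7', g10]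
  · simp [h6, k10]
    ring
  · rintro σ₃ τ₃ ⟨hfr₃, hτ₃, tr', t, hH₃, -, hF₃, htr, -, ht, hnode⟩
    refine ⟨?_, tr', cnt + 1, _, hH₃, by simpa using hF₃, ?_, by simp, ?_⟩
    · have h1 : Nat.log 2 (H₂.card + 1) ≤ Nat.log 2 n := Nat.log_mono_right (by omega)
      have h2 : Nat.log 2 (H₂.card + 1 + 1) ≤ Nat.log 2 n := Nat.log_mono_right (by omega)
      unfold unitCost
      simp at hτ₃ ⊢
      omega
    · rw [hfr₃.1 10 rfl]
      simp [k10]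
    · have t0 : t 0 = ia := by
        have := ht 0 (by simp)
        simp [h7'] at this
        exact_mod_cast this.symm
      have t1 : t 1 = ib := by
        have := ht 1 (by simp)
        simp [g10] at this
        exact_mod_cast this.symm
      have hnode' : tr' cnt = FTree.node 2 ![tr ia, tr ib] := by
        rw [hnode, ← t0, ← t1]
        -- The number of children occurs in the type of the child function, so it is generalised
        -- before it is replaced by `2`.
        have : ∀ r, r = 2 → FTree.node r (fun l : Fin r => tr (t l)) =
            FTree.node 2 ![tr (t 0), tr (t 1)] := by
          rintro _ rfl
          congr 1
          funext l
          fin_cases l <;> rfl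
        exact this _ (by simp)
      have hfr : freqs C tr' H₂ = freqs C tr H₂ := by
        apply Multiset.map_congr rfl
        intro x hx
        rw [htr x.2 (hF.lt _ (by
          simp only [Multiset.map_cons, Multiset.mem_cons]
          exact Or.inr (Or.inr (Multiset.mem_map_of_mem _ hx))))]
      have e1 : freqs C tr ((κb, ib) ::ₘ (κa, ia) ::ₘ H₂) =
          freqs C tr H₂ + {(gridVal C κa, tr ia), (gridVal C κb, tr ib)} := by
        simp only [freqs, Multiset.map_cons, Multiset.insert_eq_cons]
        rw [add_comm, Multiset.cons_add, Multiset.singleton_add, Multiset.cons_swap]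
      have e2 : freqs C tr' ((κa - C, cnt) ::ₘ H₂) =
          freqs C tr H₂ + {(gridVal C κa / 2, FTree.node 2 ![tr ia, tr ib])} := by
        rw [← hfr, ← gridVal_sub C hC, ← hnode']
        simp only [freqs, Multiset.map_cons]
        rw [add_comm _ {_}, Multiset.singleton_add]
      rw [e1, e2]
      refine MergeLargest.mk _ _ _ _ _ ?_ ?_
      · exact (gridVal_strictMono hC).monotone (hmax₁ (κa, ia) (by simp))
      · intro x hx
        obtain ⟨y, hy, rfl⟩ := Multiset.mem_map.1 hx
        exact (gridVal_strictMono hC).monotone (hmax₂ _ (by simp [hy]))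

theorem mergeProg_spec (hn : 0 < n) {C : ℕ} (hC : 0 < C) {σ : Mem} {tr : ℕ → FTree n} {cnt : ℕ}
    {H : Multiset (ℤ × ℕ)} (hH : HeapAt σ H) (hF : Forest σ tr cnt (H.map Prod.snd))
    (h10 : σ.reg 10 = C) :
    Runs mergeProg σ fun σ' τ => τ ≤ 3 * unitCost n * n + 10 ∧
      ∃ (tr' : ℕ → FTree n) (cnt' : ℕ) (v : ℝ), Forest σ' tr' cnt' {cnt' - 1} ∧
        Relation.ReflTransGen MergeLargest (freqs C tr H) {(v, tr' (cnt' - 1))} := by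
  have hcard := hF.card_le
  rw [Multiset.card_map] at hcard
  refine Runs.loop (fun σ' B => ∃ tr' cnt' H', HeapAt σ' H' ∧
    Forest σ' tr' cnt' (H'.map Prod.snd) ∧ σ'.reg 10 = C ∧
    Relation.ReflTransGen MergeLargest (freqs C tr H) (freqs C tr' H') ∧
    B = 3 * unitCost n * H'.card) _ ⟨tr, cnt, H, hH, hF, h10, .refl, rfl⟩ ?_ ?_
  · rintro σ B ⟨tr', cnt', H', hH', hF', h10', hR, rfl⟩ hb
    simp [hH'.reg] at hb
    refine (mergeBody_spec hC hH' hF' h10' hb).mono ?_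
    rintro σ₁ τ₁ ⟨hτ, tr₂, cnt₂, H₂, hH₂, hF₂, h10₂, hc, hM⟩
    refine ⟨_, ⟨tr₂, cnt₂, H₂, hH₂, hF₂, h10₂, hR.tail hM, rfl⟩, ?_⟩
    rw [hc, mul_add]
    have : 700 ≤ unitCost n := by unfold unitCost; omega
    simp
    omega
  · rintro σ' τ B' ⟨tr', cnt', H', hH', hF', h10', hR, rfl⟩ hb hτ
    simp [hH'.reg] at hb hτ
    have hmem := hF'.ne_zero hn
    obtain ⟨⟨κ, i⟩, hx, hi⟩ := Multiset.mem_map.1 hmem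
    have hpos := Multiset.card_pos.2 (fun h : H' = 0 => by simp [h] at hx)
    obtain ⟨y, rfl⟩ := Multiset.card_eq_one.1 (show H'.card = 1 by omega)
    obtain rfl := Multiset.mem_singleton.1 hx
    obtain rfl : i = cnt' - 1 := hi
    refine ⟨?_, tr', cnt', gridVal C κ, by simpa using hF', by simpa [freqs] using hR⟩
    have := Nat.mul_le_mul_left (3 * unitCost n) hcard
    omega

/-- Expand the trees: compute the places of all trees from those of their parents. -/
def expandProg : Prog :=
  .seq (.setReg 11 (sub (reg 16) (const 1))) <|
  .seq (.setCell 1 (reg 11) (const 0)) <|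
  .seq (.setCell 2 (reg 11) (const 1)) <|
  .loop (.le (const 1) (reg 11)) <|
  .seq (.setReg 11 (sub (reg 11) (const 1))) <|
  .seq (.setReg 12 (cell 5 (reg 11))) <|
  .seq (.setCell 1 (reg 11) (add (cell 1 (reg 12)) (mul (cell 6 (reg 11)) (cell 2 (reg 12))))) <|
  .setCell 2 (reg 11) (mul (cell 7 (reg 12)) (cell 2 (reg 12)))

/-- Going down through the names, the place of the parent is known before it is needed. The leaves
are the names below `n`, so the output ends up in the right cells, and `cnt < 2 * n` bounds the
time. -/
theorem expandProg_spec {σ : Mem} {tr : ℕ → FTree n} {cnt : ℕ}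
    (hF : Forest σ tr cnt {cnt - 1}) :
    Runs expandProg σ fun σ' τ => τ ≤ 80 * n + 50 ∧ ∃ p q : Fin n → ℕ, HoldsPairs σ' p q ∧
      ∀ i, Places (tr (cnt - 1)) 0 1 i (p i) (q i) := by
  have hle := hF.le
  have hcard := hF.card
  rw [Multiset.card_singleton] at hcard
  apply Runs.seq
  apply Runs.setReg
  apply Runs.seq
  apply Runs.setCell
  apply Runs.seq
  apply Runs.setCell
  have e16 : σ.reg 16 - 1 = ((cnt - 1 : ℕ) : ℝ) := by
    rw [hF.reg, Nat.cast_sub (by omega)]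
    simp
  refine Runs.loop (fun σ' B => ∃ k : ℕ, k < cnt ∧ σ'.reg 11 = k ∧ σ'.arr 5 = σ.arr 5 ∧
    σ'.arr 6 = σ.arr 6 ∧ σ'.arr 7 = σ.arr 7 ∧
    (∀ i, k ≤ i → i < cnt → ∃ p q : ℕ, σ'.arr 1 i = p ∧ σ'.arr 2 i = q ∧
      ∀ i' p' q', Places (tr i) p q i' p' q' → Places (tr (cnt - 1)) 0 1 i' p' q') ∧
    B = 40 * k) (40 * (cnt - 1)) ?_ ?_ ?_
  · refine ⟨cnt - 1, by omega, by simp [e16], by funext i; simp, by funext i; simp,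
      by funext i; simp, ?_, rfl⟩
    intro i h₁ h₂
    obtain rfl : i = cnt - 1 := by omega
    refine ⟨0, 1, ?_, ?_, fun _ _ _ h => h⟩
    · simp only [Mem.arr_setCell, Mem.reg_setCell, Mem.reg_setReg, RExpr.eval, Mem.arr_setReg]
      simp [e16]
    · simp only [Mem.arr_setCell, Mem.reg_setCell, Mem.reg_setReg, RExpr.eval, Mem.arr_setReg]
      simp [e16]
  · rintro σ' B ⟨k, hk, h11, h5, h6, h7, hP, rfl⟩ hb
    have hk1 : 1 ≤ k := by simpa [h11] using hb
    obtain ⟨j, rfl⟩ : ∃ j, k = j + 1 := ⟨k - 1, by omega⟩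
    rcases hF.parent j (by omega) with h | ⟨t, m, child, l, hjt, htc, g5, g6, g7, hnode, hchild⟩
    · rw [Multiset.mem_singleton] at h
      omega
    obtain ⟨p, q, hp, hq, hpl⟩ := hP t (by omega) htc
    have e11 : σ'.reg 11 - 1 = (j : ℝ) := by rw [h11]; push_cast; ring
    repeat' with_reducible first | apply Runs.seq | apply Runs.setReg | apply Runs.setCell
    refine ⟨_, ⟨j, by omega, by simp [e11], by funext i; simp [h5], by funext i; simp [h6],
      by funext i; simp [h7], ?_, rfl⟩, ?_⟩
    · intro i h₁ h₂
      by_cases hij : i = j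
      · subst hij
        refine ⟨p + l * q, m * q, ?_, ?_, fun i' p' q' h => hpl _ _ _ ?_⟩
        · simp [e11, h5, g5, h6, g6, hp, hq]
        · simp [e11, h5, g5, h7, g7, hq]
        · rw [hnode]
          refine Places.node l ?_
          rwa [hchild]
      · obtain ⟨p, q, hp, hq, hpl⟩ := hP i (by omega) h₂
        exact ⟨p, q, by simp [e11, hij, hp], by simp [e11, hij, hq], hpl⟩
    · simp
      omega
  · rintro σ' τ B' ⟨k, hk, h11, h5, h6, h7, hP, rfl⟩ hb hτ
    have hk0 : k = 0 := by simpa [h11] using hb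
    subst hk0
    refine ⟨?_, ?_⟩
    · simp at hτ ⊢
      omega
    · have : ∀ i : Fin n, ∃ p q : ℕ, σ'.arr 1 i = p ∧ σ'.arr 2 i = q ∧
          Places (tr (cnt - 1)) 0 1 i p q := by
        intro i
        obtain ⟨p, q, hp, hq, hpl⟩ := hP i (by omega) (by have := i.2; omega)
        refine ⟨p, q, hp, hq, hpl _ _ _ ?_⟩
        rw [hF.leaf i]
        exact Places.leaf i p q
      choose p q hp hq hpl using this
      exact ⟨p, q, fun i => ⟨hp i, hq i⟩, hpl⟩

/-! ### The frequencies of the items -/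

/-- Compute `(1 + δ) H`, `lo`, `lo / 2` and `C`. -/
def initProg : Prog :=
  .seq (.setReg 11 (const 0)) <|
  .seq (.loop (.lt (reg 11) (reg 0)) <|
    .seq (.setReg 7 (add (reg 7) (cell 0 (reg 11)))) (.setReg 11 (add (reg 11) (const 1)))) <|
  .seq (.setReg 8 (mul (add (const 1) (mul (const 3) (sqrt (divide (cell 0 (const 0)) (reg 7)))))
    (reg 7))) <|
  .seq (.setReg 9 (floor (divide (log (divide (reg 8) (cell 0 (const 0)))) (log (const 2))))) <|
  .seq (.setReg 25 (floor (divide (reg 9) (const 2)))) <|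
  .seq (.setReg 10 (const 1)) <|
  .seq (.setReg 11 (reg 25)) <|
  .loop (.le (const 1) (reg 11)) <|
  .seq (.setReg 10 (mul (const 2) (reg 10))) (.setReg 11 (sub (reg 11) (const 1)))

theorem sumLoop_spec (h : Fin n → ℝ) {σ : Mem} (h0 : σ.reg 0 = n) (h7 : σ.reg 7 = 0)
    (h11 : σ.reg 11 = 0) (hh : ∀ i : Fin n, σ.arr 0 i = h i) :
    Runs (.loop (.lt (reg 11) (reg 0)) <|
      .seq (.setReg 7 (add (reg 7) (cell 0 (reg 11)))) (.setReg 11 (add (reg 11) (const 1)))) σ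
      fun σ' τ => τ ≤ 20 * n + 10 ∧ σ'.reg 7 = ∑ i, h i := by
  refine Runs.loop (fun σ' B => ∃ s ≤ n, σ'.reg 11 = (s : ℕ) ∧ σ'.reg 0 = n ∧ σ'.arr = σ.arr ∧
    σ'.reg 7 = ∑ i ∈ Finset.range s, σ.arr 0 i ∧ B = 20 * (n - s)) (20 * n)
    ⟨0, by omega, by simpa using h11, h0, rfl, by simpa using h7, rfl⟩ ?_ ?_
  · rintro σ' B ⟨s, hs, h11, h0, ha, h7, rfl⟩ hb
    have hsn : s < n := by simpa [h11, h0] using hb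
    repeat' with_reducible first | apply Runs.seq | apply Runs.setReg | apply Runs.setCell
    refine ⟨_, ⟨s + 1, hsn, by simp [h11], by simp [h0], by simp [ha], ?_, rfl⟩, ?_⟩
    · simp [h7, h11, ha, Finset.sum_range_succ]
    · simp
      omega
  · rintro σ' τ B' ⟨s, hs, h11, h0, ha, h7, rfl⟩ hb hτ
    have : s = n := by
      have : n ≤ s := by simpa [h11, h0] using hb
      omega
    subst this
    simp at hτ
    refine ⟨by omega, ?_⟩
    rw [h7, Finset.sum_range]
    exact Finset.sum_congr rfl fun i _ => hh i

theorem powLoop_spec {σ : Mem} {c : ℕ} (h10 : σ.reg 10 = 1) (h11 : σ.reg 11 = c) :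
    Runs (.loop (.le (const 1) (reg 11)) <|
      .seq (.setReg 10 (mul (const 2) (reg 10))) (.setReg 11 (sub (reg 11) (const 1)))) σ
      fun σ' τ => τ ≤ 20 * c + 10 ∧ σ'.reg 10 = (2 ^ c : ℕ) := by
  refine Runs.loop (fun σ' B => ∃ s ≤ c, σ'.reg 11 = (s : ℕ) ∧ σ'.reg 10 * 2 ^ s = 2 ^ c ∧
    B = 20 * s) (20 * c) ⟨c, le_rfl, h11, by simp [h10], rfl⟩ ?_ ?_
  · rintro σ' B ⟨s, hs, h11, h10, rfl⟩ hb
    have hs1 : 1 ≤ s := by simpa [h11] using hb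
    obtain ⟨s, rfl⟩ : ∃ t, s = t + 1 := ⟨s - 1, by omega⟩
    repeat' with_reducible first | apply Runs.seq | apply Runs.setReg | apply Runs.setCell
    refine ⟨_, ⟨s, by omega, by simp [h11], ?_, rfl⟩, ?_⟩
    · simp
      rw [← h10, pow_succ]
      ring
    · simp
      omega
  · rintro σ' τ B' ⟨s, hs, h11, h10, rfl⟩ hb hτ
    have hs0 : s = 0 := by simpa [h11] using hb
    subst hs0
    simp at hτ h10
    exact ⟨by omega, by simpa using h10⟩

theorem floor_log_eq {x : ℝ} {k : ℤ} (h₁ : (2 : ℝ) ^ k ≤ x) (h₂ : x < 2 ^ (k + 1)) :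
    ⌊Real.log x / Real.log 2⌋ = k := by
  have h2 : 0 < Real.log 2 := Real.log_pos one_lt_two
  have hp : (0 : ℝ) < 2 ^ k := by positivity
  rw [Int.floor_eq_iff, le_div_iff₀ h2, div_lt_iff₀ h2]
  have e₁ := Real.log_le_log hp h₁
  have e₂ := Real.log_lt_log (hp.trans_le h₁) h₂
  rw [Real.log_zpow] at e₁ e₂
  push_cast at e₂
  exact ⟨e₁, e₂⟩

theorem initProg_spec (hn : 0 < n) (h : Fin n → ℝ) {lo : ℕ}
    (h₁ : (2 : ℝ) ^ lo ≤ initialFreq hn h ⟨0, hn⟩)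
    (h₂ : initialFreq hn h ⟨0, hn⟩ < (2 : ℝ) ^ (lo + 1)) :
    Runs initProg (inputMem h) fun σ' τ => τ ≤ 20 * n + 20 * lo + 100 ∧
      σ'.reg 8 = (1 + delta hn h) * ∑ j, h j ∧ σ'.reg 9 = lo ∧ σ'.reg 25 = (lo / 2 : ℕ) ∧
      σ'.reg 10 = (2 ^ (lo / 2) : ℕ) := by
  apply Runs.seq
  apply Runs.setReg
  refine Runs.seq_spec (sumLoop_spec h (by simp [inputMem]) (by simp [inputMem]) (by simp)
    (by simp [inputMem])) ?_
  rintro σ₁ τ₁ hfr ⟨hτ₁, h7⟩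
  have h0 : σ₁.arr 0 0 = h ⟨0, hn⟩ := by
    rw [hfr.2 0 rfl]
    simp [inputMem, hn]
  apply Runs.seq
  apply Runs.setReg
  have e8 : (mul (add (const 1) (mul (const 3) (sqrt (divide (cell 0 (const 0)) (reg 7)))))
    (reg 7)).eval σ₁ = (1 + delta hn h) * ∑ j, h j := by
    simp [h0, h7, delta]
  rw [e8]
  apply Runs.seq
  apply Runs.setReg
  have e9 : (floor (divide (log (divide (reg 8) (cell 0 (const 0)))) (log (const 2)))).eval
      (σ₁.setReg 8 ((1 + delta hn h) * ∑ j, h j)) = lo := by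
    simp only [RExpr.eval, Mem.reg_setReg, Mem.arr_setReg, if_true, Int.cast_zero, Nat.floor_zero, h0,
      Int.cast_ofNat]
    rw [floor_log_eq (k := lo) (by exact_mod_cast h₁) (by exact_mod_cast h₂)]
    simp
  rw [e9]
  apply Runs.seq
  apply Runs.setReg
  have e25 : ∀ σ : Mem, σ.reg 9 = lo → (floor (divide (reg 9) (const 2))).eval σ = (lo / 2 : ℕ) := by
    intro σ h9
    simp only [RExpr.eval, h9, Int.cast_ofNat]
    rw [← natCast_floor_eq_intCast_floor (by positivity), Nat.floor_div_ofNat, Nat.floor_natCast]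
  rw [e25 _ (by simp)]
  apply Runs.seq
  apply Runs.setReg
  apply Runs.seq
  apply Runs.setReg
  refine Runs.mono (Runs.frame (powLoop_spec (c := lo / 2) (by simp) (by simp))) ?_
  rintro σ₂ τ₂ ⟨hfr₂, hτ₂, h10⟩
  refine ⟨?_, ?_, ?_, ?_, h10⟩
  · simp
    omega
  · rw [hfr₂.1 8 rfl]; simp
  · rw [hfr₂.1 9 rfl]; simp
  · rw [hfr₂.1 25 rfl]; simp

/-- Find by bisection the largest `j` with `log (1 + j / C)` at most the value in register `13`. -/
def searchProg : Prog :=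
  .loop (.le (const 2) (reg 15)) <|
  .seq (.setReg 15 (divide (reg 15) (const 2))) <|
  .ite (.le (log (add (const 1) (divide (add (reg 14) (reg 15)) (reg 10)))) (reg 13))
    (.setReg 14 (add (reg 14) (reg 15))) .skip

/-- The answer is kept between `j` and `j + 2 ^ d`. The bounds on `y` make the whole range `0` to `2
^ c` a valid start, and `d` drops by one per round. -/
theorem searchProg_spec {σ : Mem} {c : ℕ} {y : ℝ} (h10 : σ.reg 10 = (2 ^ c : ℕ))
    (h13 : σ.reg 13 = y) (h14 : σ.reg 14 = 0) (h15 : σ.reg 15 = (2 ^ c : ℕ)) (hy0 : 0 ≤ y)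
    (hy : y < Real.log 2) :
    Runs searchProg σ fun σ' τ => τ ≤ 40 * c + 10 ∧ ∃ j : ℕ, σ'.reg 14 = j ∧ j < 2 ^ c ∧
      Real.log (1 + (j : ℝ) / (2 ^ c : ℕ)) ≤ y ∧
      y < Real.log (1 + ((j : ℝ) + 1) / (2 ^ c : ℕ)) := by
  refine Runs.loop (fun σ' B => ∃ j d : ℕ, σ'.reg 14 = j ∧ σ'.reg 15 = (2 ^ d : ℕ) ∧
    σ'.reg 10 = (2 ^ c : ℕ) ∧ σ'.reg 13 = y ∧ j + 2 ^ d ≤ 2 ^ c ∧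
    Real.log (1 + (j : ℝ) / (2 ^ c : ℕ)) ≤ y ∧
    y < Real.log (1 + ((j : ℝ) + (2 ^ d : ℕ)) / (2 ^ c : ℕ)) ∧ B = 40 * d) (40 * c) ?_ ?_ ?_
  · refine ⟨0, c, by simpa using h14, h15, h10, h13, by simp, by simpa using hy0, ?_, rfl⟩
    have : ((2 ^ c : ℕ) : ℝ) ≠ 0 := by positivity
    rw [Nat.cast_zero, zero_add, div_self this]
    norm_num
    exact hy
  · rintro σ' B ⟨j, d, h14, h15, h10, h13, hjd, hl, hu, rfl⟩ hb
    have hd : d ≠ 0 := by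
      rintro rfl
      simp [h15] at hb
    obtain ⟨d, rfl⟩ : ∃ e, d = e + 1 := ⟨d - 1, by omega⟩
    have e15 : (divide (reg 15) (const 2)).eval σ' = (2 ^ d : ℕ) := by
      simp [h15, pow_succ]
    have hjd' : j + 2 ^ d + 2 ^ d ≤ 2 ^ c := by rw [pow_succ] at hjd; omega
    have hp : 0 < 2 ^ d := by positivity
    apply Runs.seq
    apply Runs.setReg
    rw [e15]
    apply Runs.ite
    · intro hb
      simp only [RTest.holds, RExpr.eval, Mem.reg_setReg, h14, h10, h13] at hb
      norm_num at hb
      apply Runs.setReg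
      refine ⟨_, ⟨j + 2 ^ d, d, by simp [h14], by simp, by simp [h10], by simp [h13], hjd', ?_, ?_,
        rfl⟩, ?_⟩
      · push_cast
        exact hb
      · refine hu.trans_eq ?_
        push_cast
        congr 3
        ring
      · simp
        omega
    · intro hb
      simp only [RTest.holds, RExpr.eval, Mem.reg_setReg, h14, h10, h13] at hb
      norm_num at hb
      apply Runs.skip
      refine ⟨_, ⟨j, d, by simp [h14], by simp, by simp [h10], by simp [h13], by omega, hl, ?_,
        rfl⟩, ?_⟩
      · push_cast
        exact hb
      · simp
        omega
  · rintro σ' τ B' ⟨j, d, h14, h15, h10, h13, hjd, hl, hu, rfl⟩ hb hτ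
    have hd : d = 0 := by
      by_contra hd
      obtain ⟨d, rfl⟩ : ∃ e, d = e + 1 := ⟨d - 1, by omega⟩
      apply hb
      simp only [RTest.holds, RExpr.eval, h15]
      have : (1 : ℝ) ≤ 2 ^ d := one_le_pow₀ one_le_two
      push_cast
      rw [pow_succ]
      linarith
    subst hd
    simp at hτ
    exact ⟨by omega, j, h14, by simpa using hjd, hl, by simpa using hu⟩

/-- The layer `k` of a slowly growing item is not bounded in terms of `n`. Comparing logarithms
avoids computing `2 ^ k`. -/
theorem gridVal_of_log {c j : ℕ} {k : ℤ} {x : ℝ} (hx : 0 < x) (hj : j < 2 ^ c)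
    (hl : Real.log (1 + (j : ℝ) / (2 ^ c : ℕ)) ≤ Real.log x - k * Real.log 2)
    (hu : Real.log x - k * Real.log 2 < Real.log (1 + ((j : ℝ) + 1) / (2 ^ c : ℕ))) :
    gridVal (2 ^ c) (k * (2 ^ c : ℕ) + j) ≤ x ∧ x < gridVal (2 ^ c) (k * (2 ^ c : ℕ) + j + 1) := by
  have hp : (0 : ℝ) < 2 ^ k := by positivity
  have h1 : (0 : ℝ) < 1 + (j : ℝ) / (2 ^ c : ℕ) := by positivity
  have h2 : (0 : ℝ) < 1 + ((j : ℝ) + 1) / (2 ^ c : ℕ) := by positivity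
  rw [gridVal_eq (by omega) (by exact_mod_cast hj), gridVal_succ (by omega) (by exact_mod_cast hj)]
  rw [Int.cast_natCast]
  constructor
  · rw [← Real.log_le_log_iff (by positivity) hx, Real.log_mul hp.ne' h1.ne', Real.log_zpow]
    linarith
  · rw [← Real.log_lt_log_iff hx (by positivity), Real.log_mul hp.ne' h2.ne', Real.log_zpow]
    linarith

/-- Compute the keys of the items. -/
def keysProg : Prog :=
  .seq (.setReg 11 (const 0)) <|
  .seq (.loop (.lt (reg 11) (reg 0)) <|
    .seq (.setReg 13 (log (divide (reg 8) (cell 0 (reg 11))))) <|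
    .seq (.setReg 12 (floor (divide (reg 13) (log (const 2))))) <|
    .seq (.setReg 13 (sub (reg 13) (mul (reg 12) (log (const 2))))) <|
    .seq (.setReg 14 (const 0)) <|
    .seq (.setReg 15 (reg 10)) <|
    .seq searchProg <|
    .seq (.setCell 8 (reg 11) (sub (const 0) (add (mul (reg 12) (reg 10)) (reg 14)))) <|
    .seq (.setCell 9 (reg 11) (reg 11)) <|
    .setReg 11 (add (reg 11) (const 1))) <|
  .seq (.setReg 16 (reg 0)) (.setReg 17 (reg 0))

theorem keysProg_spec {σ : Mem} {x : Fin n → ℝ} {c : ℕ} (hx0 : ∀ i, 0 < x i)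
    (h0 : σ.reg 0 = n) (h10 : σ.reg 10 = (2 ^ c : ℕ))
    (hx : ∀ i : Fin n, σ.reg 8 / σ.arr 0 i = x i) :
    Runs keysProg σ fun σ' τ => τ ≤ n * (40 * c + 100) + 50 ∧ σ'.reg 16 = n ∧ ∃ κ : Fin n → ℤ,
      (∀ i, gridVal (2 ^ c) (κ i) ≤ x i ∧ x i < gridVal (2 ^ c) (κ i + 1)) ∧
      ListAt σ' (Finset.univ.val.map fun i => (κ i, (i : ℕ))) := by
  apply Runs.seq
  apply Runs.setReg
  apply Runs.seq
  refine Runs.loop (fun σ' B => ∃ s ≤ n, σ'.reg 11 = (s : ℕ) ∧ σ'.reg 0 = n ∧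
    σ'.reg 8 = σ.reg 8 ∧ σ'.reg 10 = (2 ^ c : ℕ) ∧ σ'.arr 0 = σ.arr 0 ∧
    (∀ i : Fin n, (i : ℕ) < s → ∃ κ : ℤ, σ'.arr 8 i = -(κ : ℝ) ∧ σ'.arr 9 i = ((i : ℕ) : ℝ) ∧
      gridVal (2 ^ c) κ ≤ x i ∧ x i < gridVal (2 ^ c) (κ + 1)) ∧
    B = (n - s) * (40 * c + 100)) (n * (40 * c + 100)) ?_ ?_ ?_
  · exact ⟨0, by omega, by simp, by simp [h0], by simp, by simp [h10], by simp, by omega, rfl⟩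
  · rintro σ' B ⟨s, hs, h11, h0, h8, h10, ha, hκ, rfl⟩ hb
    have hsn : s < n := by simpa [h11, h0] using hb
    set i : Fin n := ⟨s, hsn⟩ with hi
    have h2 : 0 < Real.log 2 := Real.log_pos one_lt_two
    have e13 : (log (divide (reg 8) (cell 0 (reg 11)))).eval σ' = Real.log (x i) := by
      rw [← hx i]
      simp [h8, h11, ha, hi]
    apply Runs.seq
    apply Runs.setReg
    rw [e13]
    set k : ℤ := ⌊Real.log (x i) / Real.log 2⌋ with hk
    have hk₁ : k * Real.log 2 ≤ Real.log (x i) := (le_div_iff₀ h2).1 (Int.floor_le _)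
    have hk₂ : Real.log (x i) < (k + 1) * Real.log 2 := (div_lt_iff₀ h2).1 (Int.lt_floor_add_one _)
    apply Runs.seq
    apply Runs.setReg
    apply Runs.seq
    apply Runs.setReg
    apply Runs.seq
    apply Runs.setReg
    apply Runs.seq
    apply Runs.setReg
    refine Runs.seq_spec (searchProg_spec (c := c) (y := Real.log (x i) - k * Real.log 2)
      (by simp [h10]) (by simp [hk]) (by simp) (by simp [h10]) (by linarith) (by linarith)) ?_
    rintro σ₁ τ₁ hfr ⟨hτ₁, j, h14, hj, hl, hu⟩
    have g11 : σ₁.reg 11 = s := by rw [hfr.1 11 rfl]; simp [h11]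
    have g0 : σ₁.reg 0 = n := by rw [hfr.1 0 rfl]; simp [h0]
    have g8 : σ₁.reg 8 = σ.reg 8 := by rw [hfr.1 8 rfl]; simp [h8]
    have g10 : σ₁.reg 10 = (2 ^ c : ℕ) := by rw [hfr.1 10 rfl]; simp [h10]
    have g12 : σ₁.reg 12 = k := by rw [hfr.1 12 rfl]; simp [hk]
    have ga : σ₁.arr = σ'.arr := by rw [hfr.arr fun a => rfl]; rfl
    repeat' with_reducible first | apply Runs.seq | apply Runs.setReg | apply Runs.setCell
    refine ⟨_, ⟨s + 1, hsn, by simp [g11], by simp [g0], by simp [g8], by simp [g10], ?_, ?_, rfl⟩,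
      ?_⟩
    · funext i'
      simp [ga, ha]
    · intro i' hi'
      by_cases his : (i' : ℕ) = s
      · obtain rfl : i' = i := Fin.ext his
        refine ⟨k * (2 ^ c : ℕ) + j, ?_, ?_, gridVal_of_log (hx0 _) hj hl hu⟩
        · simp [g11, g12, g10, h14, hi]
        · simp [g11, hi]
      · obtain ⟨κ, h₁, h₂, h₃⟩ := hκ i' (by omega)
        refine ⟨κ, ?_, ?_, h₃⟩
        · simp [g11, ga, his, h₁]
        · simp [g11, ga, his, h₂]
    · have h4 : n - s = n - (s + 1) + 1 := by omega
      rw [h4, add_mul]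
      simp
      omega
  · rintro σ' τ B' ⟨s, hs, h11, h0, h8, h10, ha, hκ, rfl⟩ hb hτ
    have : s = n := by
      have : n ≤ s := by simpa [h11, h0] using hb
      omega
    subst this
    apply Runs.seq
    apply Runs.setReg
    apply Runs.setReg
    choose κ h₁ h₂ h₃ using fun i : Fin s => hκ i i.2
    refine ⟨?_, by simp [h0], κ, h₃, by simp [h0], ?_⟩
    · simp at hτ ⊢
      omega
    · rw [Multiset.map_map, Multiset.card_map]
      have e : (Finset.univ : Finset (Fin s)).val.card = s := by simp
      rw [e, ← map_univ_fin_eq_map_range]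
      apply Multiset.map_congr rfl
      intro i _
      simp [entry, h₁, h₂]

/-! ### The Main Algorithm -/

/-- With `u = h₁ / H` the value is `(1 + 3 * √u) / u`, where `1 / n ≤ u ≤ 1` and `u ≤ √u ≤ 1`. The
lower bound gives `lo ≥ 1`, the upper one `lo = O(log n)`. -/
theorem initialFreq_bounds (hn : 0 < n) (h : Fin n → ℝ) (hpos : ∀ i, 0 < h i) (hanti : Antitone h) :
    2 ≤ initialFreq hn h ⟨0, hn⟩ ∧ initialFreq hn h ⟨0, hn⟩ ≤ 4 * n := by
  set a := h ⟨0, hn⟩ with ha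
  set H := ∑ j, h j with hH
  have ha0 : 0 < a := hpos _
  have haH : a ≤ H := Finset.single_le_sum (f := h) (fun i _ => (hpos i).le) (Finset.mem_univ _)
  have hHn : H ≤ n * a := by
    have := Finset.sum_le_card_nsmul Finset.univ h a fun i _ => hanti (Fin.mk_le_mk.2 (Nat.zero_le _))
    simpa using this
  have hH0 : 0 < H := ha0.trans_le haH
  have hu0 : 0 < a / H := by positivity
  have hu1 : a / H ≤ 1 := (div_le_one hH0).2 haH
  have hs1 : Real.sqrt (a / H) ≤ 1 := Real.sqrt_le_one.2 hu1
  have hs2 : a / H ≤ Real.sqrt (a / H) := Real.le_sqrt_of_sq_le (by nlinarith)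
  have e : initialFreq hn h ⟨0, hn⟩ = (1 + 3 * Real.sqrt (a / H)) * (H / a) := by
    rw [initialFreq, delta, mul_div_assoc]
  rw [e]
  have h1 : 1 ≤ H / a := (one_le_div ha0).2 haH
  have h2 : H / a ≤ n := (div_le_iff₀ ha0).2 hHn
  have h3 : a / H * (H / a) = 1 := by field_simp
  constructor
  · nlinarith
  · nlinarith

theorem initialFreq_mono (hn : 0 < n) (h : Fin n → ℝ) (hpos : ∀ i, 0 < h i) (hanti : Antitone h) :
    Monotone (initialFreq hn h) := by
  intro i j hij
  have : 0 ≤ delta hn h := by unfold delta; positivity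
  have : 0 ≤ ∑ j, h j := Finset.sum_nonneg fun i _ => (hpos i).le
  unfold initialFreq
  exact div_le_div_of_nonneg_left (by positivity) (hpos j) (hanti hij)

theorem forEach_of_desc {push : Bool} {C lo hi : ℕ} (hC : 0 < C) (hlo : 0 < lo)
    {G : ℕ → ℕ → Freqs n → Freqs n → Prop}
    (hG : ∀ k j S S', lo ≤ k → 0 < j → j < C → ∀ S₁,
      CombineAll (if k = lo then C + j else 2) (gridFreq C k j) S S₁ →
      S' = (if push then pushDown (gridFreq C k j) (gridFreq C k (j - 1)) S₁ else S₁) → G k j S S')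
    {S₀ S : Freqs n}
    (h : Desc (KeyStep push C lo) ((hi + 1 : ℕ) * C - 1) S₀ ((lo : ℤ) * C - 1) S) :
    ForEach (fun k => ForEach (G k) (downTo (C - 1) 1)) (downTo hi lo) S₀ S := by
  -- The end key `lo * C - 1` is the last group of layer `lo - 1`, where nothing of that layer has
  -- been done. This is where `0 < lo` is needed.
  have key := h.forEach (lo := lo) hC (G := G) ?_ ?_ (lo - 1) (C - 1) ?_ (by omega)
    (by omega) (by omega)
  · obtain ⟨S₁, h₁, h₂⟩ := key
    rw [Nat.sub_add_cancel hlo] at h₁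
    rw [downTo_eq_nil (by omega)] at h₂
    obtain rfl : S₁ = S := h₂
    exact h₁
  · intro k j S S' hk hj0 hj hR
    have hd : ((k : ℤ) * C + j) / (C : ℤ) = k := key_ediv (by omega) (by omega)
    have hm : ((k : ℤ) * C + j) % (C : ℤ) = j := key_emod (by omega) (by omega)
    have hact : Active C lo ((k : ℤ) * C + j) := by
      rw [Active, hd, hm]
      omega
    rw [KeyStep, if_pos hact] at hR
    obtain ⟨S₂, hS₂, hS'⟩ := hR
    refine hG k j S S' hk hj0 hj S₂ ?_ ?_
    · rw [gridFreq_eq hj]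
      convert hS₂ using 1
      rw [arity, hd, hm]
      simp
    · rw [gridFreq_eq hj, gridFreq_eq (by omega), hS', Nat.cast_sub (by omega)]
      simp [add_sub_assoc]
  · intro k S S' hR
    have hact : ¬ Active C lo ((k : ℤ) * C) := fun h => h.2 (Int.mul_emod_left _ _)
    rwa [KeyStep, if_neg hact] at hR
  · rw [Nat.cast_sub hlo, Nat.cast_sub hC]
    push_cast
    ring

/-- The Main Algorithm. -/
def mainProg : Prog :=
  .seq initProg <| .seq keysProg <| .seq (descentPhase 0) <| .seq (descentPhase 1) <|
  .seq loadProg <| .seq mergeProg expandProg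

theorem mainProg_spec (hn : 0 < n) (h : Fin n → ℝ) (hpos : ∀ i, 0 < h i) (hanti : Antitone h) :
    Runs mainProg (inputMem h) fun σ' τ => τ ≤ 30 * unitCost n * n ∧ ∃ p q : Fin n → ℕ,
      HoldsPairs σ' p q ∧ MainAlgorithm hn h p q := by
  obtain ⟨hx2, hxn⟩ := initialFreq_bounds hn h hpos hanti
  have hmono := initialFreq_mono hn h hpos hanti
  obtain ⟨lo, hlo₁, hlo₂⟩ := exists_nat_pow_near (show (1 : ℝ) ≤ initialFreq hn h ⟨0, hn⟩ by linarith)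
    one_lt_two
  set last : Fin n := ⟨n - 1, Nat.sub_lt hn one_pos⟩ with hlast
  have hle0 : ∀ i, initialFreq hn h ⟨0, hn⟩ ≤ initialFreq hn h i := fun i =>
    hmono (Fin.mk_le_mk.2 (Nat.zero_le _))
  have hlel : ∀ i, initialFreq hn h i ≤ initialFreq hn h last := fun i =>
    hmono (Fin.mk_le_mk.2 (by have := i.2; omega))
  obtain ⟨hi, hhi₁, hhi₂⟩ := exists_nat_pow_near (show (1 : ℝ) ≤ initialFreq hn h last by
    have := hle0 last; linarith) one_lt_two
  have hlo0 : 0 < lo := by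
    by_contra hcon
    obtain rfl : lo = 0 := by omega
    norm_num at hlo₂
    linarith
  have hlohi : lo ≤ hi := by
    have : (2 : ℝ) ^ lo < 2 ^ (hi + 1) := (hlo₁.trans (hle0 last)).trans_lt hhi₂
    have := (pow_lt_pow_iff_right₀ (one_lt_two (α := ℝ))).1 this
    omega
  have hlog : lo ≤ Nat.log 2 n + 2 := by
    have h1 : (2 : ℝ) ^ lo ≤ 4 * n := hlo₁.trans hxn
    have h2 : 2 ^ lo ≤ n * 2 * 2 := by
      have : 2 ^ lo ≤ 4 * n := by exact_mod_cast h1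
      omega
    have := Nat.le_log_of_pow_le one_lt_two h2
    rwa [Nat.log_mul_base one_lt_two (by omega), Nat.log_mul_base one_lt_two (by omega)] at this
  set c := lo / 2 with hc
  set C := 2 ^ c with hC
  have hC0 : 0 < C := by positivity
  have hinj := gridVal_strictMono hC0
  refine Runs.seq_spec (initProg_spec hn h hlo₁ hlo₂) ?_
  rintro σ₁ τ₁ hfr₁ ⟨hτ₁, h8, h9, h25, h10⟩
  refine Runs.seq_spec (keysProg_spec (σ := σ₁) (x := initialFreq hn h) (c := c) ?_ ?_ h10 ?_) ?_
  · intro i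
    have := hle0 i
    linarith
  · rw [hfr₁.1 0 rfl]; simp [inputMem]
  · intro i
    rw [h8, hfr₁.2 0 rfl]
    simp [inputMem, initialFreq]
  rintro σ₂ τ₂ hfr₂ ⟨hτ₂, h16, κ, hκ, hL⟩
  let tr : ℕ → FTree n := fun i => if hi : i < n then .leaf ⟨i, hi⟩ else .leaf ⟨0, hn⟩
  set L : Multiset (ℤ × ℕ) := Finset.univ.val.map fun i : Fin n => (κ i, (i : ℕ)) with hLdef
  have eL : L.map Prod.snd = Multiset.range n := by
    rw [hLdef, Multiset.map_map]
    simpa using map_univ_fin_eq_map_range n fun i => i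
  have hS : ListState c lo σ₂ tr n L := by
    refine ⟨⟨?_, rfl, by simp⟩, ⟨?_, fun _ => 0, by simp, by simp⟩, hL, ?_, ?_, ?_, ?_⟩
    · rw [hfr₂.1 2 rfl, hfr₁.1 2 rfl]; simp [inputMem]
    · rw [hfr₂.1 19 rfl, hfr₁.1 19 rfl]; simp [inputMem]
    · rw [eL]
      refine ⟨h16, fun i => ?_, le_rfl, by simp, Multiset.nodup_range n, fun i hi => Or.inl (by simpa using hi),
        by simp; omega⟩
      simp [tr]
    · rw [hfr₂.1 9 rfl, h9]
    · rw [hfr₂.1 10 rfl, h10]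
    · rw [hfr₂.1 25 rfl, h25]
  have egr : ∀ k : ℕ, gridVal C ((k : ℤ) * C) = 2 ^ k := by
    intro k
    have := gridVal_eq (C := C) (k := k) (j := 0) le_rfl (by omega)
    simpa using this
  have hκhi : ∀ i, κ i ≤ (hi + 1 : ℕ) * C - 1 := by
    intro i
    have : gridVal C (κ i) < gridVal C ((hi + 1 : ℕ) * C) := by
      rw [egr]
      exact ((hκ i).1.trans (hlel i)).trans_lt hhi₂
    have := hinj.lt_iff_lt.1 this
    omega
  -- `2 ^ lo` is itself a grid frequency not above any initial frequency, so rounding down cannot go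
  -- below it.
  have hκlo : ∀ i, (lo : ℤ) * C ≤ κ i := by
    intro i
    have : gridVal C (lo * C) < gridVal C (κ i + 1) := by
      rw [egr]
      exact (hlo₁.trans (hle0 i)).trans_lt (hκ i).2
    have := hinj.lt_iff_lt.1 this
    omega
  have hlob : (lo : ℤ) * C - 1 ≤ (hi + 1 : ℕ) * C - 1 := by
    have := mul_le_mul_of_nonneg_right (show (lo : ℤ) ≤ (hi + 1 : ℕ) by omega)
      (show (0 : ℤ) ≤ C by omega)
    omega
  have hb : ∀ x ∈ L, x.1 ≤ (hi + 1 : ℕ) * (C : ℤ) - 1 := by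
    intro x hx
    obtain ⟨i, -, rfl⟩ := Multiset.mem_map.1 hx
    exact hκhi i
  refine Runs.seq_spec (descentPhase_spec (push := false) (by simp) hS hb hlob) ?_
  rintro σ₃ τ₃ - ⟨hτ₃, tr₃, cnt₃, L₃, hS₃, hb₃, hD₃⟩
  refine Runs.seq_spec (descentPhase_spec (push := true) (by simp) hS₃ hb₃ hlob) ?_
  rintro σ₄ τ₄ - ⟨hτ₄, tr₄, cnt₄, L₄, hS₄, -, hD₄⟩
  refine Runs.seq_spec (loadProg_spec hS₄.heap hS₄.list) ?_
  rintro σ₅ τ₅ hfr₅ ⟨hτ₅, hH₅, -⟩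
  refine Runs.seq_spec (mergeProg_spec hn hC0 hH₅ (hS₄.forest.congr (hfr₅.1 16 rfl) (hfr₅.2 5 rfl)
    (hfr₅.2 6 rfl) (hfr₅.2 7 rfl)) ((hfr₅.1 10 rfl).trans hS₄.reg10)) ?_
  rintro σ₆ τ₆ - ⟨hτ₆, tr₆, cnt₆, v, hF₆, hM⟩
  refine (expandProg_spec hF₆).mono ?_
  rintro σ₇ τ₇ ⟨hτ₇, p, q, hpq, hpl⟩
  refine ⟨?_, p, q, hpq, ?_⟩
  · have hcard := hS₄.forest.card_le
    rw [Multiset.card_map] at hcard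
    have hlogL : Nat.log 2 L₄.card ≤ Nat.log 2 n := Nat.log_mono_right hcard
    have b₅ : L₄.card * (60 * Nat.log 2 L₄.card + 80) ≤ n * unitCost n :=
      Nat.mul_le_mul hcard (by unfold unitCost; omega)
    have b₂ : n * (40 * c + 100) ≤ n * unitCost n := Nat.mul_le_mul_left _ (by unfold unitCost; omega)
    have b₁ : unitCost n ≤ n * unitCost n := Nat.le_mul_of_pos_left _ hn
    have b₀ : n * 700 ≤ n * unitCost n := Nat.mul_le_mul_left _ (by unfold unitCost; omega)
    have e₁ : 11 * unitCost n * n = 11 * (n * unitCost n) := by ring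
    have e₂ : 3 * unitCost n * n = 3 * (n * unitCost n) := by ring
    have e₃ : 30 * unitCost n * n = 30 * (n * unitCost n) := by ring
    rw [e₁] at hτ₃ hτ₄
    rw [e₂] at hτ₆
    rw [e₃]
    have hu : unitCost n = 150 * Nat.log 2 n + 700 := rfl
    omega
  · have hfr : freqs C tr L = Finset.univ.val.map fun i => (gridVal C (κ i), FTree.leaf i) := by
      rw [freqs, hLdef, Multiset.map_map]
      apply Multiset.map_congr rfl
      intro i _
      simp [tr]
    have h34 := forEach_of_desc hC0 hlo0
      (G := fun k j => CombineAll (if k = lo then C + j else 2) (gridFreq C k j))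
      (fun k j S S' _ _ _ S₁ h h' => by simpa [h'] using h) hD₃
    have h5 := forEach_of_desc hC0 hlo0
      (G := fun k j S S' => ∃ S₁, CombineAll (if k = lo then C + j else 2) (gridFreq C k j) S S₁ ∧
        S' = pushDown (gridFreq C k j) (gridFreq C k (j - 1)) S₁)
      (fun k j S S' _ _ _ S₁ h h' => ⟨S₁, h, by simpa using h'⟩) hD₄
    -- Splitting off the last layer of the first pass separates Step 3 from Step 4.
    rw [downTo_eq_append hlohi] at h34
    obtain ⟨S₃, h3, S', h4, hS'⟩ := h34.of_append
    obtain rfl : S' = freqs C tr₃ L₃ := hS'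
    rw [hfr] at h3
    refine ⟨lo, hi, C, fun i => gridVal C (κ i), S₃, freqs C tr₃ L₃, freqs C tr₄ L₄,
      ⟨hlo₁, fun m hm => ?_⟩, ⟨hhi₂, fun m hm => ?_⟩, rfl, fun i => ⟨⟨(hκ i).1, ?_⟩, ?_⟩,
      h3.imp fun k hk S S' hkS => hkS.imp fun j _ S S' h => ?_, h4.imp fun j _ S S' h => ?_, h5,
      v, tr₆ (cnt₆ - 1), hM, hpl⟩
    · have : (2 : ℝ) ^ m < 2 ^ (lo + 1) := lt_of_le_of_lt hm hlo₂
      have := (pow_lt_pow_iff_right₀ (one_lt_two (α := ℝ))).1 this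
      omega
    · have : (2 : ℝ) ^ hi < 2 ^ (m + 1) := lt_of_le_of_lt hhi₁ hm
      have := (pow_lt_pow_iff_right₀ (one_lt_two (α := ℝ))).1 this
      omega
    · have h0 := Int.emod_nonneg (κ i) (show (C : ℤ) ≠ 0 by omega)
      have h1 := Int.emod_lt_of_pos (κ i) (show (0 : ℤ) < C by omega)
      have h2 : (lo : ℤ) ≤ κ i / C := (Int.le_ediv_iff_mul_le (by omega)).2 (hκlo i)
      refine ⟨(κ i / C).toNat, (κ i % C).toNat, by omega, by omega, ?_⟩
      rw [gridFreq_eq (by omega), Int.toNat_of_nonneg (by omega), Int.toNat_of_nonneg h0,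
        Int.ediv_mul_add_emod]
    · rintro x ⟨hx, k, j, hk, hj, rfl⟩
      rw [gridFreq_eq hj] at hx ⊢
      have := hinj.lt_iff_lt.1 (hx.trans_lt (hκ i).2)
      exact hinj.monotone (by omega)
    · have := (mem_downTo.1 hk).1
      rwa [if_neg (by omega)] at h
    · rwa [if_pos rfl] at h

/-! ### Step counts in terms of the real logarithm -/

/-- Both `log 2` and `Nat.log 2 n * log 2` are at most `log (n + 1)`, whence the factor 2. The
argument `n + 1` keeps the bound positive at `n = 1`. -/
theorem natLog_le (n : ℕ) (hn : 0 < n) :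
    ((Nat.log 2 n + 1 : ℕ) : ℝ) ≤ 2 / Real.log 2 * Real.log (n + 1) := by
  have h2 : 0 < Real.log 2 := Real.log_pos one_lt_two
  have h1 : (1 : ℝ) ≤ n := by exact_mod_cast hn
  have h3 : Real.log 2 ≤ Real.log (n + 1) := Real.log_le_log two_pos (by linarith)
  have h4 : (Nat.log 2 n : ℝ) * Real.log 2 ≤ Real.log (n + 1) := by
    rw [← Real.log_pow]
    apply Real.log_le_log (by positivity)
    have : ((2 ^ Nat.log 2 n : ℕ) : ℝ) ≤ n := by exact_mod_cast Nat.pow_log_le_self 2 hn.ne'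
    push_cast at this
    linarith
  rw [div_mul_eq_mul_div, le_div_iff₀ h2]
  push_cast
  linarith

theorem unitCost_le (n : ℕ) (hn : 0 < n) :
    (unitCost n : ℝ) ≤ 1400 / Real.log 2 * Real.log (n + 1) := by
  have h1 : unitCost n ≤ 700 * (Nat.log 2 n + 1) := by unfold unitCost; omega
  have h2 : (unitCost n : ℝ) ≤ 700 * (Nat.log 2 n + 1 : ℕ) := by exact_mod_cast h1
  refine h2.trans ?_
  have := natLog_le n hn
  have e : 1400 / Real.log 2 * Real.log (n + 1) = 700 * (2 / Real.log 2 * Real.log (n + 1)) := by ring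
  rw [e]
  linarith

end BambooGarden

theorem mainTheorem7 :
    ∃ (main setup next : BambooGarden.Prog) (c : ℝ),
      -- the Main Algorithm in time `O(n log n)`
      (∀ (n : ℕ) (hn : 0 < n) (h : Fin n → ℝ), (∀ i, 0 < h i) → Antitone h →
        ∃ (σ : BambooGarden.Mem) (τ : ℕ) (p q : Fin n → ℕ),
          BambooGarden.Exec main (BambooGarden.inputMem h) σ τ ∧
          (τ : ℝ) ≤ c * (n * Real.log (n + 1)) ∧
          BambooGarden.HoldsPairs σ p q ∧
          BambooGarden.MainAlgorithm hn h p q ∧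
          BambooGarden.IsCyclicSchedule p q) ∧
      -- the schedule step by step from the pairs, in time `O(log n)` per step
      (∀ (n : ℕ) (p q : Fin n → ℕ), BambooGarden.IsCyclicSchedule p q →
        ∃ (σ : ℕ → BambooGarden.Mem) (t : ℕ → Fin n → ℕ) (item : ℕ → Fin n) (τ₀ : ℕ) (τ : ℕ → ℕ),
          BambooGarden.Exec setup (BambooGarden.pairsMem p q) (σ 0) τ₀ ∧
          (τ₀ : ℝ) ≤ c * (n * Real.log (n + 1)) ∧
          t 0 = p ∧
          ∀ T : ℕ,
            BambooGarden.HoldsQueue (σ T) (t T) ∧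
            (∀ i, t T (item T) ≤ t T i) ∧
            t (T + 1) = Function.update (t T) (item T) (t T (item T) + q (item T)) ∧
            BambooGarden.Exec next (σ T) (σ (T + 1)) (τ T) ∧
            (τ T : ℝ) ≤ c * Real.log (n + 1) ∧
            (σ (T + 1)).reg 1 = ((item T : ℕ) : ℝ) ∧
            ∃ k : ℕ, T = p (item T) + k * q (item T)) := by
  -- The constant is `30 * 700 * 2 / log 2`: thirty units per item, with `unitCost n` at most `700 *
  -- (Nat.log 2 n + 1)`.
  refine ⟨BambooGarden.mainProg, BambooGarden.setupProg, BambooGarden.nextProg,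
    42000 / Real.log 2, fun n hn h hpos hanti => ?_, fun n p q hpq => ?_⟩
  · obtain ⟨σ, τ, hx, hτ, p, q, hpq, hM⟩ := BambooGarden.mainProg_spec hn h hpos hanti
    refine ⟨σ, τ, p, q, hx, ?_, hpq, hM, hM.isCyclicSchedule⟩
    have h1 : (τ : ℝ) ≤ 30 * BambooGarden.unitCost n * n := by exact_mod_cast hτ
    refine h1.trans ?_
    have h2 := mul_le_mul_of_nonneg_right (BambooGarden.unitCost_le n hn) (Nat.cast_nonneg (α := ℝ) n)
    have e : 42000 / Real.log 2 * (n * Real.log (n + 1)) =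
      30 * (1400 / Real.log 2 * Real.log (n + 1) * n) := by ring
    rw [e]
    linarith
  -- Position `0` must receive an item, so a gap-free schedule has at least one.
  · have hn : 0 < n := by
      obtain ⟨i, -⟩ := hpq.2 0
      exact i.pos
    obtain ⟨σ, t, item, τ₀, τ, h₁, h₂, h₃, h₄⟩ := BambooGarden.exists_queue_run hn p q hpq
    have hu := BambooGarden.unitCost_le n hn
    have hl : 0 ≤ 1400 / Real.log 2 * Real.log (n + 1) := (Nat.cast_nonneg _).trans hu
    have hn1 : (1 : ℝ) ≤ n := by exact_mod_cast hn
    refine ⟨σ, t, item, τ₀, τ, h₁, ?_, h₃, fun T => ?_⟩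
    · have hb : τ₀ ≤ 30 * BambooGarden.unitCost n * n := by
        have b₁ : n * (60 * Nat.log 2 n + 60) ≤ n * BambooGarden.unitCost n :=
          Nat.mul_le_mul_left _ (by unfold BambooGarden.unitCost; omega)
        have b₂ : BambooGarden.unitCost n ≤ n * BambooGarden.unitCost n :=
          Nat.le_mul_of_pos_left _ hn
        have e : 30 * BambooGarden.unitCost n * n = 30 * (n * BambooGarden.unitCost n) := by ring
        have hu' : BambooGarden.unitCost n = 150 * Nat.log 2 n + 700 := rfl
        rw [e]
        omega
      have h1 : (τ₀ : ℝ) ≤ 30 * BambooGarden.unitCost n * n := by exact_mod_cast hb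
      refine h1.trans ?_
      have h2 := mul_le_mul_of_nonneg_right hu (Nat.cast_nonneg (α := ℝ) n)
      have e : 42000 / Real.log 2 * (n * Real.log (n + 1)) =
        30 * (1400 / Real.log 2 * Real.log (n + 1) * n) := by ring
      rw [e]
      linarith
    · obtain ⟨g₁, g₂, g₃, g₄, g₅, g₆, g₇⟩ := h₄ T
      refine ⟨g₁, g₂, g₃, g₄, ?_, g₆, g₇⟩
      have h1 : τ T ≤ BambooGarden.unitCost n := by unfold BambooGarden.unitCost; omega
      have h2 : (τ T : ℝ) ≤ BambooGarden.unitCost n := by exact_mod_cast h1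
      have e : 42000 / Real.log 2 * Real.log (n + 1) =
        30 * (1400 / Real.log 2 * Real.log (n + 1)) := by ring
      rw [e]
      linarith
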